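/- Let $p\ge 1$ and let $(\mathcal S,\omega,Q)$ be a symplectic Q$p$-manifold: a non-negatively graded manifold $\mathcal S$ with body a smooth manifold $M$ and local coordinates of degrees $0,\dots,p$, a vector field $Q$ of degree $1$ with $Q^2=0$, and a closed non-degenerate 2-form $\omega$ of degree $p$ with $\mathcal L_Q\omega=0$. Signs are governed by the total degree (degree plus form order). Let $\xi$ be the Euler vector field (acting on functions of degree $k$ as multiplication by $k$), and for a function $h$ of degree $q$ let $X_h$ be its Hamiltonian vector field, of degree $q-p$, with $\iota_{X_h}\omega=(-1)^{q+1}\mathrm dh$. Let $N$ be a compact oriented smooth manifold of dimension $p+2$ with boundary $\Sigma=\partial N$, which carries the induced (outward normal first) orientation, and let $\varphi\colon T[1]N\to\mathcal S$ be a degree preserving map, that is, a smooth map $N\to M$ together with a degree preserving algebra homomorphism $\varphi^*\colon C^\infty(\mathcal S)\to\Omega^\bullet(N)$ which extends the pull-back of functions on $M$. Then there is a unique algebra homomorphism $f^*\colon\Omega^\bullet(\mathcal S)\to\Omega^\bullet(N)$ (the pull-back along the field strength) with $$f^*(a)=\varphi^*(a),\qquad f^*(\mathrm da)=\mathrm d\,\varphi^*(a)-\varphi^*(Qa)\qquad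 (a\in C^\infty(\mathcal S)),$$ there is a unique function $\mathcal Q$ of degree $p+1$ with $Q=X_{\mathcal Q}$, and $$\int_N f^*\omega \;=\; S^{AKSZ}_{\Sigma,(cl)}[\varphi]\;:=\;\int_\Sigma\Big(\iota_{\mathrm d_\Sigma}\varphi^*\alpha+(-1)^{p+1}\varphi^*\mathcal Q\Big),\qquad \alpha=\tfrac1p\,\iota_\xi\omega ,$$ the classical action of the AKSZ topological sigma model on $\Sigma$ with target $\mathcal S$. Here $\varphi$ is restricted to $T[1]\Sigma$, and $\iota_{\mathrm d_\Sigma}\varphi^*$ is the restriction to 1-forms of the (unique) algebra homomorphism $\Omega^\bullet(\mathcal S)\to\Omega^\bullet(\Sigma)$ with $a\mapsto\varphi^*(a)$, $\mathrm da\mapsto\mathrm d\,\varphi^*(a)$; so $\iota_{\mathrm d_\Sigma}\varphi^*(a\,\mathrm db)=\varphi^*(a)\,\mathrm d\,\varphi^*(b)$. Moreover: (a) If $p=1$, this is the Poisson sigma model: $\{a,b\}=-X_{Qa}\,b$ is a Poisson bracket on $C^\infty(M)$; there are finitely many functions $x^i\in C^\infty(M)$ and $P_i$ of degree $1$ with $\omega=\sum_i\mathrm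 dP_i\,\mathrm dx^i$; and for every such choice, with $X^i=\varphi^*x^i$, $A_i=\varphi^*P_i$, $\pi^{ij}=\{x^i,x^j\}$, the integrand of $S^{AKSZ}_{\Sigma,(cl)}$ is $$\sum_i A_i\wedge\mathrm dX^i+\tfrac12\sum_{i,j}\pi^{ij}(X)\,A_i\wedge A_j .$$ (b) If $p=2$, this is the Courant sigma model: the functions of degree $1$ are the sections of a Courant algebroid over $M$ with pairing $\langle e,e'\rangle=X_e e'$, anchor $\rho(e)a=X_eQa$ and Dorfman bracket $[e,e']=(X_eQ+QX_e)e'$; there are finitely many functions $x^i,\xi^a,P_i$ of degrees $0,1,2$ and a constant symmetric matrix $(g_{ab})$ with $\omega=\sum_i\mathrm dP_i\,\mathrm dx^i+\tfrac12\sum_{a,b}g_{ab}\,\mathrm d\xi^a\,\mathrm d\xi^b$; and for every such choice, with $X^i=\varphi^*x^i$, $A^a=\varphi^*\xi^a$, $F_i=\varphi^*P_i$, $e_a=\sum_b g_{ab}\xi^b$, the integrand of $S^{AKSZ}_{\Sigma,(cl)}$ is $$\sum_i F_i\wedge\mathrm dX^i+\tfrac12\sum_{a,b}g_{ab}A^a\wedge\mathrm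 dA^b-\sum_{i,a}\big(\rho(e_a)x^i\big)(X)\,F_i\wedge A^a+\tfrac16\sum_{a,b,c}\langle[e_a,e_b],e_c\rangle(X)\,A^a\wedge A^b\wedge A^c .$$ -/

import Mathlib

open scoped Manifold ContDiff
open TopologicalSpace

noncomputable section

/-- The algebra of smooth real functions on `M`. -/
abbrev SmoothFn {E H : Type*} [NormedAddCommGroup E] [NormedSpace ℝ E] [TopologicalSpace H]
    (I : ModelWithCorners ℝ E H) (M : Type*) [TopologicalSpace M] [ChartedSpace H M] :=
  C^∞⟮I, M; 𝓘(ℝ, ℝ), ℝ⟯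

/-- The smooth function `x ↦ F (h₁ x, …, hₙ x)`. -/
def SmoothFn.comp {E H : Type*} [NormedAddCommGroup E] [NormedSpace ℝ E] [TopologicalSpace H]
    {I : ModelWithCorners ℝ E H} {M : Type*} [TopologicalSpace M] [ChartedSpace H M] {n : ℕ}
    (F : (Fin n → ℝ) → ℝ) (hF : ContDiff ℝ ∞ F) (h : Fin n → SmoothFn I M) : SmoothFn I M :=
  ⟨fun x => F fun i => h i x, by
    have h1 : ContMDiff I 𝓘(ℝ, Fin n → ℝ) ∞ (fun x => fun i => h i x) :=
      contMDiff_pi_space.2 fun i => (h i).contMDiff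
    exact hF.contMDiff.comp h1⟩

/-- The `i`-th partial derivative of a function on `ℝⁿ`. -/
def partialDeriv {n : ℕ} (F : (Fin n → ℝ) → ℝ) (i : Fin n) : (Fin n → ℝ) → ℝ :=
  fun v => fderiv ℝ F v (Pi.single i 1)

theorem partialDeriv_contDiff {n : ℕ} {F : (Fin n → ℝ) → ℝ} (hF : ContDiff ℝ ∞ F) (i : Fin n) :
    ContDiff ℝ ∞ (partialDeriv F i) :=
  (hF.fderiv_right (m := ∞) (by simp)).clm_apply contDiff_const

theorem partialDeriv_comm {n : ℕ} {F : (Fin n → ℝ) → ℝ} (hF : ContDiff ℝ ∞ F) (i j : Fin n) :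
    partialDeriv (partialDeriv F i) j = partialDeriv (partialDeriv F j) i := by
  have key : ∀ (i j : Fin n) v, partialDeriv (partialDeriv F i) j v =
      fderiv ℝ (fderiv ℝ F) v (Pi.single j 1) (Pi.single i 1) := by
    intro i j v
    have hd : DifferentiableAt ℝ (fderiv ℝ F) v :=
      ((hF.fderiv_right (m := ∞) (by simp)).differentiable (by simp)) v
    unfold partialDeriv
    rw [fderiv_clm_apply hd (differentiableAt_const _)]
    simp
  funext v
  rw [key, key]
  exact (hF.contDiffAt.isSymmSndFDerivAt (by simpa using WithTop.coe_le_coe.2 (le_top (a := (2 : ℕ∞))))) _ _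

universe uM uA

/-- A graded-commutative algebra `⨁ₖ deg k`, `k ≥ 0`, whose part of degree zero is the algebra
of smooth functions on `M`. -/
structure GradedFnAlg {E H : Type*} [NormedAddCommGroup E] [NormedSpace ℝ E] [TopologicalSpace H]
    (I : ModelWithCorners ℝ E H) (M : Type*) [TopologicalSpace M] [ChartedSpace H M] where
  carrier : Type uA
  [ring : Ring carrier]
  [algebra : Algebra ℝ carrier]
  deg : ℕ → Submodule ℝ carrier
  [graded : GradedAlgebra deg]
  comm : ∀ {i j : ℕ} {a b : carrier}, a ∈ deg i → b ∈ deg j →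
    a * b = (-1 : ℝ) ^ (i * j) • (b * a)
  ofSmooth : SmoothFn I M →ₐ[ℝ] carrier
  ofSmooth_injective : Function.Injective ofSmooth
  mem_deg_zero : ∀ a, a ∈ deg 0 ↔ ∃ h, ofSmooth h = a

attribute [instance] GradedFnAlg.ring GradedFnAlg.algebra GradedFnAlg.graded

theorem neg_one_zpow_sub_one (q : ℤ) : (-1 : ℝ) ^ (q - 1) = (-1) * (-1) ^ q := by
  rw [zpow_sub_one₀ (by norm_num)]; norm_num

theorem neg_one_pow_of_add {q : ℤ} {j k : ℕ} (hk : (j : ℤ) + q = k) :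
    (-1 : ℝ) ^ k = (-1) ^ j * (-1) ^ q := by
  rw [← zpow_natCast, ← hk, zpow_add₀ (by norm_num), zpow_natCast]

theorem neg_one_zpow_mul_self (q : ℤ) : (-1 : ℝ) ^ q * (-1) ^ q = 1 := by
  rw [← mul_zpow]; simp

theorem sign_identity_one (q : ℤ) (i : ℕ) :
    (-1 : ℝ) ^ (q * i) = (-1) ^ i * ((-1) ^ (q - 1)) ^ i := by
  rw [zpow_mul, zpow_natCast, neg_one_zpow_sub_one, ← mul_pow]
  congr 1; ring

theorem sign_identity_two {q : ℤ} {j k : ℕ} (hk : (j : ℤ) + q = k) (i : ℕ) :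
    ((-1 : ℝ) ^ (q - 1)) ^ i * (-1) ^ (i * k) = (-1) ^ (i * (j + 1)) := by
  rw [mul_comm i k, mul_comm i (j + 1), pow_mul, pow_mul, neg_one_pow_of_add hk,
    neg_one_zpow_sub_one, ← mul_pow, pow_succ (-1 : ℝ) j]
  congr 1
  linear_combination (-(-1 : ℝ) ^ j) * neg_one_zpow_mul_self q

theorem sign_identity_three {q : ℤ} {i k : ℕ} (hk : (i : ℤ) + q = k) (j : ℕ) :
    (-1 : ℝ) ^ (k * (j + 1)) = (-1) ^ ((i + 1) * (j + 1)) * ((-1) ^ (q - 1)) ^ (j + 1) := by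
  rw [pow_mul, pow_mul, neg_one_pow_of_add hk, neg_one_zpow_sub_one, ← mul_pow,
    pow_succ (-1 : ℝ) i]
  congr 1; ring

namespace GradedFnAlg

variable {E H : Type*} [NormedAddCommGroup E] [NormedSpace ℝ E] [TopologicalSpace H]
  {I : ModelWithCorners ℝ E H} {M : Type*} [TopologicalSpace M] [ChartedSpace H M]
  (G : GradedFnAlg I M)

/-- The components indexed by all integers: `deg k` for `k ≥ 0`, zero for `k < 0`. -/
def degZ (k : ℤ) : Submodule ℝ G.carrier := if 0 ≤ k then G.deg k.toNat else ⊥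

/-- The linear map acting on `deg k` as multiplication by `c k`. -/
def scale (c : ℕ → ℝ) : G.carrier →ₗ[ℝ] G.carrier :=
  (DirectSum.toModule ℝ ℕ G.carrier fun k => c k • (G.deg k).subtype).comp
    (DirectSum.decomposeLinearEquiv G.deg).toLinearMap

theorem scale_of_mem (c : ℕ → ℝ) {k : ℕ} {a : G.carrier} (ha : a ∈ G.deg k) :
    G.scale c a = c k • a := by
  have h : DirectSum.decomposeLinearEquiv G.deg a = DirectSum.lof ℝ ℕ (fun k => G.deg k) k ⟨a, ha⟩ :=
    DirectSum.decompose_of_mem G.deg ha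
  simp only [scale, LinearMap.comp_apply, LinearEquiv.coe_coe, h, DirectSum.toModule_lof]
  simp

theorem homogeneous_induction {P : G.carrier → Prop} (h0 : P 0)
    (hh : ∀ k, ∀ a ∈ G.deg k, P a) (ha : ∀ a b, P a → P b → P (a + b)) (a : G.carrier) : P a :=
  DirectSum.Decomposition.inductionOn G.deg h0 (fun {i} m => hh i m m.2) ha a

theorem scale_pow_mul (c : ℝ) (a b : G.carrier) :
    G.scale (c ^ ·) (a * b) = G.scale (c ^ ·) a * G.scale (c ^ ·) b := by
  induction a using G.homogeneous_induction with
  | h0 => simp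
  | ha a a' h h' => simp [add_mul, h, h']
  | hh i a hai =>
    induction b using G.homogeneous_induction with
    | h0 => simp
    | ha b b' h h' => simp [mul_add, h, h']
    | hh j b hbj =>
      rw [G.scale_of_mem _ (SetLike.mul_mem_graded hai hbj), G.scale_of_mem _ hai,
        G.scale_of_mem _ hbj]
      simp [pow_add, smul_smul, mul_comm]

theorem scale_smooth (c : ℝ) (h : SmoothFn I M) :
    G.scale (c ^ ·) (G.ofSmooth h) = G.ofSmooth h := by
  rw [G.scale_of_mem _ ((G.mem_deg_zero _).2 ⟨h, rfl⟩)]; simp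

theorem scale_algebraMap (c r : ℝ) :
    G.scale (c ^ ·) (algebraMap ℝ G.carrier r) = algebraMap ℝ G.carrier r := by
  have := G.scale_smooth c (algebraMap ℝ _ r)
  simpa using this

/-- A vector field of degree `q` on the graded manifold with function algebra `G`: a graded
derivation of degree `q`. The chain rule on smooth functions of degree zero is automatic on
graded manifolds (Hadamard's lemma); it is recorded so that the contraction with forms is
visibly well defined. -/
structure VField (q : ℤ) where
  toFun : G.carrier →ₗ[ℝ] G.carrier
  map_deg : ∀ {i : ℕ} {a : G.carrier}, a ∈ G.deg i → toFun a ∈ G.degZ (i + q)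
  leibniz : ∀ {i : ℕ} {a : G.carrier} (b : G.carrier), a ∈ G.deg i →
    toFun (a * b) = toFun a * b + (-1 : ℝ) ^ (q * i) • (a * toFun b)
  chain : ∀ {n : ℕ} (F : (Fin n → ℝ) → ℝ) (hF : ContDiff ℝ ∞ F) (h : Fin n → SmoothFn I M),
    toFun (G.ofSmooth (SmoothFn.comp F hF h)) =
      ∑ i, G.ofSmooth (SmoothFn.comp _ (partialDeriv_contDiff hF i) h) * toFun (G.ofSmooth (h i))

/-- The Euler vector field, acting on functions of degree `k` as multiplication by `k`. -/
def euler : G.VField 0 where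
  toFun := G.scale (fun k => (k : ℝ))
  map_deg := by
    intro i a ha
    rw [G.scale_of_mem _ ha]
    simpa [degZ] using Submodule.smul_mem _ _ ha
  leibniz := by
    intro i a b ha
    induction b using G.homogeneous_induction with
    | h0 => simp
    | ha b b' h h' => simp only [mul_add, map_add, h, h', smul_add]; abel
    | hh j b hbj =>
      rw [G.scale_of_mem _ (SetLike.mul_mem_graded ha hbj), G.scale_of_mem _ ha,
        G.scale_of_mem _ hbj]
      simp [add_smul]
  chain := by
    intro n F hF h
    have key : ∀ h : SmoothFn I M, G.scale (fun k => (k : ℝ)) (G.ofSmooth h) = 0 := by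
      intro h
      rw [G.scale_of_mem _ ((G.mem_deg_zero _).2 ⟨h, rfl⟩)]; simp
    simp [key]

/-- The relations among functions `a` (left summand) and differentials `d a` (right summand). -/
inductive FormRel : FreeAlgebra ℝ (G.carrier ⊕ G.carrier) →
    FreeAlgebra ℝ (G.carrier ⊕ G.carrier) → Prop
  | fn_add (a b) : FormRel (.ι ℝ (.inl (a + b))) (.ι ℝ (.inl a) + .ι ℝ (.inl b))
  | fn_mul (a b) : FormRel (.ι ℝ (.inl (a * b))) (.ι ℝ (.inl a) * .ι ℝ (.inl b))
  | fn_const (r : ℝ) : FormRel (.ι ℝ (.inl (algebraMap ℝ G.carrier r))) (algebraMap ℝ _ r)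
  | d_add (a b) : FormRel (.ι ℝ (.inr (a + b))) (.ι ℝ (.inr a) + .ι ℝ (.inr b))
  | d_smul (r : ℝ) (a) : FormRel (.ι ℝ (.inr (r • a))) (r • .ι ℝ (.inr a))
  | d_mul {i : ℕ} {a} (b) : a ∈ G.deg i → FormRel (.ι ℝ (.inr (a * b)))
      (.ι ℝ (.inr a) * .ι ℝ (.inl b) + (-1 : ℝ) ^ i • (.ι ℝ (.inl a) * .ι ℝ (.inr b)))
  | fn_d_comm {i j : ℕ} {a b} : a ∈ G.deg i → b ∈ G.deg j →
      FormRel (.ι ℝ (.inl a) * .ι ℝ (.inr b))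
        ((-1 : ℝ) ^ (i * (j + 1)) • (.ι ℝ (.inr b) * .ι ℝ (.inl a)))
  | d_d_comm {i j : ℕ} {a b} : a ∈ G.deg i → b ∈ G.deg j →
      FormRel (.ι ℝ (.inr a) * .ι ℝ (.inr b))
        ((-1 : ℝ) ^ ((i + 1) * (j + 1)) • (.ι ℝ (.inr b) * .ι ℝ (.inr a)))
  | chain {n : ℕ} (F : (Fin n → ℝ) → ℝ) (hF : ContDiff ℝ ∞ F) (h : Fin n → SmoothFn I M) :
      FormRel (.ι ℝ (.inr (G.ofSmooth (SmoothFn.comp F hF h))))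
        (∑ i, .ι ℝ (.inl (G.ofSmooth (SmoothFn.comp _ (partialDeriv_contDiff hF i) h))) *
          .ι ℝ (.inr (G.ofSmooth (h i))))

/-- The algebra of differential forms: generated by functions and their differentials, with
signs governed by the total degree. -/
def Form : Type _ := RingQuot G.FormRel

instance : Ring G.Form := inferInstanceAs (Ring (RingQuot G.FormRel))
instance : Algebra ℝ G.Form := inferInstanceAs (Algebra ℝ (RingQuot G.FormRel))

/-- The quotient map. -/
def mkForm : FreeAlgebra ℝ (G.carrier ⊕ G.carrier) →ₐ[ℝ] G.Form := RingQuot.mkAlgHom ℝ G.FormRel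

theorem mkForm_rel {x y : FreeAlgebra ℝ (G.carrier ⊕ G.carrier)} (h : G.FormRel x y) :
    G.mkForm x = G.mkForm y := RingQuot.mkAlgHom_rel ℝ h

theorem mkForm_surjective : Function.Surjective G.mkForm := RingQuot.mkAlgHom_surjective ℝ G.FormRel

/-- A function as a form of order zero. -/
def fn (a : G.carrier) : G.Form := G.mkForm (.ι ℝ (.inl a))

/-- The differential of a function. -/
def df (a : G.carrier) : G.Form := G.mkForm (.ι ℝ (.inr a))

/-- Images of functions and differentials that satisfy the defining relations of forms. -/
structure IsFormHom {B : Type*} [Ring B] [Algebra ℝ B] (u v : G.carrier → B) : Prop where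
  fn_add : ∀ a b, u (a + b) = u a + u b
  fn_mul : ∀ a b, u (a * b) = u a * u b
  fn_const : ∀ r : ℝ, u (algebraMap ℝ G.carrier r) = algebraMap ℝ B r
  d_add : ∀ a b, v (a + b) = v a + v b
  d_smul : ∀ (r : ℝ) a, v (r • a) = r • v a
  d_mul : ∀ {i : ℕ} {a} (b), a ∈ G.deg i → v (a * b) = v a * u b + (-1 : ℝ) ^ i • (u a * v b)
  fn_d_comm : ∀ {i j : ℕ} {a b}, a ∈ G.deg i → b ∈ G.deg j →
    u a * v b = (-1 : ℝ) ^ (i * (j + 1)) • (v b * u a)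
  d_d_comm : ∀ {i j : ℕ} {a b}, a ∈ G.deg i → b ∈ G.deg j →
    v a * v b = (-1 : ℝ) ^ ((i + 1) * (j + 1)) • (v b * v a)
  chain : ∀ {n : ℕ} (F : (Fin n → ℝ) → ℝ) (hF : ContDiff ℝ ∞ F) (h : Fin n → SmoothFn I M),
    v (G.ofSmooth (SmoothFn.comp F hF h)) =
      ∑ i, u (G.ofSmooth (SmoothFn.comp _ (partialDeriv_contDiff hF i) h)) * v (G.ofSmooth (h i))

theorem isFormHom : G.IsFormHom G.fn G.df where
  fn_add a b := by simpa [fn, df] using G.mkForm_rel (FormRel.fn_add a b)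
  fn_mul a b := by simpa [fn, df] using G.mkForm_rel (FormRel.fn_mul a b)
  fn_const r := by
    have := G.mkForm_rel (FormRel.fn_const r)
    rwa [AlgHom.commutes] at this
  d_add a b := by simpa [fn, df] using G.mkForm_rel (FormRel.d_add a b)
  d_smul r a := by simpa [fn, df] using G.mkForm_rel (FormRel.d_smul r a)
  d_mul b ha := by simpa [fn, df] using G.mkForm_rel (FormRel.d_mul b ha)
  fn_d_comm ha hb := by simpa [fn, df] using G.mkForm_rel (FormRel.fn_d_comm ha hb)
  d_d_comm ha hb := by simpa [fn, df] using G.mkForm_rel (FormRel.d_d_comm ha hb)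
  chain F hF h := by simpa [fn, df] using G.mkForm_rel (FormRel.chain F hF h)

variable {G} in
/-- The algebra homomorphism out of the forms with prescribed values on functions and
differentials. -/
def IsFormHom.lift {B : Type*} [Ring B] [Algebra ℝ B] {u v : G.carrier → B}
    (h : G.IsFormHom u v) : G.Form →ₐ[ℝ] B :=
  RingQuot.liftAlgHom ℝ ⟨FreeAlgebra.lift ℝ (Sum.elim u v), by
    intro x y hxy
    induction hxy with
    | fn_add a b => simpa using h.fn_add a b
    | fn_mul a b => simpa using h.fn_mul a b
    | fn_const r => simpa using h.fn_const r
    | d_add a b => simpa using h.d_add a b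
    | d_smul r a => simpa using h.d_smul r a
    | d_mul b ha => simpa using h.d_mul b ha
    | fn_d_comm ha hb => simpa using h.fn_d_comm ha hb
    | d_d_comm ha hb => simpa using h.d_d_comm ha hb
    | chain F hF k => simpa using h.chain F hF k⟩

variable {G} in
theorem IsFormHom.lift_mk {B : Type*} [Ring B] [Algebra ℝ B] {u v : G.carrier → B}
    (h : G.IsFormHom u v) (x : FreeAlgebra ℝ (G.carrier ⊕ G.carrier)) :
    h.lift (G.mkForm x) = FreeAlgebra.lift ℝ (Sum.elim u v) x :=
  RingQuot.liftAlgHom_mkAlgHom_apply _ _ _ _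

variable {G} in
theorem IsFormHom.lift_fn {B : Type*} [Ring B] [Algebra ℝ B] {u v : G.carrier → B}
    (h : G.IsFormHom u v) (a : G.carrier) : h.lift (G.fn a) = u a := by
  simp [fn, h.lift_mk]

variable {G} in
theorem IsFormHom.lift_df {B : Type*} [Ring B] [Algebra ℝ B] {u v : G.carrier → B}
    (h : G.IsFormHom u v) (a : G.carrier) : h.lift (G.df a) = v a := by
  simp [df, h.lift_mk]

theorem fn_smul (r : ℝ) (a : G.carrier) : G.fn (r • a) = r • G.fn a := by
  rw [Algebra.smul_def, G.isFormHom.fn_mul, G.isFormHom.fn_const, ← Algebra.smul_def]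

theorem isFormHom_twist (c : ℝ) : G.IsFormHom (fun a => G.fn (G.scale (c ^ ·) a))
    (fun a => c • G.df (G.scale (c ^ ·) a)) where
  fn_add a b := by simp [G.isFormHom.fn_add]
  fn_mul a b := by simp [G.scale_pow_mul, G.isFormHom.fn_mul]
  fn_const r := by rw [G.scale_algebraMap, G.isFormHom.fn_const]
  d_add a b := by simp [G.isFormHom.d_add]
  d_smul r a := by rw [map_smul, G.isFormHom.d_smul, smul_comm]
  d_mul {i a} b ha := by
    rw [G.scale_pow_mul, G.scale_of_mem _ ha, G.isFormHom.d_mul _ (Submodule.smul_mem _ _ ha)]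
    simp only [smul_mul_assoc, mul_smul_comm, smul_add, smul_comm c]
  fn_d_comm {i j a b} ha hb := by
    rw [G.scale_of_mem _ ha, G.scale_of_mem _ hb, mul_smul_comm, smul_mul_assoc,
      G.isFormHom.fn_d_comm (Submodule.smul_mem _ _ ha) (Submodule.smul_mem _ _ hb), smul_comm c]
  d_d_comm {i j a b} ha hb := by
    rw [G.scale_of_mem _ ha, G.scale_of_mem _ hb, mul_smul_comm, smul_mul_assoc,
      G.isFormHom.d_d_comm (Submodule.smul_mem _ _ ha) (Submodule.smul_mem _ _ hb), smul_mul_smul_comm,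
      smul_smul, smul_comm (c * c)]
  chain F hF h := by
    simp only [G.scale_smooth, G.isFormHom.chain, Finset.smul_sum, mul_smul_comm]

/-- The automorphism (for `c ≠ 0`) multiplying forms of total degree `k` by `c ^ k`. -/
def twist (c : ℝ) : G.Form →ₐ[ℝ] G.Form := (G.isFormHom_twist c).lift

theorem twist_fn (c : ℝ) {i : ℕ} {a : G.carrier} (ha : a ∈ G.deg i) :
    G.twist c (G.fn a) = c ^ i • G.fn a := by
  rw [twist, IsFormHom.lift_fn, G.scale_of_mem _ ha, fn_smul]

theorem twist_df (c : ℝ) {i : ℕ} {a : G.carrier} (ha : a ∈ G.deg i) :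
    G.twist c (G.df a) = c ^ (i + 1) • G.df a := by
  rw [twist, IsFormHom.lift_df, G.scale_of_mem _ ha, G.isFormHom.d_smul, smul_smul, pow_succ']

/-- Upper triangular matrices, used to turn super derivations into algebra homomorphisms. -/
def tri (x y z : G.Form) : Matrix (Fin 2) (Fin 2) G.Form := !![x, y; 0, z]

theorem tri_add (x y z x' y' z' : G.Form) :
    G.tri x y z + G.tri x' y' z' = G.tri (x + x') (y + y') (z + z') := by
  ext i j; fin_cases i <;> fin_cases j <;> simp [tri]

theorem tri_mul (x y z x' y' z' : G.Form) :
    G.tri x y z * G.tri x' y' z' = G.tri (x * x') (x * y' + y * z') (z * z') := by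
  ext i j; fin_cases i <;> fin_cases j <;> simp [tri, Matrix.mul_apply]

theorem tri_smul (r : ℝ) (x y z : G.Form) : r • G.tri x y z = G.tri (r • x) (r • y) (r • z) := by
  ext i j; fin_cases i <;> fin_cases j <;> simp [tri]

theorem tri_sum {n : ℕ} (x y z : Fin n → G.Form) :
    ∑ i, G.tri (x i) (y i) (z i) = G.tri (∑ i, x i) (∑ i, y i) (∑ i, z i) := by
  ext i j; fin_cases i <;> fin_cases j <;> simp [tri, Matrix.sum_apply]

/-- `u` on functions and `v` on differentials extend to a super derivation `D`, that is,
`D (x y) = D x · y + c ^ deg x · x · D y` for the sign `c` (the parity of `D`). -/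
structure IsSuperDer (c : ℝ) (u v : G.carrier → G.Form) : Prop where
  fn_add : ∀ a b, u (a + b) = u a + u b
  fn_mul : ∀ a b, u (a * b) = G.twist c (G.fn a) * u b + u a * G.fn b
  fn_const : ∀ r : ℝ, u (algebraMap ℝ G.carrier r) = 0
  d_add : ∀ a b, v (a + b) = v a + v b
  d_smul : ∀ (r : ℝ) a, v (r • a) = r • v a
  d_mul : ∀ {i : ℕ} {a} (b), a ∈ G.deg i → v (a * b) =
    (G.twist c (G.df a) * u b + v a * G.fn b) +
      (-1 : ℝ) ^ i • (G.twist c (G.fn a) * v b + u a * G.df b)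
  fn_d_comm : ∀ {i j : ℕ} {a b}, a ∈ G.deg i → b ∈ G.deg j →
    G.twist c (G.fn a) * v b + u a * G.df b =
      (-1 : ℝ) ^ (i * (j + 1)) • (G.twist c (G.df b) * u a + v b * G.fn a)
  d_d_comm : ∀ {i j : ℕ} {a b}, a ∈ G.deg i → b ∈ G.deg j →
    G.twist c (G.df a) * v b + v a * G.df b =
      (-1 : ℝ) ^ ((i + 1) * (j + 1)) • (G.twist c (G.df b) * v a + v b * G.df a)
  chain : ∀ {n : ℕ} (F : (Fin n → ℝ) → ℝ) (hF : ContDiff ℝ ∞ F) (h : Fin n → SmoothFn I M),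
    v (G.ofSmooth (SmoothFn.comp F hF h)) =
      ∑ i, (G.twist c (G.fn (G.ofSmooth (SmoothFn.comp _ (partialDeriv_contDiff hF i) h))) *
        v (G.ofSmooth (h i)) +
        u (G.ofSmooth (SmoothFn.comp _ (partialDeriv_contDiff hF i) h)) * G.df (G.ofSmooth (h i)))

variable {G} in
theorem IsSuperDer.isFormHom {c : ℝ} {u v : G.carrier → G.Form} (h : G.IsSuperDer c u v) :
    G.IsFormHom (fun a => G.tri (G.twist c (G.fn a)) (u a) (G.fn a))
      (fun a => G.tri (G.twist c (G.df a)) (v a) (G.df a)) where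
  fn_add a b := by simp only [h.fn_add, tri_add, G.isFormHom.fn_add, map_add]
  fn_mul a b := by simp only [h.fn_mul, tri_mul, G.isFormHom.fn_mul, map_mul]
  fn_const r := by
    rw [h.fn_const, G.isFormHom.fn_const, AlgHom.commutes]
    ext i j; fin_cases i <;> fin_cases j <;> simp [tri, Matrix.algebraMap_matrix_apply]
  d_add a b := by simp only [h.d_add, tri_add, G.isFormHom.d_add, map_add]
  d_smul r a := by simp only [h.d_smul, tri_smul, G.isFormHom.d_smul, map_smul]
  d_mul b ha := by
    simp only [h.d_mul b ha, tri_mul, tri_smul, tri_add, G.isFormHom.d_mul b ha, map_mul, map_add,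
      map_smul]
  fn_d_comm ha hb := by
    simp only [tri_mul, tri_smul, h.fn_d_comm ha hb, G.isFormHom.fn_d_comm ha hb, ← map_mul,
      map_smul]
  d_d_comm ha hb := by
    simp only [tri_mul, tri_smul, h.d_d_comm ha hb, ← map_mul]
    rw [G.isFormHom.d_d_comm ha hb, map_smul]
  chain F hF k := by
    simp only [tri_mul, tri_sum, h.chain F hF k, G.isFormHom.chain F hF k, map_sum, map_mul]

variable {G} in
/-- The super derivation of the algebra of forms with the given values on generators. -/
def IsSuperDer.toLinearMap {c : ℝ} {u v : G.carrier → G.Form} (h : G.IsSuperDer c u v) :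
    G.Form →ₗ[ℝ] G.Form where
  toFun x := h.isFormHom.lift x 0 1
  map_add' x y := by simp
  map_smul' r x := by simp

variable {G} in
theorem IsSuperDer.apply_fn {c : ℝ} {u v : G.carrier → G.Form} (h : G.IsSuperDer c u v)
    (a : G.carrier) : h.toLinearMap (G.fn a) = u a := by
  simp [toLinearMap, IsFormHom.lift_fn, tri]

variable {G} in
theorem IsSuperDer.apply_df {c : ℝ} {u v : G.carrier → G.Form} (h : G.IsSuperDer c u v)
    (a : G.carrier) : h.toLinearMap (G.df a) = v a := by
  simp [toLinearMap, IsFormHom.lift_df, tri]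

variable {G} in
theorem IsSuperDer.lift_apply {c : ℝ} {u v : G.carrier → G.Form} (h : G.IsSuperDer c u v)
    (x : G.Form) : h.isFormHom.lift x = G.tri (G.twist c x) (h.toLinearMap x) x := by
  suffices hx : ∃ y, h.isFormHom.lift x = G.tri (G.twist c x) y x by
    obtain ⟨y, hy⟩ := hx
    have : h.toLinearMap x = y := by change h.isFormHom.lift x 0 1 = y; rw [hy]; simp [tri]
    rw [hy, this]
  obtain ⟨x, rfl⟩ := G.mkForm_surjective x
  induction x using FreeAlgebra.induction with
  | grade0 r =>
    refine ⟨0, ?_⟩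
    simp only [AlgHom.commutes]
    ext i j; fin_cases i <;> fin_cases j <;> simp [tri, Matrix.algebraMap_matrix_apply]
  | grade1 x =>
    cases x with
    | inl a => exact ⟨u a, h.isFormHom.lift_fn a⟩
    | inr a => exact ⟨v a, h.isFormHom.lift_df a⟩
  | mul x y hx hy =>
    obtain ⟨x', hx⟩ := hx
    obtain ⟨y', hy⟩ := hy
    exact ⟨_, by rw [map_mul, map_mul, hx, hy, tri_mul, map_mul]⟩
  | add x y hx hy =>
    obtain ⟨x', hx⟩ := hx
    obtain ⟨y', hy⟩ := hy
    exact ⟨_, by rw [map_add, map_add, hx, hy, tri_add, map_add]⟩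

variable {G} in
theorem IsSuperDer.apply_mul {c : ℝ} {u v : G.carrier → G.Form} (h : G.IsSuperDer c u v)
    (x y : G.Form) :
    h.toLinearMap (x * y) = h.toLinearMap x * y + G.twist c x * h.toLinearMap y := by
  change h.isFormHom.lift (x * y) 0 1 = _
  rw [map_mul, h.lift_apply, h.lift_apply, tri_mul]
  simp [tri, add_comm]

theorem isSuperDer_d : G.IsSuperDer (-1) G.df (fun _ => 0) where
  fn_add := G.isFormHom.d_add
  fn_mul a b := by
    induction a using G.homogeneous_induction with
    | h0 =>
      have h1 : G.df 0 = 0 := by simpa using G.isFormHom.d_smul 0 0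
      have h2 : G.fn 0 = 0 := by simpa using G.fn_smul 0 0
      simp [h1, h2]
    | ha a a' h h' =>
      rw [add_mul, G.isFormHom.d_add, h, h', G.isFormHom.d_add, G.isFormHom.fn_add, map_add]
      noncomm_ring
    | hh i a ha => rw [G.isFormHom.d_mul b ha, G.twist_fn _ ha, smul_mul_assoc, add_comm]
  fn_const r := by
    have h1 : G.df (1 * 1) = _ := G.isFormHom.d_mul (i := 0) 1 SetLike.GradedOne.one_mem
    have h2 : G.fn 1 = 1 := by simpa using G.isFormHom.fn_const 1
    rw [Algebra.algebraMap_eq_smul_one, G.isFormHom.d_smul]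
    simp [h2] at h1
    simp [h1]
  d_add a b := by simp
  d_smul r a := by simp
  d_mul {i a} b ha := by
    rw [G.twist_df _ ha, pow_succ]; simp [neg_smul]
  fn_d_comm {i j a b} ha hb := by
    rw [G.twist_df _ hb, smul_mul_assoc, G.isFormHom.d_d_comm ha hb]
    simp only [mul_zero, zero_add, zero_mul, add_zero, smul_smul]
    congr 1; ring
  d_d_comm ha hb := by simp
  chain {n} F hF h := by
    simp only [mul_zero, zero_add, G.isFormHom.chain, Finset.sum_mul]
    set T : Fin n → Fin n → G.Form := fun i j =>
      G.fn (G.ofSmooth (SmoothFn.comp _ (partialDeriv_contDiff (partialDeriv_contDiff hF i) j) h)) *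
        G.df (G.ofSmooth (h j)) * G.df (G.ofSmooth (h i)) with hT
    have hanti : ∀ i j, T i j = - T j i := by
      intro i j
      have h1 := G.isFormHom.d_d_comm ((G.mem_deg_zero _).2 ⟨h j, rfl⟩)
        ((G.mem_deg_zero _).2 ⟨h i, rfl⟩)
      have h2 : SmoothFn.comp _ (partialDeriv_contDiff (partialDeriv_contDiff hF i) j) h =
          SmoothFn.comp _ (partialDeriv_contDiff (partialDeriv_contDiff hF j) i) h := by
        simp only [partialDeriv_comm hF i j]
      simp only [hT, h2, mul_assoc]
      rw [h1]; simp [neg_smul]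
    have hsum : ∑ i, ∑ j, T i j = - ∑ i, ∑ j, T i j := by
      conv_rhs => rw [Finset.sum_comm]
      simp only [← Finset.sum_neg_distrib]
      exact Finset.sum_congr rfl fun i _ => Finset.sum_congr rfl fun j _ => hanti i j
    have h0 : ∑ i, ∑ j, T i j = 0 := by
      have h2 : (2 : ℝ) • ∑ i, ∑ j, T i j = 0 := by
        rw [two_smul]; nth_rewrite 1 [hsum]; simp
      exact (smul_eq_zero_iff_right (two_ne_zero)).1 h2
    exact h0.symm

/-- The de Rham differential of forms. -/
def d : G.Form →ₗ[ℝ] G.Form := G.isSuperDer_d.toLinearMap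

theorem degZ_mem {k : ℤ} {a : G.carrier} (ha : a ∈ G.degZ k) :
    a = 0 ∨ ∃ i : ℕ, k = i ∧ a ∈ G.deg i := by
  unfold degZ at ha
  split_ifs at ha with h
  · exact Or.inr ⟨k.toNat, (Int.toNat_of_nonneg h).symm, ha⟩
  · exact Or.inl (by simpa using ha)

theorem fn_comm {i j : ℕ} {a b : G.carrier} (ha : a ∈ G.deg i) (hb : b ∈ G.deg j) :
    G.fn a * G.fn b = (-1 : ℝ) ^ (i * j) • (G.fn b * G.fn a) := by
  rw [← G.isFormHom.fn_mul, G.comm ha hb, G.fn_smul, G.isFormHom.fn_mul]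

theorem fn_zero : G.fn 0 = 0 := by simpa using G.fn_smul 0 0

variable {G} in
theorem VField.isSuperDer {q : ℤ} (X : G.VField q) :
    G.IsSuperDer ((-1) ^ (q - 1)) (fun _ => 0) (fun a => G.fn (X.toFun a)) where
  fn_add a b := by simp
  fn_mul a b := by simp
  fn_const r := rfl
  d_add a b := by simp [G.isFormHom.fn_add]
  d_smul r a := by simp [G.fn_smul]
  d_mul {i a} b ha := by
    rw [X.leibniz b ha, G.twist_fn _ ha, G.isFormHom.fn_add, G.fn_smul, G.isFormHom.fn_mul,
      G.isFormHom.fn_mul]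
    simp only [mul_zero, zero_add, zero_mul, add_zero, smul_mul_assoc, smul_smul]
    congr 2
    exact sign_identity_one q i
  fn_d_comm {i j a b} ha hb := by
    rw [G.twist_fn _ ha]
    rcases G.degZ_mem (X.map_deg hb) with h | ⟨k, hk, h⟩
    · simp [h, G.fn_zero]
    · simp only [mul_zero, zero_add, zero_mul, add_zero, smul_mul_assoc, G.fn_comm ha h, smul_smul]
      congr 1
      exact sign_identity_two hk i
  d_d_comm {i j a b} ha hb := by
    have key : ∀ {i j : ℕ} {a b : G.carrier}, a ∈ G.deg i → b ∈ G.deg j →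
        G.fn (X.toFun a) * G.df b = (-1 : ℝ) ^ ((i + 1) * (j + 1)) •
          (((-1 : ℝ) ^ (q - 1)) ^ (j + 1) • (G.df b * G.fn (X.toFun a))) := by
      intro i j a b ha hb
      rcases G.degZ_mem (X.map_deg ha) with h | ⟨k, hk, h⟩
      · simp [h, G.fn_zero]
      · rw [G.isFormHom.fn_d_comm h hb, smul_smul]
        congr 1
        exact sign_identity_three hk j
    have key2 : ((-1 : ℝ) ^ (q - 1)) ^ (i + 1) • (G.df a * G.fn (X.toFun b)) =
        (-1 : ℝ) ^ ((i + 1) * (j + 1)) • (G.fn (X.toFun b) * G.df a) := by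
      rw [key hb ha, smul_smul, mul_comm (j + 1) (i + 1), ← pow_add,
        Even.neg_one_pow ⟨_, rfl⟩, one_smul]
    rw [G.twist_df _ ha, G.twist_df _ hb, smul_mul_assoc, smul_mul_assoc, key2, key ha hb,
      smul_add, add_comm]
  chain F hF h := by
    rw [X.chain F hF h]
    have hs : ∀ {n : ℕ} (x : Fin n → G.carrier), G.fn (∑ i, x i) = ∑ i, G.fn (x i) := by
      intro n x
      exact map_sum (AddMonoidHom.mk' G.fn G.isFormHom.fn_add) x Finset.univ
    rw [hs]
    refine Finset.sum_congr rfl fun i _ => ?_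
    rw [G.twist_fn _ ((G.mem_deg_zero _).2 ⟨_, rfl⟩), G.isFormHom.fn_mul]
    simp

/-- The contraction of forms with a vector field. -/
def contract {q : ℤ} (X : G.VField q) : G.Form →ₗ[ℝ] G.Form := X.isSuperDer.toLinearMap

/-- The Lie derivative `ι_X d + (-1)^q d ι_X` along a vector field of degree `q`. -/
def lie {q : ℤ} (X : G.VField q) : G.Form →ₗ[ℝ] G.Form :=
  G.contract X ∘ₗ G.d + (-1 : ℝ) ^ q • G.d ∘ₗ G.contract X

/-- Forms of order `r` and degree `k`: spanned by the products `a₀ da₁ ⋯ daᵣ` of homogeneous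
functions whose degrees add up to `k`. -/
def bideg (r k : ℕ) : Submodule ℝ G.Form :=
  Submodule.span ℝ {x | ∃ (a₀ : G.carrier) (k₀ : ℕ) (a : Fin r → G.carrier) (l : Fin r → ℕ),
    a₀ ∈ G.deg k₀ ∧ (∀ t, a t ∈ G.deg (l t)) ∧ k₀ + ∑ t, l t = k ∧
    x = G.fn a₀ * (List.ofFn fun t => G.df (a t)).prod}

end GradedFnAlg

/-- A graded manifold with body `M` (an `n`-dimensional manifold), non-negatively graded and with
local coordinates of degree at most `p`: a sheaf on `M` of graded-commutative algebras, with the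
smooth functions in degree zero, which is locally a free graded-commutative algebra over the
smooth functions on finitely many coordinates of prescribed degrees between `1` and `p`. -/
structure GradedManifold (p n : ℕ) (M : Type uM) [TopologicalSpace M]
    [ChartedSpace (EuclideanSpace ℝ (Fin n)) M] where
  sheaf : ∀ U : Opens M, GradedFnAlg.{uA, 0, 0, uM} (𝓡 n) U
  res : ∀ {U V : Opens M}, U ≤ V → (sheaf V).carrier →ₐ[ℝ] (sheaf U).carrier
  res_deg : ∀ {U V : Opens M} (h : U ≤ V) {k : ℕ} {a : (sheaf V).carrier},
    a ∈ (sheaf V).deg k → res h a ∈ (sheaf U).deg k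
  res_self : ∀ {U : Opens M} (a : (sheaf U).carrier), res le_rfl a = a
  res_res : ∀ {U V W : Opens M} (h : U ≤ V) (h' : V ≤ W) (a : (sheaf W).carrier),
    res h (res h' a) = res (h.trans h') a
  res_ofSmooth : ∀ {U V : Opens M} (h : U ≤ V) (f : SmoothFn (𝓡 n) V),
    res h ((sheaf V).ofSmooth f) =
      (sheaf U).ofSmooth (ContMDiffMap.restrictRingHom (𝓡 n) 𝓘(ℝ, ℝ) ℝ h f)
  glue : ∀ {ι : Type uM} (U : ι → Opens M) (k : ℕ) (s : ∀ i, (sheaf (U i)).carrier),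
    (∀ i, s i ∈ (sheaf (U i)).deg k) →
    (∀ i j, res (inf_le_left : U i ⊓ U j ≤ U i) (s i) = res inf_le_right (s j)) →
    ∃! t, t ∈ (sheaf (iSup U)).deg k ∧ ∀ i, res (le_iSup U i) t = s i
  numCoord : ℕ
  weight : Fin numCoord → ℕ
  weight_pos : ∀ a, 1 ≤ weight a
  weight_le : ∀ a, weight a ≤ p
  local_coord : ∀ x : M, ∃ (U : Opens M) (_ : x ∈ U) (ξ : Fin numCoord → (sheaf U).carrier),
    (∀ a, ξ a ∈ (sheaf U).deg (weight a)) ∧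
    ∀ (V : Opens M) (h : V ≤ U) (s : (sheaf V).carrier),
      ∃! c : {e : Fin numCoord → ℕ // ∀ a, Odd (weight a) → e a ≤ 1} →₀ SmoothFn (𝓡 n) V,
        s = c.sum fun e f =>
          (sheaf V).ofSmooth f * (List.ofFn fun a => res h (ξ a) ^ e.1 a).prod

namespace GradedManifold

variable {p n : ℕ} {M : Type uM} [TopologicalSpace M] [ChartedSpace (EuclideanSpace ℝ (Fin n)) M]

/-- The graded algebra of global functions. -/
abbrev global (S : GradedManifold.{uM, uA} p n M) : GradedFnAlg (𝓡 n) (⊤ : Opens M) := S.sheaf ⊤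

end GradedManifold

/-- A symplectic `Q`-manifold of degree `p`: a graded manifold with a homological vector field `Q`
and a closed non-degenerate two-form `ω` of degree `p` that is invariant under `Q`. -/
structure SymplecticQManifold (p n : ℕ) (M : Type uM) [TopologicalSpace M]
    [ChartedSpace (EuclideanSpace ℝ (Fin n)) M] extends GradedManifold.{uM, uA} p n M where
  form : (sheaf ⊤).Form
  form_mem : form ∈ (sheaf ⊤).bideg 2 p
  form_closed : (sheaf ⊤).d form = 0
  form_nondeg : ∀ k : ℕ, ∀ β ∈ (sheaf ⊤).bideg 1 k,
    ∃! X : (sheaf ⊤).VField (k - p), (sheaf ⊤).contract X form = β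
  Q : (sheaf ⊤).VField 1
  Q_sq : ∀ a, Q.toFun (Q.toFun a) = 0
  Q_symplectic : (sheaf ⊤).lie Q form = 0

namespace SymplecticQManifold

variable {p n : ℕ} {M : Type uM} [TopologicalSpace M] [ChartedSpace (EuclideanSpace ℝ (Fin n)) M]
  (S : SymplecticQManifold.{uM, uA} p n M)

/-- `X` is the Hamiltonian vector field of the function `h` of degree `q`. -/
def IsHamiltonian (q : ℕ) (h : S.global.carrier) {r : ℤ} (X : S.global.VField r) : Prop :=
  h ∈ S.global.deg q ∧ r = q - p ∧
    S.global.contract X S.form = (-1 : ℝ) ^ (q + 1) • S.global.df h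

/-- The symplectic potential `α = (1/p) ι_ξ ω`, with `ξ` the Euler vector field. -/
def α : S.global.Form := (p : ℝ)⁻¹ • S.global.contract S.global.euler S.form

end SymplecticQManifold

/-! ### Differential forms on ordinary manifolds -/

/-- Differential forms (of mixed degree) on a manifold: fields of elements of the exterior
algebra of the cotangent spaces, with the pointwise exterior product. -/
abbrev DForm {E H : Type*} [NormedAddCommGroup E] [NormedSpace ℝ E] [TopologicalSpace H]
    (I : ModelWithCorners ℝ E H) (N : Type*) [TopologicalSpace N] [ChartedSpace H N] :=
  ∀ x : N, ExteriorAlgebra ℝ (Module.Dual ℝ (TangentSpace I x))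

/-- The basis dual to the standard basis of `ℝᵐ`. -/
def coBasis (m : ℕ) :
    Module.Basis (Fin m) ℝ (Module.Dual ℝ (EuclideanSpace ℝ (Fin m))) :=
  (EuclideanSpace.basisFun (Fin m) ℝ).toBasis.dualBasis

/-- The basis of exterior products of coordinate one-forms, in increasing order. -/
def extBasis (m : ℕ) : Module.Basis (Finset (Fin m)) ℝ
    (ExteriorAlgebra ℝ (Module.Dual ℝ (EuclideanSpace ℝ (Fin m)))) :=
  (coBasis m).ExteriorAlgebra

section Forms

variable {m : ℕ} {H : Type*} [TopologicalSpace H]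
  (I : ModelWithCorners ℝ (EuclideanSpace ℝ (Fin m)) H)
  {N : Type*} [TopologicalSpace N] [ChartedSpace H N]

/-- A form read in the preferred chart at `x`, as a function of the coordinates `y`. -/
def chartRep [IsManifold I ∞ N] (η : DForm I N) (x : N) (y : EuclideanSpace ℝ (Fin m)) :
    ExteriorAlgebra ℝ (Module.Dual ℝ (EuclideanSpace ℝ (Fin m))) :=
  let z := (extChartAt I x).symm y
  ExteriorAlgebra.map
    (LinearMap.dualMap (M₂ := TangentSpace I z) (tangentCoordChange I x z z).toLinearMap) (η z)

/-- The coefficients of a form in the preferred chart at `x`. -/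
def chartCoef [IsManifold I ∞ N] (η : DForm I N) (x : N) (s : Finset (Fin m))
    (y : EuclideanSpace ℝ (Fin m)) : ℝ :=
  (extBasis m).repr (chartRep I η x y) s

/-- Smooth differential forms of degree `k`. -/
def IsSmoothForm [IsManifold I ∞ N] (k : ℕ) (η : DForm I N) : Prop :=
  (∀ x, η x ∈ ⋀[ℝ]^k (Module.Dual ℝ (TangentSpace I x))) ∧
    ∀ x s, ContDiffOn ℝ ∞ (chartCoef I η x s) (extChartAt I x).target

/-- The exterior derivative `∑ᵢ dxⁱ ∧ ∂ᵢ η`, at each point computed in the preferred chart. -/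
def extD [IsManifold I ∞ N] (η : DForm I N) : DForm I N := fun x =>
  ∑ i, ∑ s, fderivWithin ℝ (chartCoef I η x s) (Set.range I) (extChartAt I x x)
      (EuclideanSpace.single i 1) •
    (ExteriorAlgebra.ι ℝ (coBasis m i) * extBasis m s :
      ExteriorAlgebra ℝ (Module.Dual ℝ (EuclideanSpace ℝ (Fin m))))

/-- An orientation: `sgn x` tells whether the standard basis of `T_x N = ℝᵐ` (the identification
given by the preferred chart at `x`) is positively oriented. -/
structure MOrientation [IsManifold I ∞ N] where
  sgn : N → ℝ
  sgn_eq : ∀ x, sgn x = 1 ∨ sgn x = -1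
  locally_const : ∀ x, ∀ᶠ z in nhds x, 0 < sgn x * sgn z * (tangentCoordChange I z x z).det

/-- The integral over a compact manifold of (the top degree part of) `η` with respect to the
orientation signs `sgn`, computed with a smooth partition of unity subordinate to charts. -/
def integrate [IsManifold I ∞ N] [T2Space N] [CompactSpace N]
    (sgn : N → ℝ) (η : DForm I N) : ℝ :=
  let ρ := Classical.choose (SmoothPartitionOfUnity.exists_isSubordinate_chartAt_source I N)
  ∑ᶠ x : N, ∫ y in (extChartAt I x).target,
    let z := (extChartAt I x).symm y
    ρ x z * (sgn z * |(tangentCoordChange I x z z).det| * (extBasis m).repr (η z) Finset.univ)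

/-- The pull-back of forms along a map of manifolds. -/
def pullForm {m' : ℕ} {H' : Type*} [TopologicalSpace H']
    (I' : ModelWithCorners ℝ (EuclideanSpace ℝ (Fin m')) H')
    {N' : Type*} [TopologicalSpace N'] [ChartedSpace H' N'] (j : N' → N) :
    DForm I N →ₐ[ℝ] DForm I' N' :=
  AlgHom.pi fun x =>
    (ExteriorAlgebra.map (mfderiv I' I j x).toLinearMap.dualMap).comp (Pi.evalAlgHom ℝ _ (j x))

end Forms

/-- The orientation signs on the boundary, included by `j`: a basis `v₁, …` of a tangent space of
the boundary is positive if `ν, dj v₁, …` is, where `ν = -e₀` points outwards from the half space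
`x₀ ≥ 0`. -/
def boundarySgn {k : ℕ} {N : Type*} [TopologicalSpace N] [ChartedSpace (EuclideanHalfSpace (k + 1)) N]
    [IsManifold (𝓡∂ (k + 1)) ∞ N] (o : MOrientation (𝓡∂ (k + 1)) (N := N))
    {B : Type*} [TopologicalSpace B] [ChartedSpace (EuclideanSpace ℝ (Fin k)) B] (j : B → N)
    (x : B) : ℝ :=
  o.sgn (j x) * Real.sign (Matrix.det (Matrix.of fun r c : Fin (k + 1) =>
    (Fin.cons (-EuclideanSpace.single 0 1)
      (fun i : Fin k => mfderiv (𝓡 k) (𝓡∂ (k + 1)) j x (EuclideanSpace.single i (1 : ℝ))) :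
        Fin (k + 1) → EuclideanSpace ℝ (Fin (k + 1))) c r))

/-! ### Gauge fields, field strength and actions -/

/-- A degree preserving map from `T[1]N` to a graded manifold: a smooth map of the bodies and a
homomorphism from the functions of degree `k` to the `k`-forms on `N`. -/
structure GradedMap {p n : ℕ} {M : Type*} [TopologicalSpace M]
    [ChartedSpace (EuclideanSpace ℝ (Fin n)) M] (S : GradedManifold p n M)
    {m : ℕ} {H : Type*} [TopologicalSpace H]
    (I : ModelWithCorners ℝ (EuclideanSpace ℝ (Fin m)) H)
    (N : Type*) [TopologicalSpace N] [ChartedSpace H N] [IsManifold I ∞ N] where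
  body : C^∞⟮I, N; 𝓡 n, M⟯
  pull : S.global.carrier →ₐ[ℝ] DForm I N
  pull_smooth : ∀ {k : ℕ} {a : S.global.carrier}, a ∈ S.global.deg k → IsSmoothForm I k (pull a)
  pull_body : ∀ (h : SmoothFn (𝓡 n) (⊤ : Opens M)) (x : N),
    pull (S.global.ofSmooth h) x = algebraMap ℝ _ (h ⟨body x, trivial⟩)

/-- The pull-back of functions along the restriction of `φ` to `T[1]B`, for a map `j : B → N`. -/
def GradedMap.restrict {p n : ℕ} {M : Type*} [TopologicalSpace M]
    [ChartedSpace (EuclideanSpace ℝ (Fin n)) M] {S : GradedManifold p n M}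
    {m : ℕ} {H : Type*} [TopologicalSpace H]
    {I : ModelWithCorners ℝ (EuclideanSpace ℝ (Fin m)) H}
    {N : Type*} [TopologicalSpace N] [ChartedSpace H N] [IsManifold I ∞ N] (φ : GradedMap S I N)
    {m' : ℕ} {H' : Type*} [TopologicalSpace H']
    (I' : ModelWithCorners ℝ (EuclideanSpace ℝ (Fin m')) H')
    {B : Type*} [TopologicalSpace B] [ChartedSpace H' B] (j : B → N) :
    S.global.carrier →ₐ[ℝ] DForm I' B :=
  (pullForm I I' j).comp φ.pull

/-- `f` is the pull-back along the field strength `N → T[1]S` of the map with pull-back `φ`, for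
the vector field `Q` on the target: the algebra homomorphism with `f(a) = φ(a)` and
`f(da) = d φ(a) - φ(Q a)` for all functions `a`. -/
def IsFieldStrength {E H' M : Type*} [NormedAddCommGroup E] [NormedSpace ℝ E] [TopologicalSpace H']
    {I' : ModelWithCorners ℝ E H'} [TopologicalSpace M] [ChartedSpace H' M] (G : GradedFnAlg I' M)
    (Q : G.carrier →ₗ[ℝ] G.carrier) {m : ℕ} {H : Type*} [TopologicalSpace H]
    {I : ModelWithCorners ℝ (EuclideanSpace ℝ (Fin m)) H}
    {N : Type*} [TopologicalSpace N] [ChartedSpace H N] [IsManifold I ∞ N]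
    (φ : G.carrier →ₐ[ℝ] DForm I N) (f : G.Form →ₐ[ℝ] DForm I N) : Prop :=
  ∀ a, f (G.fn a) = φ a ∧ f (G.df a) = extD I (φ a) - φ (Q a)

/-- A Poisson bracket on the smooth functions on `M`. -/
structure IsPoissonBracket {E H M : Type*} [NormedAddCommGroup E] [NormedSpace ℝ E]
    [TopologicalSpace H] {I : ModelWithCorners ℝ E H} [TopologicalSpace M] [ChartedSpace H M]
    (br : SmoothFn I M →ₗ[ℝ] SmoothFn I M →ₗ[ℝ] SmoothFn I M) : Prop where
  skew : ∀ a b, br a b = -br b a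
  leibniz : ∀ a b c, br a (b * c) = br a b * c + b * br a c
  jacobi : ∀ a b c, br a (br b c) = br (br a b) c + br b (br a c)

/-- The functions of degree one are the sections of a Courant algebroid over `M`, with the given
pairing `⟨e, e'⟩`, anchor `ρ(e) a` and Dorfman bracket `[e, e']` of sections. -/
structure IsCourantAlgebroid {E H M : Type*} [NormedAddCommGroup E] [NormedSpace ℝ E]
    [TopologicalSpace H] {I : ModelWithCorners ℝ E H} [TopologicalSpace M] [ChartedSpace H M]
    (G : GradedFnAlg I M) (pair anchor brk : G.carrier → G.carrier → G.carrier) : Prop where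
  pair_mem : ∀ e ∈ G.deg 1, ∀ e' ∈ G.deg 1, pair e e' ∈ G.deg 0
  pair_add : ∀ e ∈ G.deg 1, ∀ e' ∈ G.deg 1, ∀ e'' ∈ G.deg 1,
    pair e (e' + e'') = pair e e' + pair e e''
  pair_smul : ∀ a ∈ G.deg 0, ∀ e ∈ G.deg 1, ∀ e' ∈ G.deg 1, pair e (a * e') = a * pair e e'
  pair_symm : ∀ e ∈ G.deg 1, ∀ e' ∈ G.deg 1, pair e e' = pair e' e
  pair_nondeg : ∀ l : G.carrier → G.carrier, (∀ e ∈ G.deg 1, l e ∈ G.deg 0) →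
    (∀ e ∈ G.deg 1, ∀ e' ∈ G.deg 1, l (e + e') = l e + l e') →
    (∀ a ∈ G.deg 0, ∀ e ∈ G.deg 1, l (a * e) = a * l e) →
    ∃! e, e ∈ G.deg 1 ∧ ∀ e' ∈ G.deg 1, pair e e' = l e'
  anchor_mem : ∀ e ∈ G.deg 1, ∀ a ∈ G.deg 0, anchor e a ∈ G.deg 0
  anchor_add : ∀ e ∈ G.deg 1, ∀ e' ∈ G.deg 1, ∀ a ∈ G.deg 0,
    anchor (e + e') a = anchor e a + anchor e' a
  anchor_smul : ∀ a ∈ G.deg 0, ∀ e ∈ G.deg 1, ∀ b ∈ G.deg 0, anchor (a * e) b = a * anchor e b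
  anchor_linear : ∀ e ∈ G.deg 1, ∀ a ∈ G.deg 0, ∀ b ∈ G.deg 0, ∀ r : ℝ,
    anchor e (r • a + b) = r • anchor e a + anchor e b
  anchor_leibniz : ∀ e ∈ G.deg 1, ∀ a ∈ G.deg 0, ∀ b ∈ G.deg 0,
    anchor e (a * b) = anchor e a * b + a * anchor e b
  brk_mem : ∀ e ∈ G.deg 1, ∀ e' ∈ G.deg 1, brk e e' ∈ G.deg 1
  brk_add_left : ∀ e ∈ G.deg 1, ∀ e' ∈ G.deg 1, ∀ e'' ∈ G.deg 1,
    brk (e + e') e'' = brk e e'' + brk e' e''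
  brk_add_right : ∀ e ∈ G.deg 1, ∀ e' ∈ G.deg 1, ∀ e'' ∈ G.deg 1,
    brk e (e' + e'') = brk e e' + brk e e''
  brk_smul : ∀ a ∈ G.deg 0, ∀ e ∈ G.deg 1, ∀ e' ∈ G.deg 1,
    brk e (a * e') = a * brk e e' + anchor e a * e'
  brk_jacobi : ∀ e₁ ∈ G.deg 1, ∀ e₂ ∈ G.deg 1, ∀ e₃ ∈ G.deg 1,
    brk e₁ (brk e₂ e₃) = brk (brk e₁ e₂) e₃ + brk e₂ (brk e₁ e₃)
  brk_pair : ∀ e ∈ G.deg 1, ∀ e₁ ∈ G.deg 1, ∀ e₂ ∈ G.deg 1,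
    anchor e (pair e₁ e₂) = pair (brk e e₁) e₂ + pair e₁ (brk e e₂)
  brk_self : ∀ e ∈ G.deg 1, ∀ e' ∈ G.deg 1,
    (2 : ℝ) • pair (brk e e) e' = anchor e' (pair e e)

section Actions

variable {p n : ℕ} {M : Type uM} [TopologicalSpace M]
  [ChartedSpace (EuclideanSpace ℝ (Fin n)) M] (S : SymplecticQManifold.{uM, uA} p n M)

/-- The bracket on the body derived from `Q` and the symplectic form: `{a, b} = -X_{Qa} b`. -/
def IsDerivedPoisson (br : SmoothFn (𝓡 n) (⊤ : Opens M) → SmoothFn (𝓡 n) (⊤ : Opens M) →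
    SmoothFn (𝓡 n) (⊤ : Opens M)) : Prop :=
  ∀ a b {r : ℤ} (X : S.global.VField r),
    S.IsHamiltonian 1 (S.Q.toFun (S.global.ofSmooth a)) X →
      S.global.ofSmooth (br a b) = -X.toFun (S.global.ofSmooth b)

/-- The operations on functions of degree one derived from `Q` and the symplectic form:
`⟨e, e'⟩ = X_e e'`, `ρ(e) a = X_e Q a`, `[e, e'] = (X_e Q + Q X_e) e'`. -/
def IsDerivedCourant (pair anchor brk : S.global.carrier → S.global.carrier → S.global.carrier) :
    Prop :=
  ∀ e b {r : ℤ} (X : S.global.VField r), S.IsHamiltonian 1 e X →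
    pair e b = X.toFun b ∧ anchor e b = X.toFun (S.Q.toFun b) ∧
      brk e b = X.toFun (S.Q.toFun b) + S.Q.toFun (X.toFun b)

/-- Functions `xⁱ` on the body and `Pᵢ` of degree one in which the symplectic form is
`∑ᵢ dPᵢ dxⁱ` (they may be more than local coordinates, so that they exist globally). -/
def IsPoissonFrame {r : ℕ} (x : Fin r → SmoothFn (𝓡 n) (⊤ : Opens M))
    (P : Fin r → S.global.carrier) : Prop :=
  (∀ i, P i ∈ S.global.deg 1) ∧
    S.form = ∑ i, S.global.df (P i) * S.global.df (S.global.ofSmooth (x i))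

/-- Functions `xⁱ`, `ξᵃ`, `Pᵢ` of degrees zero, one, two and a constant symmetric matrix `g` for
which the symplectic form is `∑ᵢ dPᵢ dxⁱ + ½ ∑ gₐᵦ dξᵃ dξᵇ`. -/
def IsCourantFrame {r s : ℕ} (x : Fin r → SmoothFn (𝓡 n) (⊤ : Opens M))
    (P : Fin r → S.global.carrier) (ξ : Fin s → S.global.carrier) (g : Matrix (Fin s) (Fin s) ℝ) :
    Prop :=
  (∀ i, P i ∈ S.global.deg 2) ∧ (∀ a, ξ a ∈ S.global.deg 1) ∧ g.IsSymm ∧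
    S.form = ∑ i, S.global.df (P i) * S.global.df (S.global.ofSmooth (x i)) +
      (1 / 2 : ℝ) • ∑ a, ∑ b, g a b • (S.global.df (ξ a) * S.global.df (ξ b))

variable {m : ℕ} {H : Type*} [TopologicalSpace H]
  {I : ModelWithCorners ℝ (EuclideanSpace ℝ (Fin m)) H}
  {B : Type*} [TopologicalSpace B] [ChartedSpace H B] [IsManifold I ∞ B]
  (φ : S.global.carrier →ₐ[ℝ] DForm I B)

/-- The integrand `ι_d φ*α + (-1)^(p+1) φ*h` of the classical action of the AKSZ sigma model with
Hamiltonian `h`. Here `κ` is the homomorphism `a ↦ φ(a)`, `da ↦ d φ(a)`; on a one-form `a db` it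
is `φ(a) d φ(b)`, the contraction of `φ*(a db)` with the de Rham vector field. -/
def akszLagrangian (κ : S.global.Form →ₐ[ℝ] DForm I B) (h : S.global.carrier) : DForm I B :=
  κ S.α + (-1 : ℝ) ^ (p + 1) • φ h

/-- The integrand `Aᵢ dXⁱ + ½ πⁱʲ(X) Aᵢ Aⱼ` of the Poisson sigma model, with `Xⁱ = φ*xⁱ`,
`Aᵢ = φ*Pᵢ` and `πⁱʲ = {xⁱ, xʲ}`. -/
def poissonLagrangian (br : SmoothFn (𝓡 n) (⊤ : Opens M) → SmoothFn (𝓡 n) (⊤ : Opens M) →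
    SmoothFn (𝓡 n) (⊤ : Opens M)) {r : ℕ} (x : Fin r → SmoothFn (𝓡 n) (⊤ : Opens M))
    (P : Fin r → S.global.carrier) : DForm I B :=
  ∑ i, φ (P i) * extD I (φ (S.global.ofSmooth (x i))) +
    (1 / 2 : ℝ) • ∑ i, ∑ k, φ (S.global.ofSmooth (br (x i) (x k))) * φ (P i) * φ (P k)

/-- The integrand `Fᵢ dXⁱ + ½ gₐᵦ Aᵃ dAᵇ - ρ(eₐ)(xⁱ) Fᵢ Aᵃ + ⅙ ⟨[eₐ, eᵦ], e_c⟩ Aᵃ Aᵇ Aᶜ` of the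
Courant sigma model, with `Xⁱ = φ*xⁱ`, `Aᵃ = φ*ξᵃ`, `Fᵢ = φ*Pᵢ` and `eₐ = ∑ gₐᵦ ξᵇ`. -/
def courantLagrangian (pair anchor brk : S.global.carrier → S.global.carrier → S.global.carrier)
    {r s : ℕ} (x : Fin r → SmoothFn (𝓡 n) (⊤ : Opens M)) (P : Fin r → S.global.carrier)
    (ξ : Fin s → S.global.carrier) (g : Matrix (Fin s) (Fin s) ℝ) : DForm I B :=
  let e : Fin s → S.global.carrier := fun a => ∑ b, g a b • ξ b
  ∑ i, φ (P i) * extD I (φ (S.global.ofSmooth (x i))) +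
    (1 / 2 : ℝ) • ∑ a, ∑ b, g a b • (φ (ξ a) * extD I (φ (ξ b))) -
    ∑ i, ∑ a, φ (anchor (e a) (S.global.ofSmooth (x i))) * φ (P i) * φ (ξ a) +
    (1 / 6 : ℝ) • ∑ a, ∑ b, ∑ c,
      φ (pair (brk (e a) (e b)) (e c)) * φ (ξ a) * φ (ξ b) * φ (ξ c)

end Actions

end

noncomputable section

set_option linter.unusedSectionVars false

namespace GradedFnAlg

variable {E H : Type*} [NormedAddCommGroup E] [NormedSpace ℝ E] [TopologicalSpace H]
  {I : ModelWithCorners ℝ E H} {M : Type*} [TopologicalSpace M] [ChartedSpace H M]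
  (G : GradedFnAlg I M)

/-! ### Super derivations of the algebra of forms -/

/-! The pull-back f*ω is exact on N with the AKSZ integrand as primitive, and Stokes' theorem does
the rest. Since ω is closed of degree p, Cartan's formula for the Euler field gives dα = ω (`d_α`).
Moreover α is a finite sum Σ aₜ dbₜ of homogeneous global functions, so ω = Σ daₜ dbₜ
(`exists_potential`). The same homotopy argument, applied to the closed one-form ι_Q ω of degree p +
1, produces the Hamiltonian h of Q (`existsUnique_hamiltonian_Q`). Expanding f*ω = Σ (dφaₜ −
φQaₜ)(dφbₜ − φQbₜ) gives three groups of terms. The terms dφaₜ dφbₜ add up to d of the image of α.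
The mixed terms are the image of ι_Q ω = (−1)^p dh. The terms quadratic in Q are half the image of
ι_Q ι_Q ω, which is Qh up to sign; this vanishes because Qh is the Hamiltonian of [Q, Q] = 0 and has
positive degree (`IsHamiltonian.Q_hamiltonian`). Together this is `IsFieldStrength.form_eq`.

The pull-backs exist because forms are given by generators and relations, and the relations are
respected: d ∘ φ and φ ∘ Q are both derivations of degree one along φ that satisfy the chain rule
(`IsPull.isFormHom`).

The identities of the Cartan calculus hold because super derivations that agree on generators are
equal (`IsDer.ext`). They give X_{Qf} = [Q, X_f] and show that a commutator of Hamiltonian fields is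
Hamiltonian (`IsHamiltonian.commutator`). From this, Q² = 0 and degree counting follow the Poisson
and Courant axioms. Contracting ι_X ω = ± df once more with the Euler field expresses f through a
frame (`IsPoissonFrame.expand`, `IsCourantFrame.expand`); iterating this on the functions Q x, Q ξ
and h computes h.

Stokes' theorem (`integrate_extD`) rests on the naturality of the exterior derivative in coordinates
(`coordD_pb`), a partition of unity, and the divergence theorem on a box in the half space. The
boundary term is carried to charts of B by a change of variables whose sign is settled by
`boundary_sign_identity`. -/

theorem df_zero : G.df 0 = 0 := by simpa using G.isFormHom.d_smul 0 0

theorem fn_sum {ι : Type*} (s : Finset ι) (x : ι → G.carrier) :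
    G.fn (∑ i ∈ s, x i) = ∑ i ∈ s, G.fn (x i) :=
  map_sum (AddMonoidHom.mk' G.fn G.isFormHom.fn_add) x s

theorem fn_one : G.fn 1 = 1 := by simpa using G.isFormHom.fn_const 1

/-- Induction over the generators of the algebra of forms. -/
theorem form_induction {P : G.Form → Prop} (hc : ∀ r : ℝ, P (algebraMap ℝ G.Form r))
    (hf : ∀ a, P (G.fn a)) (hd : ∀ a, P (G.df a)) (hm : ∀ x y, P x → P y → P (x * y))
    (ha : ∀ x y, P x → P y → P (x + y)) (x : G.Form) : P x := by
  obtain ⟨x, rfl⟩ := G.mkForm_surjective x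
  induction x using FreeAlgebra.induction with
  | grade0 r => rw [AlgHom.commutes]; exact hc r
  | grade1 x =>
    cases x with
    | inl a => exact hf a
    | inr a => exact hd a
  | mul x y hx hy => rw [map_mul]; exact hm _ _ hx hy
  | add x y hx hy => rw [map_add]; exact ha _ _ hx hy

theorem form_algHom_ext {B : Type*} [Ring B] [Algebra ℝ B] {f g : G.Form →ₐ[ℝ] B}
    (hf : ∀ a, f (G.fn a) = g (G.fn a)) (hd : ∀ a, f (G.df a) = g (G.df a)) : f = g := by
  ext x
  induction x using G.form_induction with
  | hc r => simp
  | hf a => exact hf a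
  | hd a => exact hd a
  | hm x y hx hy => rw [map_mul, map_mul, hx, hy]
  | ha x y hx hy => rw [map_add, map_add, hx, hy]

/-- `D` is a super derivation with sign `c`. -/
def IsDer (c : ℝ) (D : G.Form →ₗ[ℝ] G.Form) : Prop :=
  ∀ x y, D (x * y) = D x * y + G.twist c x * D y

variable {G}

theorem IsDer.map_one {c : ℝ} {D : G.Form →ₗ[ℝ] G.Form} (h : G.IsDer c D) : D 1 = 0 := by
  have := h 1 1
  simpa using this

/-- Every identity of the Cartan calculus below is proved by showing that both sides are super
derivations of the same sign and comparing them on homogeneous generators. -/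
theorem IsDer.ext {c : ℝ} {D D' : G.Form →ₗ[ℝ] G.Form} (h : G.IsDer c D) (h' : G.IsDer c D')
    (hf : ∀ k, ∀ a ∈ G.deg k, D (G.fn a) = D' (G.fn a))
    (hd : ∀ k, ∀ a ∈ G.deg k, D (G.df a) = D' (G.df a)) : D = D' := by
  ext x
  induction x using G.form_induction with
  | hc r => rw [Algebra.algebraMap_eq_smul_one, map_smul, map_smul, h.map_one, h'.map_one]
  | hf a =>
    induction a using G.homogeneous_induction with
    | h0 => simp [G.fn_zero]
    | ha a b ha hb => rw [G.isFormHom.fn_add, map_add, map_add, ha, hb]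
    | hh k a ha => exact hf k a ha
  | hd a =>
    induction a using G.homogeneous_induction with
    | h0 => simp [G.df_zero]
    | ha a b ha hb => rw [G.isFormHom.d_add, map_add, map_add, ha, hb]
    | hh k a ha => exact hd k a ha
  | hm x y hx hy => rw [h, h', hx, hy]
  | ha x y hx hy => rw [map_add, map_add, hx, hy]

theorem IsDer.smul {c : ℝ} {D : G.Form →ₗ[ℝ] G.Form} (h : G.IsDer c D) (r : ℝ) :
    G.IsDer c (r • D) := by
  intro x y
  simp [h x y]

theorem isDer_zero (c : ℝ) : G.IsDer c 0 := by intro x y; simp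

theorem twist_twist (c c' : ℝ) (x : G.Form) : G.twist c (G.twist c' x) = G.twist (c * c') x := by
  have : (G.twist c).comp (G.twist c') = G.twist (c * c') := by
    apply G.form_algHom_ext
    · intro a
      induction a using G.homogeneous_induction with
      | h0 => simp [G.fn_zero]
      | ha a b ha hb => rw [G.isFormHom.fn_add, map_add, map_add, ha, hb]
      | hh k a ha => simp [G.twist_fn _ ha, mul_pow, smul_smul, mul_comm]
    · intro a
      induction a using G.homogeneous_induction with
      | h0 => simp [G.df_zero]
      | ha a b ha hb => rw [G.isFormHom.d_add, map_add, map_add, ha, hb]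
      | hh k a ha => simp [G.twist_df _ ha, mul_pow, smul_smul, mul_comm]
  exact DFunLike.congr_fun this x

/-- `D` multiplies the eigenvalues of the automorphism `twist c` by `e`. -/
def Shifts (c : ℝ) (e : ℝ) (D : G.Form →ₗ[ℝ] G.Form) : Prop :=
  ∀ x, G.twist c (D x) = e • D (G.twist c x)

theorem Shifts.comp {c e e' : ℝ} {D D' : G.Form →ₗ[ℝ] G.Form} (h : Shifts c e D)
    (h' : Shifts c e' D') : Shifts c (e * e') (D ∘ₗ D') := by
  intro x
  simp [h _, h' _, smul_smul]

theorem Shifts.add {c e : ℝ} {D D' : G.Form →ₗ[ℝ] G.Form} (h : Shifts c e D)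
    (h' : Shifts c e D') : Shifts c e (D + D') := by
  intro x
  simp [h x, h' x]

theorem Shifts.smul {c e : ℝ} {D : G.Form →ₗ[ℝ] G.Form} (h : Shifts c e D) (r : ℝ) :
    Shifts c e (r • D) := by
  intro x
  rw [LinearMap.smul_apply, LinearMap.smul_apply, map_smul, h x, smul_comm]

/-- A super derivation shifts the total degree if it does so on generators. -/
theorem IsDer.shifts {c₁ : ℝ} {D : G.Form →ₗ[ℝ] G.Form} (h : G.IsDer c₁ D) {c e : ℝ}
    (hf : ∀ k, ∀ a ∈ G.deg k, G.twist c (D (G.fn a)) = (e * c ^ k) • D (G.fn a))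
    (hd : ∀ k, ∀ a ∈ G.deg k, G.twist c (D (G.df a)) = (e * c ^ (k + 1)) • D (G.df a)) :
    Shifts c e D := by
  intro x
  induction x using G.form_induction with
  | hc r => rw [AlgHom.commutes, Algebra.algebraMap_eq_smul_one, map_smul, h.map_one]; simp
  | hf a =>
    induction a using G.homogeneous_induction with
    | h0 => simp [G.fn_zero]
    | ha a b ha hb => simp only [G.isFormHom.fn_add, map_add, ha, hb, smul_add]
    | hh k a ha => rw [hf k a ha, G.twist_fn _ ha, map_smul, smul_smul]
  | hd a =>
    induction a using G.homogeneous_induction with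
    | h0 => simp [G.df_zero]
    | ha a b ha hb => simp only [G.isFormHom.d_add, map_add, ha, hb, smul_add]
    | hh k a ha => rw [hd k a ha, G.twist_df _ ha, map_smul, smul_smul]
  | hm x y hx hy =>
    rw [h, map_add, map_mul, map_mul, hx, hy, map_mul, h, twist_twist, twist_twist, mul_comm c c₁]
    simp
  | ha x y hx hy => simp only [map_add, hx, hy, smul_add]

/-- The super commutator of two super derivations is a super derivation. -/
theorem IsDer.superCommutator {c₁ c₂ l : ℝ} {D₁ D₂ : G.Form →ₗ[ℝ] G.Form} (h₁ : G.IsDer c₁ D₁)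
    (h₂ : G.IsDer c₂ D₂) (hl : l * l = 1) (h₁₂ : Shifts c₁ l D₂) (h₂₁ : Shifts c₂ l D₁) :
    G.IsDer (c₁ * c₂) (D₁ ∘ₗ D₂ - l • D₂ ∘ₗ D₁) := by
  intro x y
  -- As l² = 1, the shift relation of D₁ can be read backwards. The two cross terms, D₂ x against D₁
  -- y and D₁ x against D₂ y, then cancel.
  have e₁ : D₁ (G.twist c₂ x) = l • G.twist c₂ (D₁ x) := by rw [h₂₁ x, smul_smul, hl, one_smul]
  simp only [LinearMap.sub_apply, LinearMap.comp_apply, LinearMap.smul_apply, h₁ _ _, h₂ _ _,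
    map_add, h₁₂ x, e₁, twist_twist, mul_comm c₂ c₁, smul_add, smul_mul_assoc, sub_mul, mul_sub,
    mul_smul_comm]
  abel

/-! ### The Cartan calculus -/

theorem isDer_d : G.IsDer (-1) G.d := fun x y => G.isSuperDer_d.apply_mul x y

@[simp] theorem d_fn (a : G.carrier) : G.d (G.fn a) = G.df a := G.isSuperDer_d.apply_fn a

@[simp] theorem d_df (a : G.carrier) : G.d (G.df a) = 0 := G.isSuperDer_d.apply_df a

theorem isDer_contract {q : ℤ} (X : G.VField q) : G.IsDer ((-1) ^ (q - 1)) (G.contract X) :=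
  fun x y => X.isSuperDer.apply_mul x y

@[simp] theorem contract_fn {q : ℤ} (X : G.VField q) (a : G.carrier) :
    G.contract X (G.fn a) = 0 := X.isSuperDer.apply_fn a

@[simp] theorem contract_df {q : ℤ} (X : G.VField q) (a : G.carrier) :
    G.contract X (G.df a) = G.fn (X.toFun a) := X.isSuperDer.apply_df a

theorem shifts_d (c : ℝ) : Shifts c c G.d :=
  isDer_d.shifts (fun k a ha => by rw [d_fn, G.twist_df _ ha, pow_succ'])
    (fun k a ha => by simp)

theorem twist_fn_of_degZ {c : ℝ} {k : ℤ} {a : G.carrier} (ha : a ∈ G.degZ k) :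
    G.twist c (G.fn a) = c ^ k • G.fn a := by
  rcases G.degZ_mem ha with h | ⟨i, hi, h⟩
  · simp [h, G.fn_zero]
  · rw [G.twist_fn _ h, hi, zpow_natCast]

/-- In the exponent q − 1, the q is the degree of the vector field and the −1 is the loss of one
form order. -/
theorem shifts_contract {c : ℝ} (hc : c ≠ 0) {q : ℤ} (X : G.VField q) :
    Shifts c (c ^ (q - 1)) (G.contract X) :=
  (isDer_contract X).shifts (fun k a ha => by simp)
    (fun k a ha => by
      rw [contract_df, twist_fn_of_degZ (X.map_deg ha), ← zpow_natCast, ← zpow_add₀ hc]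
      congr 2; push_cast; ring)

/-- The Lie derivative is the super commutator of ι_X, which shifts the total degree by q − 1, and
d, which shifts it by 1. The sign (−1)^q in its definition is minus the commutator sign (−1)^(q−1).
-/
theorem isDer_lie {q : ℤ} (X : G.VField q) : G.IsDer ((-1) ^ q) (G.lie X) := by
  have h := (isDer_contract X).superCommutator isDer_d (l := (-1) ^ (q - 1))
    (neg_one_zpow_mul_self _) (shifts_d _) (shifts_contract (by norm_num) X)
  convert h using 1
  · rw [neg_one_zpow_sub_one]; ring
  · ext x
    simp [lie, neg_one_zpow_sub_one]

theorem shifts_lie {c : ℝ} (hc : c ≠ 0) {q : ℤ} (X : G.VField q) :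
    Shifts c (c ^ q) (G.lie X) := by
  have e : c ^ (q - 1) * c = c ^ q := by rw [← zpow_add_one₀ hc]; congr 1; ring
  have h1 := (shifts_contract hc X).comp (shifts_d c)
  have h2 := (shifts_d c).comp (shifts_contract hc X)
  rw [e] at h1
  rw [mul_comm, e] at h2
  exact h1.add (h2.smul _)

@[simp] theorem lie_fn {q : ℤ} (X : G.VField q) (a : G.carrier) :
    G.lie X (G.fn a) = G.fn (X.toFun a) := by simp [lie]

@[simp] theorem lie_df {q : ℤ} (X : G.VField q) (a : G.carrier) :
    G.lie X (G.df a) = (-1 : ℝ) ^ q • G.df (X.toFun a) := by simp [lie]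

/-- The super commutator of two contractions lowers the form order by two, so it kills functions and
differentials, hence everything. -/
theorem contract_contract {r s : ℤ} (X : G.VField r) (Y : G.VField s) (x : G.Form) :
    G.contract X (G.contract Y x) =
      (-1 : ℝ) ^ ((r - 1) * (s - 1)) • G.contract Y (G.contract X x) := by
  have h := (isDer_contract X).superCommutator (isDer_contract Y)
    (l := (-1) ^ ((r - 1) * (s - 1))) (neg_one_zpow_mul_self _)
    (by simpa [zpow_mul] using shifts_contract (G := G) (c := (-1) ^ (r - 1))
          (zpow_ne_zero _ (by norm_num)) Y)
    (by simpa [zpow_mul, mul_comm (r - 1)] using shifts_contract (G := G) (c := (-1) ^ (s - 1))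
          (zpow_ne_zero _ (by norm_num)) X)
  have h0 := h.ext (isDer_zero _) (by simp) (by simp)
  have := LinearMap.congr_fun h0 x
  simpa [sub_eq_zero] using this

/-- The graded commutator of vector fields. -/
def VField.commutator {r s : ℤ} (X : G.VField r) (Y : G.VField s) : G.VField (r + s) where
  toFun := X.toFun ∘ₗ Y.toFun - (-1 : ℝ) ^ (r * s) • Y.toFun ∘ₗ X.toFun
  map_deg := by
    have key : ∀ {r s : ℤ} (X : G.VField r) (Y : G.VField s) {i : ℕ} {a : G.carrier},
        a ∈ G.deg i → X.toFun (Y.toFun a) ∈ G.degZ (i + (r + s)) := by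
      intro r s X Y i a ha
      rcases G.degZ_mem (Y.map_deg ha) with h | ⟨k, hk, h⟩
      · simp [h]
      · have := X.map_deg h
        rwa [← hk, add_assoc, add_comm s] at this
    intro i a ha
    have h2 := key Y X ha
    rw [add_comm s] at h2
    exact Submodule.sub_mem _ (key X Y ha) (Submodule.smul_mem _ _ h2)
  leibniz := by
    have key : ∀ {r s : ℤ} (X : G.VField r) (Y : G.VField s) {i : ℕ} {a : G.carrier}
        (b : G.carrier), a ∈ G.deg i → X.toFun (Y.toFun (a * b)) =
          X.toFun (Y.toFun a) * b + (-1 : ℝ) ^ (r * (i + s)) • (Y.toFun a * X.toFun b) +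
          (-1 : ℝ) ^ (s * i) • (X.toFun a * Y.toFun b) +
          (-1 : ℝ) ^ ((r + s) * i) • (a * X.toFun (Y.toFun b)) := by
      intro r s X Y i a b ha
      rw [Y.leibniz b ha, map_add, map_smul, X.leibniz _ ha]
      have : X.toFun (Y.toFun a * b) = X.toFun (Y.toFun a) * b +
          (-1 : ℝ) ^ (r * (i + s)) • (Y.toFun a * X.toFun b) := by
        rcases G.degZ_mem (Y.map_deg ha) with h | ⟨k, hk, h⟩
        · simp [h]
        · rw [X.leibniz _ h, hk]
      rw [this, smul_add, smul_smul, ← zpow_add₀ (by norm_num), add_mul, add_comm (s * (i : ℤ))]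
      abel
    intro i a b ha
    simp only [LinearMap.sub_apply, LinearMap.comp_apply, LinearMap.smul_apply, key X Y b ha,
      key Y X b ha, sub_mul, mul_sub, smul_add, smul_sub, smul_smul, smul_mul_assoc, mul_smul_comm,
      ← zpow_add₀ (show (-1 : ℝ) ≠ 0 by norm_num)]
    have e1 : (-1 : ℝ) ^ (r * (i + s)) = (-1) ^ (r * s + r * i) := by congr 1; ring
    have e2 : (-1 : ℝ) ^ (r * s + s * (i + r)) = (-1) ^ (s * i) := by
      rw [show r * s + s * (i + r) = s * i + (r * s + r * s) by ring, zpow_add₀ (by norm_num),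
        Even.neg_one_zpow ⟨r * s, rfl⟩, mul_one]
    rw [e1, e2, add_comm s r, add_comm ((r + s) * (i : ℤ)) (r * s)]
    abel
  chain := by
    have key : ∀ {r s : ℤ} (X : G.VField r) (Y : G.VField s) {n : ℕ} (F : (Fin n → ℝ) → ℝ)
        (hF : ContDiff ℝ ∞ F) (h : Fin n → SmoothFn I M),
        X.toFun (Y.toFun (G.ofSmooth (SmoothFn.comp F hF h))) =
        ∑ i, ∑ j, G.ofSmooth (SmoothFn.comp _
            (partialDeriv_contDiff (partialDeriv_contDiff hF i) j) h) *
          (X.toFun (G.ofSmooth (h j)) * Y.toFun (G.ofSmooth (h i))) +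
        ∑ i, G.ofSmooth (SmoothFn.comp _ (partialDeriv_contDiff hF i) h) *
          X.toFun (Y.toFun (G.ofSmooth (h i))) := by
      intro r s X Y n F hF h
      rw [Y.chain, map_sum, ← Finset.sum_add_distrib]
      refine Finset.sum_congr rfl fun i _ => ?_
      rw [X.leibniz (i := 0) _ ((G.mem_deg_zero _).2 ⟨_, rfl⟩), X.chain, Finset.sum_mul]
      simp [mul_assoc]
    intro n F hF h
    simp only [LinearMap.sub_apply, LinearMap.comp_apply, LinearMap.smul_apply, key X Y, key Y X,
      mul_sub, Finset.sum_sub_distrib, smul_add, Finset.smul_sum, mul_smul_comm]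
    -- Only the terms with second partial derivatives are left. They cancel because partial
    -- derivatives commute and because X hⱼ and Y hᵢ, of degrees r and s, commute up to (−1)^(rs).
    rw [add_sub_add_comm, add_eq_right, sub_eq_zero, Finset.sum_comm]
    refine Finset.sum_congr rfl fun j _ => Finset.sum_congr rfl fun i _ => ?_
    have h2 : SmoothFn.comp _ (partialDeriv_contDiff (partialDeriv_contDiff hF i) j) h =
        SmoothFn.comp _ (partialDeriv_contDiff (partialDeriv_contDiff hF j) i) h := by
      simp only [partialDeriv_comm hF i j]
    rw [h2, ← mul_smul_comm]
    congr 1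
    rcases G.degZ_mem (X.map_deg ((G.mem_deg_zero _).2 ⟨h j, rfl⟩)) with hX | ⟨k, hk, hX⟩
    · simp [hX]
    rcases G.degZ_mem (Y.map_deg ((G.mem_deg_zero _).2 ⟨h i, rfl⟩)) with hY | ⟨l, hl, hY⟩
    · simp [hY]
    rw [G.comm hX hY]
    congr 1
    have hk' : r = k := by simpa using hk
    have hl' : s = l := by simpa using hl
    rw [hk', hl']; norm_cast

/-- Both sides are super derivations that kill functions, and on da both give the commutator applied
to a. This identity makes Hamiltonian vector fields closed under commutators. -/
theorem lie_contract {r s : ℤ} (X : G.VField r) (Y : G.VField s) (x : G.Form) :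
    G.lie X (G.contract Y x) - (-1 : ℝ) ^ (r * (s - 1)) • G.contract Y (G.lie X x) =
      G.contract (X.commutator Y) x := by
  have h := (isDer_lie X).superCommutator (isDer_contract Y)
    (l := (-1) ^ (r * (s - 1))) (neg_one_zpow_mul_self _)
    (by simpa [zpow_mul] using shifts_contract (G := G) (c := (-1) ^ r)
          (zpow_ne_zero _ (by norm_num)) Y)
    (by simpa [zpow_mul, mul_comm r] using shifts_lie (G := G) (c := (-1) ^ (s - 1))
          (zpow_ne_zero _ (by norm_num)) X)
  have e : ((-1 : ℝ) ^ r * (-1) ^ (s - 1)) = (-1) ^ (r + s - 1) := by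
    rw [← zpow_add₀ (by norm_num)]; congr 1; ring
  rw [e] at h
  have h0 := h.ext (isDer_contract (X.commutator Y)) (by simp) (by
    intro k a ha
    simp only [LinearMap.sub_apply, LinearMap.comp_apply, LinearMap.smul_apply, contract_df, lie_fn,
      lie_df, map_smul, VField.commutator, smul_smul, ← G.fn_smul]
    have e2 : (-1 : ℝ) ^ (r * (s - 1)) * (-1) ^ r = (-1) ^ (r * s) := by
      rw [← zpow_add₀ (by norm_num)]; congr 1; ring
    have : G.fn (X.toFun (Y.toFun a)) = G.fn (X.toFun (Y.toFun a) -
        (-1 : ℝ) ^ (r * s) • Y.toFun (X.toFun a)) + G.fn ((-1 : ℝ) ^ (r * s) • Y.toFun (X.toFun a)) := by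
      rw [← G.isFormHom.fn_add, sub_add_cancel]
    rw [e2, this, add_sub_cancel_right])
  exact LinearMap.congr_fun h0 x

/-! ### Functions inside the forms, and the Euler vector field -/

-- The projection onto order zero, which sends every differential to zero, is an algebra
-- homomorphism left inverse to `fn`. It turns identities between forms of order zero into
-- identities between functions.
variable (G) in
theorem isFormHom_order_zero : G.IsFormHom (B := G.carrier) id (fun _ => 0) where
  fn_add a b := rfl
  fn_mul a b := rfl
  fn_const r := rfl
  d_add a b := by simp
  d_smul r a := by simp
  d_mul b ha := by simp
  fn_d_comm ha hb := by simp
  d_d_comm ha hb := by simp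
  chain F hF h := by simp

theorem fn_injective : Function.Injective G.fn := by
  intro a b h
  have := congrArg G.isFormHom_order_zero.lift h
  simpa [IsFormHom.lift_fn] using this

theorem euler_apply {k : ℕ} {a : G.carrier} (ha : a ∈ G.deg k) :
    G.euler.toFun a = (k : ℝ) • a := G.scale_of_mem _ ha

theorem contract_euler_df {k : ℕ} {a : G.carrier} (ha : a ∈ G.deg k) :
    G.contract G.euler (G.df a) = (k : ℝ) • G.fn a := by
  rw [contract_df, euler_apply ha, G.fn_smul]

/-- Contracting da with the Euler field gives k a, so there are no constants in positive degree. -/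
theorem eq_zero_of_df_eq_zero {k : ℕ} (hk : k ≠ 0) {a : G.carrier} (ha : a ∈ G.deg k)
    (h : G.df a = 0) : a = 0 := by
  have h1 := contract_euler_df ha
  rw [h, map_zero] at h1
  apply fn_injective (G := G)
  rw [G.fn_zero]
  exact (smul_eq_zero_iff_right (Nat.cast_ne_zero.2 hk)).1 h1.symm

/-- The Euler field has degree zero, so its Lie derivative is an ordinary derivation. It multiplies
a and da by the degree of a, and therefore counts degrees on products. -/
theorem lie_euler_of_bideg {r k : ℕ} {x : G.Form} (hx : x ∈ G.bideg r k) :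
    G.lie G.euler x = (k : ℝ) • x := by
  induction hx using Submodule.span_induction with
  | zero => simp
  | add x y _ _ hx hy => simp [hx, hy]
  | smul c x _ hx => rw [map_smul, hx, smul_comm]
  | mem x hx =>
    obtain ⟨a₀, k₀, a, l, h0, hl, rfl, rfl⟩ := hx
    -- The sign of the super derivation is (−1)^0 = 1, and twisting by 1 is the identity.
    have tw : ∀ y : G.Form, G.twist ((-1) ^ (0 : ℤ)) y = y := by
      have : G.twist ((-1) ^ (0 : ℤ)) = AlgHom.id ℝ G.Form := by
        apply G.form_algHom_ext
        · intro b
          induction b using G.homogeneous_induction with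
          | h0 => simp [G.fn_zero]
          | ha a b ha hb => rw [G.isFormHom.fn_add, map_add, map_add, ha, hb]
          | hh k a ha => simp only [G.twist_fn _ ha]; simp
        · intro b
          induction b using G.homogeneous_induction with
          | h0 => simp [G.df_zero]
          | ha a b ha hb => rw [G.isFormHom.d_add, map_add, map_add, ha, hb]
          | hh k a ha => simp only [G.twist_df _ ha]; simp
      intro y
      rw [this]; rfl
    have hd : ∀ x y, G.lie G.euler (x * y) = G.lie G.euler x * y + x * G.lie G.euler y := by
      intro x y
      rw [isDer_lie G.euler x y, tw]
    have key : ∀ {r : ℕ} (a : Fin r → G.carrier) (l : Fin r → ℕ), (∀ t, a t ∈ G.deg (l t)) →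
        G.lie G.euler (List.ofFn fun t => G.df (a t)).prod =
          ((∑ t, l t : ℕ) : ℝ) • (List.ofFn fun t => G.df (a t)).prod := by
      intro r
      induction r with
      | zero => intro a l _; simp [(isDer_lie G.euler).map_one]
      | succ r ih =>
        intro a l h
        rw [List.ofFn_succ, List.prod_cons, hd, ih _ (fun t => l t.succ) (fun t => h t.succ), lie_df,
          euler_apply (h 0), G.isFormHom.d_smul, Fin.sum_univ_succ]
        simp [add_smul]
    rw [hd, key a l hl, lie_fn, euler_apply h0, G.fn_smul]
    push_cast
    simp [add_smul]

end GradedFnAlg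

/-! ### Degree bookkeeping and contractions of two-forms -/

namespace GradedFnAlg

variable {E H : Type*} [NormedAddCommGroup E] [NormedSpace ℝ E] [TopologicalSpace H]
  {I : ModelWithCorners ℝ E H} {M : Type*} [TopologicalSpace M] [ChartedSpace H M]
  {G : GradedFnAlg I M}

theorem ofSmooth_mem (h : SmoothFn I M) : G.ofSmooth h ∈ G.deg 0 := (G.mem_deg_zero _).2 ⟨h, rfl⟩

theorem VField.map_mem {q : ℤ} (X : G.VField q) {i k : ℕ} (h : (i : ℤ) + q = k) {a : G.carrier}
    (ha : a ∈ G.deg i) : X.toFun a ∈ G.deg k := by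
  have := X.map_deg ha
  rw [h, degZ, if_pos (by positivity)] at this
  simpa using this

theorem VField.map_eq_zero {q : ℤ} (X : G.VField q) {i : ℕ} (h : (i : ℤ) + q < 0) {a : G.carrier}
    (ha : a ∈ G.deg i) : X.toFun a = 0 := by
  have := X.map_deg ha
  rw [degZ, if_neg (by omega)] at this
  simpa using this

theorem VField.leibniz_odd {q : ℤ} (hq : Odd q) (X : G.VField q) {i : ℕ} {a : G.carrier}
    (b : G.carrier) (ha : a ∈ G.deg i) :
    X.toFun (a * b) = X.toFun a * b + (-1 : ℝ) ^ i • (a * X.toFun b) := by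
  rw [X.leibniz b ha, zpow_mul, hq.neg_one_zpow, zpow_natCast]

theorem VField.leibniz_even {q : ℤ} (hq : Even q) (X : G.VField q) {i : ℕ} {a : G.carrier}
    (b : G.carrier) (ha : a ∈ G.deg i) :
    X.toFun (a * b) = X.toFun a * b + a * X.toFun b := by
  rw [X.leibniz b ha, zpow_mul, hq.neg_one_zpow, one_zpow, one_smul]

theorem df_mul_fn {i j : ℕ} {a b : G.carrier} (ha : a ∈ G.deg i) (hb : b ∈ G.deg j) :
    G.df b * G.fn a = (-1 : ℝ) ^ (i * (j + 1)) • (G.fn a * G.df b) := by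
  rw [G.isFormHom.fn_d_comm ha hb, smul_smul, ← pow_add, Even.neg_one_pow ⟨_, rfl⟩, one_smul]

theorem contract_df_mul_df {q : ℤ} (X : G.VField q) {i : ℕ} {a : G.carrier} (ha : a ∈ G.deg i)
    (b : G.carrier) : G.contract X (G.df a * G.df b) =
      G.fn (X.toFun a) * G.df b + ((-1 : ℝ) ^ (q - 1)) ^ (i + 1) • (G.df a * G.fn (X.toFun b)) := by
  rw [isDer_contract, contract_df, contract_df, G.twist_df _ ha, smul_mul_assoc]

/-- The second contraction, with the Euler field, turns the one-form ι_X(da db) into a function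
without losing information in positive degree. Applied to ι_X ω = ± dh it yields identities between
functions. -/
theorem contract_euler_contract {q : ℤ} (X : G.VField q) {i j : ℕ} {a b : G.carrier}
    (ha : a ∈ G.deg i) (hb : b ∈ G.deg j) : G.contract G.euler (G.contract X (G.df a * G.df b)) =
      G.fn (((-1 : ℝ) ^ ((i : ℤ) + q) * j) • (X.toFun a * b) +
        (((-1 : ℝ) ^ (q - 1)) ^ (i + 1) * i) • (a * X.toFun b)) := by
  rw [contract_df_mul_df X ha, map_add, map_smul, isDer_contract, isDer_contract, contract_fn,
    contract_fn, contract_euler_df hb, contract_euler_df ha, G.isFormHom.fn_add, G.fn_smul, G.fn_smul,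
    G.isFormHom.fn_mul, G.isFormHom.fn_mul]
  have h0 : (-1 : ℝ) ^ ((0 : ℤ) - 1) = -1 := by norm_num
  rw [h0, twist_fn_of_degZ (X.map_deg ha)]
  simp [smul_smul, mul_comm (j : ℝ)]

theorem df_mem_bideg {k : ℕ} {b : G.carrier} (hb : b ∈ G.deg k) : G.df b ∈ G.bideg 1 k :=
  Submodule.subset_span ⟨1, 0, fun _ => b, fun _ => k, SetLike.GradedOne.one_mem, fun _ => hb,
    by simp, by simp [G.fn_one]⟩

theorem fn_mul_df_mem_bideg {i k : ℕ} {a b : G.carrier} (ha : a ∈ G.deg i) (hb : b ∈ G.deg k) :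
    G.fn a * G.df b ∈ G.bideg 1 (i + k) :=
  Submodule.subset_span ⟨a, i, fun _ => b, fun _ => k, ha, fun _ => hb, by simp, by simp⟩

/-- The contraction of a two-form of degree `k` with the Euler vector field is a combination of
one-forms `a db` with `a` of positive degree. -/
theorem contract_euler_two_form {k : ℕ} {x : G.Form} (hx : x ∈ G.bideg 2 k) :
    G.contract G.euler x ∈ Submodule.span ℝ {y | ∃ (i j : ℕ) (a b : G.carrier), a ∈ G.deg i ∧
      b ∈ G.deg j ∧ 1 ≤ i ∧ i + j = k ∧ y = G.fn a * G.df b} := by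
  induction hx using Submodule.span_induction with
  | zero => simp
  | add x y _ _ hx hy => rw [map_add]; exact Submodule.add_mem _ hx hy
  | smul c x _ hx => rw [map_smul]; exact Submodule.smul_mem _ _ hx
  | mem x hx =>
    obtain ⟨a₀, k₀, a, l, h0, hl, rfl, rfl⟩ := hx
    have e : (List.ofFn fun t => G.df (a t)).prod = G.df (a 0) * G.df (a 1) := by
      simp [List.ofFn_succ]
    -- The Euler field contributes the factor l, so a term whose contracted function has degree zero
    -- disappears. This is why the coefficient always has positive degree.
    have key : ∀ {l l' : ℕ} {b c : G.carrier}, b ∈ G.deg l → c ∈ G.deg l' →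
        (l : ℝ) • (G.fn a₀ * (G.fn b * G.df c)) ∈ Submodule.span ℝ
        {y | ∃ (i j : ℕ) (a b : G.carrier), a ∈ G.deg i ∧
          b ∈ G.deg j ∧ 1 ≤ i ∧ i + j = k₀ + l + l' ∧ y = G.fn a * G.df b} := by
      intro l l' b c hb hc
      rcases Nat.eq_zero_or_pos l with h | h
      · simp [h]
      · refine Submodule.smul_mem _ _ (Submodule.subset_span ⟨k₀ + l, l', a₀ * b, c,
          SetLike.mul_mem_graded h0 hb, hc, by omega, rfl, ?_⟩)
        rw [G.isFormHom.fn_mul, mul_assoc]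
    rw [e, isDer_contract, contract_fn, zero_mul, zero_add, G.twist_fn _ h0, contract_df_mul_df _ (hl 0),
      euler_apply (hl 0), euler_apply (hl 1), df_mul_fn (Submodule.smul_mem _ _ (hl 1)) (hl 0),
      G.fn_smul, G.fn_smul, Fin.sum_univ_two]
    simp only [smul_mul_assoc, mul_add, mul_smul_comm]
    refine Submodule.add_mem _ ?_ (Submodule.smul_mem _ _ (Submodule.smul_mem _ _ ?_))
    · rw [smul_comm]
      exact Submodule.smul_mem _ _ (by simpa [add_assoc] using key (hl 0) (hl 1))
    · rw [smul_comm]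
      exact Submodule.smul_mem _ _ (by
        simpa [add_assoc, add_comm (l 1)] using key (hl 1) (hl 0))

theorem exists_sum_of_mem_span {k : ℕ} {x : G.Form} (hx : x ∈ Submodule.span ℝ {y | ∃ (i j : ℕ)
      (a b : G.carrier), a ∈ G.deg i ∧ b ∈ G.deg j ∧ 1 ≤ i ∧ i + j = k ∧ y = G.fn a * G.df b}) :
    ∃ (r : ℕ) (a b : Fin r → G.carrier) (i j : Fin r → ℕ), (∀ t, a t ∈ G.deg (i t)) ∧
      (∀ t, b t ∈ G.deg (j t)) ∧ (∀ t, 1 ≤ i t) ∧ (∀ t, i t + j t = k) ∧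
      x = ∑ t, G.fn (a t) * G.df (b t) := by
  induction hx using Submodule.span_induction with
  | zero => exact ⟨0, Fin.elim0, Fin.elim0, Fin.elim0, Fin.elim0, by simp, by simp, by simp, by simp,
      by simp⟩
  | mem x hx =>
    obtain ⟨i, j, a, b, ha, hb, hi, hij, rfl⟩ := hx
    exact ⟨1, fun _ => a, fun _ => b, fun _ => i, fun _ => j, fun _ => ha, fun _ => hb, fun _ => hi,
      fun _ => hij, by simp⟩
  | add x y _ _ hx hy =>
    obtain ⟨r, a, b, i, j, ha, hb, hi, hij, rfl⟩ := hx
    obtain ⟨r', a', b', i', j', ha', hb', hi', hij', rfl⟩ := hy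
    refine ⟨r + r', Fin.append a a', Fin.append b b', Fin.append i i', Fin.append j j', ?_, ?_, ?_,
      ?_, ?_⟩
    · intro t; refine Fin.addCases (fun t => ?_) (fun t => ?_) t <;> simp [ha, ha']
    · intro t; refine Fin.addCases (fun t => ?_) (fun t => ?_) t <;> simp [hb, hb']
    · intro t; refine Fin.addCases (fun t => ?_) (fun t => ?_) t <;> simp [hi, hi']
    · intro t; refine Fin.addCases (fun t => ?_) (fun t => ?_) t <;> simp [hij, hij']
    · simp [Fin.sum_univ_add]
  | smul c x _ hx =>
    obtain ⟨r, a, b, i, j, ha, hb, hi, hij, rfl⟩ := hx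
    refine ⟨r, fun t => c • a t, b, i, j, fun t => Submodule.smul_mem _ _ (ha t), hb, hi, hij, ?_⟩
    simp [Finset.smul_sum, G.fn_smul]

theorem contract_eq_zero {q : ℤ} (X : G.VField q) (h : ∀ a, X.toFun a = 0) (x : G.Form) :
    G.contract X x = 0 :=
  LinearMap.congr_fun ((isDer_contract X).ext (isDer_zero _) (by simp) (by simp [h, G.fn_zero])) x

end GradedFnAlg

/-! ### The symplectic potential and Hamiltonian vector fields -/

namespace SymplecticQManifold

open GradedFnAlg

universe v w
variable {p n : ℕ} {M : Type v} [TopologicalSpace M] [ChartedSpace (EuclideanSpace ℝ (Fin n)) M]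
  {S : SymplecticQManifold.{v, w} p n M}

/-- Since dω = 0, Cartan's formula reads p ω = L_ξ ω = d ι_ξ ω. -/
theorem d_α (hp : 0 < p) : S.global.d S.α = S.form := by
  have h := lie_euler_of_bideg S.form_mem
  rw [lie, LinearMap.add_apply, LinearMap.comp_apply, S.form_closed, map_zero, zero_add, zpow_zero,
    one_smul, LinearMap.comp_apply] at h
  rw [α, map_smul]
  change (p : ℝ)⁻¹ • (S.sheaf ⊤).d ((S.sheaf ⊤).contract (S.sheaf ⊤).euler S.form) = _
  rw [h, smul_smul, inv_mul_cancel₀ (by positivity), one_smul]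

/-- The symplectic potential and form in terms of finitely many global functions. -/
theorem exists_potential (hp : 0 < p) : ∃ (r : ℕ) (a b : Fin r → S.global.carrier)
    (i j : Fin r → ℕ), (∀ t, a t ∈ S.global.deg (i t)) ∧ (∀ t, b t ∈ S.global.deg (j t)) ∧
      (∀ t, 1 ≤ i t) ∧ (∀ t, i t + j t = p) ∧
      S.α = ∑ t, S.global.fn (a t) * S.global.df (b t) ∧
      S.form = ∑ t, S.global.df (a t) * S.global.df (b t) := by
  have h : S.α ∈ _ := Submodule.smul_mem _ (p : ℝ)⁻¹ (contract_euler_two_form S.form_mem)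
  obtain ⟨r, a, b, i, j, ha, hb, hi, hij, e⟩ := exists_sum_of_mem_span h
  refine ⟨r, a, b, i, j, ha, hb, hi, hij, e, ?_⟩
  rw [← d_α hp, e, map_sum]
  refine Finset.sum_congr rfl fun t _ => ?_
  rw [isDer_d]
  simp

/-! ### Hamiltonian vector fields -/

theorem exists_isHamiltonian {q : ℕ} {f : S.global.carrier} (hf : f ∈ S.global.deg q) :
    ∃ X : S.global.VField (q - p), S.IsHamiltonian q f X := by
  obtain ⟨X, hX, -⟩ := S.form_nondeg q _ (Submodule.smul_mem _ ((-1 : ℝ) ^ (q + 1)) (df_mem_bideg hf))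
  exact ⟨X, hf, rfl, hX⟩

/-- The Hamiltonian vector field of a homogeneous function. -/
def ham {q : ℕ} {f : S.global.carrier} (hf : f ∈ S.global.deg q) : S.global.VField (q - p) :=
  Classical.choose (exists_isHamiltonian hf)

theorem ham_spec {q : ℕ} {f : S.global.carrier} (hf : f ∈ S.global.deg q) :
    S.IsHamiltonian q f (ham hf) := Classical.choose_spec (exists_isHamiltonian hf)

/-- Uniqueness is stated on values because the two fields may live in types whose degrees agree only
propositionally. -/
theorem IsHamiltonian.toFun_eq {q : ℕ} {f : S.global.carrier} {r r' : ℤ} {X : S.global.VField r}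
    {Y : S.global.VField r'} (hX : S.IsHamiltonian q f X) (hY : S.IsHamiltonian q f Y)
    (a : S.global.carrier) : X.toFun a = Y.toFun a := by
  obtain ⟨hf, rfl, hX⟩ := hX
  obtain ⟨-, rfl, hY⟩ := hY
  have h := S.form_nondeg q _ (Submodule.smul_mem _ ((-1 : ℝ) ^ (q + 1)) (df_mem_bideg hf))
  rw [h.unique hX hY]

theorem IsHamiltonian.lie_form {q : ℕ} {f : S.global.carrier} {r : ℤ} {X : S.global.VField r}
    (hX : S.IsHamiltonian q f X) : S.global.lie X S.form = 0 := by
  rw [lie, LinearMap.add_apply, LinearMap.comp_apply, LinearMap.smul_apply, LinearMap.comp_apply,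
    hX.2.2, map_smul, d_df, smul_zero, smul_zero, add_zero]
  exact (congrArg _ S.form_closed).trans (map_zero _)

/-- The commutator of Hamiltonian vector fields is the Hamiltonian vector field of the bracket. -/
theorem IsHamiltonian.commutator {q q' k : ℕ} {f g : S.global.carrier} {r r' : ℤ}
    {X : S.global.VField r} {Y : S.global.VField r'} (hX : S.IsHamiltonian q f X)
    (hY : S.IsHamiltonian q' g Y) (hk : (q' : ℤ) + r = k) :
    S.IsHamiltonian k (X.toFun g) (X.commutator Y) := by
  refine ⟨X.map_mem hk hY.1, ?_, ?_⟩
  · rw [← hk, hY.2.1]; ring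
  -- Because L_X ω = 0, the Cartan identity reduces to ι_[X,Y] ω = L_X ι_Y ω, and L_X dg is ± d(X
  -- g).
  · rw [← lie_contract, hX.lie_form, map_zero, smul_zero, sub_zero, hY.2.2, map_smul, lie_df, smul_smul,
      pow_succ, pow_succ, neg_one_pow_of_add hk]
    congr 1; ring

/-- This compares the two orders of contraction: ι_X ι_Y ω is X g up to sign, and ι_Y ι_X ω is Y f
up to sign. -/
theorem IsHamiltonian.skew {q q' : ℕ} {f g : S.global.carrier} {r r' : ℤ}
    {X : S.global.VField r} {Y : S.global.VField r'} (hX : S.IsHamiltonian q f X)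
    (hY : S.IsHamiltonian q' g Y) :
    (-1 : ℝ) ^ (q' + 1) • X.toFun g =
      ((-1 : ℝ) ^ ((r - 1) * (r' - 1)) * (-1) ^ (q + 1)) • Y.toFun f := by
  have h := contract_contract X Y S.form
  rw [hX.2.2, hY.2.2, map_smul, map_smul, contract_df, contract_df, smul_smul, ← fn_smul,
    ← fn_smul] at h
  exact fn_injective h

/-! ### The Hamiltonian of the homological vector field -/

theorem d_contract_Q : S.global.d (S.global.contract S.Q S.form) = 0 := by
  have h := S.Q_symplectic
  rw [lie, LinearMap.add_apply, LinearMap.comp_apply, S.form_closed, map_zero, zero_add, zpow_one,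
    LinearMap.smul_apply, neg_one_smul, neg_eq_zero] at h
  exact h

theorem contract_Q_mem (hp : 0 < p) : S.global.contract S.Q S.form ∈ S.global.bideg 1 (p + 1) := by
  obtain ⟨r, a, b, i, j, ha, hb, hi, hij, -, e⟩ := exists_potential (S := S) hp
  rw [e, map_sum]
  refine Submodule.sum_mem _ fun t _ => ?_
  have hQa : S.Q.toFun (a t) ∈ S.global.deg (i t + 1) := S.Q.map_mem (by simp) (ha t)
  have hQb : S.Q.toFun (b t) ∈ S.global.deg (j t + 1) := S.Q.map_mem (by simp) (hb t)
  rw [contract_df_mul_df _ (ha t), df_mul_fn hQb (ha t)]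
  refine Submodule.add_mem _ ?_ (Submodule.smul_mem _ _ (Submodule.smul_mem _ _ ?_))
  · have := fn_mul_df_mem_bideg hQa (hb t)
    rwa [show i t + 1 + j t = p + 1 by have := hij t; omega] at this
  · have := fn_mul_df_mem_bideg hQb (ha t)
    rwa [show j t + 1 + i t = p + 1 by have := hij t; omega] at this

/-- The one-form ι_Q ω is closed and has degree p + 1, so L_ξ shows that it is d(ι_ξ ι_Q ω) / (p +
1). The Euler homotopy plays the role of the Poincaré lemma, with no condition on the topology of
the body. -/
theorem existsUnique_hamiltonian_Q (hp : 0 < p) : ∃! h, S.IsHamiltonian (p + 1) h S.Q := by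
  have hu : ∃ u ∈ S.global.deg (p + 1), S.global.contract S.global.euler
      (S.global.contract S.Q S.form) = S.global.fn u := by
    obtain ⟨r, a, b, i, j, ha, hb, hi, hij, -, e⟩ := exists_potential (S := S) hp
    rw [e, map_sum, map_sum]
    refine ⟨_, ?_, (Finset.sum_congr rfl fun t _ =>
      contract_euler_contract S.Q (ha t) (hb t)).trans (S.global.fn_sum _ _).symm⟩
    refine Submodule.sum_mem _ fun t _ => ?_
    have hQa : S.Q.toFun (a t) ∈ S.global.deg (i t + 1) := S.Q.map_mem (by simp) (ha t)
    have hQb : S.Q.toFun (b t) ∈ S.global.deg (j t + 1) := S.Q.map_mem (by simp) (hb t)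
    refine Submodule.add_mem _ (Submodule.smul_mem _ _ ?_) (Submodule.smul_mem _ _ ?_)
    · have := SetLike.mul_mem_graded hQa (hb t)
      rwa [show i t + 1 + j t = p + 1 by have := hij t; omega] at this
    · have := SetLike.mul_mem_graded (ha t) hQb
      rwa [show i t + (j t + 1) = p + 1 by have := hij t; omega] at this
  obtain ⟨u, hu, e⟩ := hu
  have h := lie_euler_of_bideg (contract_Q_mem (S := S) hp)
  rw [lie, LinearMap.add_apply, LinearMap.comp_apply, d_contract_Q, map_zero, zero_add, zpow_zero,
    one_smul, LinearMap.comp_apply, e, d_fn] at h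
  have hne : ((p + 1 : ℕ) : ℝ) ≠ 0 := by positivity
  have hs : ((-1 : ℝ) ^ (p + 1 + 1)) * (-1) ^ (p + 1 + 1) = 1 := by
    rw [← mul_pow]; norm_num
  refine ⟨((-1 : ℝ) ^ (p + 1 + 1) * ((p + 1 : ℕ) : ℝ)⁻¹) • u, ⟨Submodule.smul_mem _ _ hu,
    by push_cast; ring, ?_⟩, ?_⟩
  · rw [S.global.isFormHom.d_smul, h, smul_smul, smul_smul, ← mul_assoc, hs, one_mul,
      inv_mul_cancel₀ hne, one_smul]
  -- Contracting ι_Q ω = ± dy with the Euler field recovers (p + 1) y, so y is determined.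
  · rintro y ⟨hy, -, hy'⟩
    rw [hy', map_smul, contract_euler_df hy, smul_smul, ← fn_smul] at e
    rw [← fn_injective e, smul_smul, mul_mul_mul_comm, hs, inv_mul_cancel₀ hne, one_mul, one_smul]

/-- Qh is the Hamiltonian of [Q, Q] = 2 Q² = 0, so d(Qh) = 0; as Qh has degree p + 2 > 0, it
vanishes. This is the classical master equation. -/
theorem IsHamiltonian.Q_hamiltonian {h : S.global.carrier} (hh : S.IsHamiltonian (p + 1) h S.Q) :
    S.Q.toFun h = 0 := by
  have h1 := hh.commutator hh (k := p + 2) (by push_cast; ring)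
  refine eq_zero_of_df_eq_zero (k := p + 2) (by omega) h1.1 ?_
  have h2 := h1.2.2
  rw [contract_eq_zero _ (fun a => by simp [VField.commutator, S.Q_sq])] at h2
  exact (smul_eq_zero_iff_right (pow_ne_zero _ (by norm_num))).1 h2.symm

/-- `X_{Qf} = [Q, X_f]`. -/
theorem IsHamiltonian.Q_bracket (hp : 0 < p) {q k : ℕ} {f : S.global.carrier} {r : ℤ}
    {X : S.global.VField r} (hX : S.IsHamiltonian q f X) (hk : q + 1 = k) :
    S.IsHamiltonian k (S.Q.toFun f) (S.Q.commutator X) := by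
  obtain ⟨h, hh, -⟩ := existsUnique_hamiltonian_Q (S := S) hp
  exact hh.commutator hX (by rw [← hk]; push_cast; ring)

end SymplecticQManifold

namespace GradedFnAlg

variable {E H : Type*} [NormedAddCommGroup E] [NormedSpace ℝ E] [TopologicalSpace H]
  {I : ModelWithCorners ℝ E H} {M : Type*} [TopologicalSpace M] [ChartedSpace H M]
  {G : GradedFnAlg I M}

/-- The negative of a vector field. -/
def VField.neg {q : ℤ} (X : G.VField q) : G.VField q where
  toFun := -X.toFun
  map_deg ha := Submodule.neg_mem _ (X.map_deg ha)
  leibniz b ha := by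
    simp only [LinearMap.neg_apply, X.leibniz b ha, neg_add, neg_mul, mul_neg, smul_neg]
  chain F hF h := by simp [X.chain F hF h]

theorem contract_neg {q : ℤ} (X : G.VField q) (x : G.Form) :
    G.contract X.neg x = -G.contract X x := by
  have h := (isDer_contract X.neg).ext ((isDer_contract X).smul (-1)) (by simp) (by
    intro k a _
    simp [VField.neg, ← G.fn_smul, -neg_smul]
    simp)
  rw [h]; simp

end GradedFnAlg

namespace SymplecticQManifold

open GradedFnAlg

universe v w

theorem IsHamiltonian.neg {p n : ℕ} {M : Type v} [TopologicalSpace M]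
    [ChartedSpace (EuclideanSpace ℝ (Fin n)) M] {S : SymplecticQManifold.{v, w} p n M} {q : ℕ}
    {f : S.global.carrier} {r : ℤ} {X : S.global.VField r} (hX : S.IsHamiltonian q f X) :
    S.IsHamiltonian q (-f) X.neg := by
  refine ⟨Submodule.neg_mem _ hX.1, hX.2.1, ?_⟩
  rw [contract_neg, hX.2.2, ← neg_one_smul ℝ f, S.global.isFormHom.d_smul, neg_one_smul, smul_neg]

/-! ### Degree one: Poisson manifolds -/

section Poisson

variable {n : ℕ} {M : Type v} [TopologicalSpace M] [ChartedSpace (EuclideanSpace ℝ (Fin n)) M]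
  {S : SymplecticQManifold.{v, w} 1 n M}

theorem Q_ofSmooth_mem {p : ℕ} {S : SymplecticQManifold.{v, w} p n M}
    (a : SmoothFn (𝓡 n) (⊤ : Opens M)) : S.Q.toFun (S.global.ofSmooth a) ∈ S.global.deg 1 :=
  S.Q.map_mem (by simp) (ofSmooth_mem a)

variable (S) in
/-- The Hamiltonian vector field of `Q a`. -/
def derivedField (a : SmoothFn (𝓡 n) (⊤ : Opens M)) :
    S.global.VField (((1 : ℕ) : ℤ) - ((1 : ℕ) : ℤ)) :=
  ham (Q_ofSmooth_mem a)

theorem derivedField_spec (a : SmoothFn (𝓡 n) (⊤ : Opens M)) :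
    S.IsHamiltonian 1 (S.Q.toFun (S.global.ofSmooth a)) (S.derivedField a) := ham_spec _

/-- In X_{Qb} = Q X_b + X_b Q the first term kills a, since X_b a would have degree −1. So X_{Qb} a
= X_b Q a, and `IsHamiltonian.skew` compares this with X_{Qa} b. -/
theorem derivedField_skew (a b : SmoothFn (𝓡 n) (⊤ : Opens M)) :
    (S.derivedField a).toFun (S.global.ofSmooth b) =
      -(S.derivedField b).toFun (S.global.ofSmooth a) := by
  have hb := ham_spec (S := S) (ofSmooth_mem b)
  have h1 := (derivedField_spec a).skew hb
  have h2 := (derivedField_spec b).toFun_eq (hb.Q_bracket one_pos rfl) (S.global.ofSmooth a)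
  have h3 : (ham (S := S) (ofSmooth_mem b)).toFun (S.global.ofSmooth a) = 0 :=
    VField.map_eq_zero _ (by norm_num) (ofSmooth_mem a)
  rw [h2]
  simp only [VField.commutator, LinearMap.sub_apply, LinearMap.comp_apply, LinearMap.smul_apply, h3,
    map_zero]
  norm_num at h1 ⊢
  rw [← h1, neg_neg]

/-- X_{Qa} = Q X_a + X_a Q commutes with Q because Q² = 0; both sides equal Q X_a Q c. -/
theorem derivedField_Q (a : SmoothFn (𝓡 n) (⊤ : Opens M)) (c : S.global.carrier) :
    S.Q.toFun ((S.derivedField a).toFun c) = (S.derivedField a).toFun (S.Q.toFun c) := by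
  have ha := ham_spec (S := S) (ofSmooth_mem a)
  have h2 := (derivedField_spec a).toFun_eq (ha.Q_bracket one_pos rfl)
  rw [h2, h2]
  simp [VField.commutator, S.Q_sq]

theorem exists_derivedBracket (a b : SmoothFn (𝓡 n) (⊤ : Opens M)) :
    ∃ c, S.global.ofSmooth c = -(S.derivedField a).toFun (S.global.ofSmooth b) :=
  (S.global.mem_deg_zero _).1 (Submodule.neg_mem _
    (VField.map_mem _ (by norm_num) (ofSmooth_mem b)))

variable (S) in
/-- The derived bracket `{a, b} = -X_{Qa} b` of two functions on the body. -/
def derivedBracketFun (a b : SmoothFn (𝓡 n) (⊤ : Opens M)) : SmoothFn (𝓡 n) (⊤ : Opens M) :=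
  Classical.choose (exists_derivedBracket (S := S) a b)

theorem ofSmooth_derivedBracketFun (a b : SmoothFn (𝓡 n) (⊤ : Opens M)) :
    S.global.ofSmooth (S.derivedBracketFun a b) =
      -(S.derivedField a).toFun (S.global.ofSmooth b) :=
  Classical.choose_spec (exists_derivedBracket (S := S) a b)

theorem derivedBracketFun_skew (a b : SmoothFn (𝓡 n) (⊤ : Opens M)) :
    S.derivedBracketFun a b = -S.derivedBracketFun b a := by
  apply S.global.ofSmooth_injective
  rw [map_neg, ofSmooth_derivedBracketFun, ofSmooth_derivedBracketFun, derivedField_skew]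

theorem derivedBracketFun_add (a b c : SmoothFn (𝓡 n) (⊤ : Opens M)) :
    S.derivedBracketFun a (b + c) = S.derivedBracketFun a b + S.derivedBracketFun a c := by
  apply S.global.ofSmooth_injective
  simp only [map_add, ofSmooth_derivedBracketFun, neg_add]

theorem derivedBracketFun_smul (r : ℝ) (a b : SmoothFn (𝓡 n) (⊤ : Opens M)) :
    S.derivedBracketFun a (r • b) = r • S.derivedBracketFun a b := by
  apply S.global.ofSmooth_injective
  simp only [map_smul, ofSmooth_derivedBracketFun, smul_neg]

variable (S) in
/-- The derived bracket as a bilinear map. -/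
def derivedBracket : SmoothFn (𝓡 n) (⊤ : Opens M) →ₗ[ℝ] SmoothFn (𝓡 n) (⊤ : Opens M) →ₗ[ℝ]
    SmoothFn (𝓡 n) (⊤ : Opens M) :=
  LinearMap.mk₂ ℝ S.derivedBracketFun
    (fun a b c => by
      rw [derivedBracketFun_skew, derivedBracketFun_add, derivedBracketFun_skew a,
        derivedBracketFun_skew b, neg_add])
    (fun r a b => by
      rw [derivedBracketFun_skew, derivedBracketFun_smul, derivedBracketFun_skew a, smul_neg])
    derivedBracketFun_add (fun r a b => derivedBracketFun_smul r a b)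

theorem ofSmooth_derivedBracket (a b : SmoothFn (𝓡 n) (⊤ : Opens M)) :
    S.global.ofSmooth (S.derivedBracket a b) =
      -(S.derivedField a).toFun (S.global.ofSmooth b) := ofSmooth_derivedBracketFun a b

theorem isDerivedPoisson_derivedBracket : IsDerivedPoisson S (fun a b => S.derivedBracket a b) := by
  intro a b r X hX
  rw [ofSmooth_derivedBracket, hX.toFun_eq (derivedField_spec a)]

theorem isPoissonBracket_derivedBracket : IsPoissonBracket S.derivedBracket where
  skew a b := derivedBracketFun_skew a b
  leibniz a b c := by
    apply S.global.ofSmooth_injective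
    simp only [map_add, map_mul, ofSmooth_derivedBracket]
    rw [VField.leibniz_even (by norm_num) _ _ (ofSmooth_mem b)]
    noncomm_ring
  jacobi a b c := by
    apply S.global.ofSmooth_injective
    have h1 : S.Q.toFun (S.global.ofSmooth (S.derivedBracket a b)) =
        -(S.derivedField a).toFun (S.Q.toFun (S.global.ofSmooth b)) := by
      rw [ofSmooth_derivedBracket, map_neg, derivedField_Q]
    have h2 := (derivedField_spec (S := S) a).commutator (derivedField_spec b) (k := 1) (by norm_num)
    have h3 : S.IsHamiltonian 1 (-(S.derivedField a).toFun (S.Q.toFun (S.global.ofSmooth b)))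
        (S.derivedField (S.derivedBracket a b)) := h1 ▸ derivedField_spec _
    -- X_{Q{a,b}} and −[X_{Qa}, X_{Qb}] have the same Hamiltonian −X_{Qa} Q b. Evaluating their
    -- equality on c is the Jacobi identity.
    have h4 : ∀ u, (S.derivedField (S.derivedBracket a b)).toFun u =
        -((S.derivedField a).commutator (S.derivedField b)).toFun u := by
      have h5 : S.IsHamiltonian 1 (-(S.derivedField a).toFun (S.Q.toFun (S.global.ofSmooth b)))
          (VField.neg ((S.derivedField a).commutator (S.derivedField b))) := h2.neg
      exact fun u => h3.toFun_eq h5 u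
    simp only [map_add, ofSmooth_derivedBracket, map_neg, h4, VField.commutator]
    simp

/-- Contract ι_X ω = ± df with the Euler field: it kills xⁱ and fixes Pᵢ on the left, and it counts
the degree q of f on the right. -/
theorem _root_.IsPoissonFrame.expand {r : ℕ} {x : Fin r → SmoothFn (𝓡 n) (⊤ : Opens M)}
    {P : Fin r → S.global.carrier} (hf : IsPoissonFrame S x P) {q : ℕ} {f : S.global.carrier} {k : ℤ}
    {X : S.global.VField k} (hX : S.IsHamiltonian q f X) :
    ((-1 : ℝ) ^ (q + 1) * q) • f = ∑ i, P i * X.toFun (S.global.ofSmooth (x i)) := by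
  have h := congrArg (S.global.contract S.global.euler) hX.2.2
  rw [map_smul, contract_euler_df hX.1, smul_smul, ← fn_smul, hf.2, map_sum, map_sum,
    Finset.sum_congr rfl fun i _ => contract_euler_contract X (hf.1 i) (ofSmooth_mem (x i)),
    ← fn_sum] at h
  rw [← fn_injective h]
  refine Finset.sum_congr rfl fun i _ => ?_
  simp [mul_comm, neg_one_zpow_mul_self, pow_two]

/-- For p = 1 the terms a db of the potential, with a of positive degree, necessarily have degrees
(1, 0), so they already form a frame. -/
theorem exists_isPoissonFrame : ∃ (r : ℕ) (x : Fin r → SmoothFn (𝓡 n) (⊤ : Opens M))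
    (P : Fin r → S.global.carrier), IsPoissonFrame S x P := by
  obtain ⟨r, a, b, i, j, ha, hb, hi, hij, -, e⟩ := exists_potential (S := S) one_pos
  have hi' : ∀ t, i t = 1 := fun t => by have := hij t; have := hi t; omega
  have hb' : ∀ t, ∃ x, S.global.ofSmooth x = b t := fun t =>
    (S.global.mem_deg_zero _).1 (by
      have := hb t
      rwa [show j t = 0 by have := hij t; have := hi t; omega] at this)
  choose x hx using hb'
  exact ⟨r, x, a, fun t => by have := ha t; rwa [hi' t] at this, by simpa [hx] using e⟩

/-- The Hamiltonian `½ πⁱʲ Pᵢ Pⱼ` of a Poisson structure. -/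
theorem _root_.IsPoissonFrame.hamiltonian_eq {r : ℕ} {x : Fin r → SmoothFn (𝓡 n) (⊤ : Opens M)}
    {P : Fin r → S.global.carrier} (hf : IsPoissonFrame S x P) {h : S.global.carrier}
    (hh : S.IsHamiltonian (1 + 1) h S.Q) :
    h = (1 / 2 : ℝ) • ∑ i, ∑ k, S.global.ofSmooth (S.derivedBracket (x i) (x k)) * P i * P k := by
  -- The expansion is applied twice: here to Q xⁱ, of degree 1, with coefficient 1, and below to h,
  -- of degree 2, with coefficient −2. The latter is the source of the factor ½.
  have e1 : ∀ i, S.Q.toFun (S.global.ofSmooth (x i)) =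
      -∑ k, P k * S.global.ofSmooth (S.derivedBracket (x i) (x k)) := by
    intro i
    have := hf.expand (derivedField_spec (x i))
    simp only [ofSmooth_derivedBracket, mul_neg, Finset.sum_neg_distrib, neg_neg]
    rw [← this]; norm_num
  have e2 := hf.expand hh
  have comm : ∀ i k, P i * (P k * S.global.ofSmooth (S.derivedBracket (x i) (x k))) =
      S.global.ofSmooth (S.derivedBracket (x i) (x k)) * P i * P k := by
    intro i k
    rw [← mul_assoc, S.global.comm (SetLike.mul_mem_graded (hf.1 i) (hf.1 k)) (ofSmooth_mem _)]
    simp [mul_assoc]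
  simp only [e1, mul_neg, Finset.mul_sum, comm, Finset.sum_neg_distrib] at e2
  rw [eq_neg_iff_add_eq_zero] at e2
  have : ∑ i, ∑ k, S.global.ofSmooth (S.derivedBracket (x i) (x k)) * P i * P k = (2 : ℝ) • h := by
    rw [← sub_eq_zero, ← e2]; norm_num [sub_eq_add_neg, add_comm]
  rw [this, smul_smul]; norm_num

/-- For p = 1 the potential is Σ Pᵢ dxⁱ, because the Euler field kills xⁱ, and the sign (−1)^(p+1)
in front of the Hamiltonian is +1. -/
theorem _root_.IsPoissonFrame.akszLagrangian_eq {r : ℕ} {x : Fin r → SmoothFn (𝓡 n) (⊤ : Opens M)}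
    {P : Fin r → S.global.carrier} (hf : IsPoissonFrame S x P) {h : S.global.carrier}
    (hh : S.IsHamiltonian (1 + 1) h S.Q) {m : ℕ} {H : Type*} [TopologicalSpace H]
    {I : ModelWithCorners ℝ (EuclideanSpace ℝ (Fin m)) H}
    {B : Type*} [TopologicalSpace B] [ChartedSpace H B] [IsManifold I ∞ B]
    (φ : S.global.carrier →ₐ[ℝ] DForm I B) (κ : S.global.Form →ₐ[ℝ] DForm I B)
    (hκ : IsFieldStrength S.global 0 φ κ) :
    akszLagrangian S φ κ h = poissonLagrangian S φ (fun a b => S.derivedBracket a b) x P := by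
  have hα : S.α = ∑ i, S.global.fn (P i) * S.global.df (S.global.ofSmooth (x i)) := by
    rw [α, hf.2, map_sum]
    simp only [Nat.cast_one, inv_one, one_smul]
    refine Finset.sum_congr rfl fun i _ => ?_
    rw [contract_df_mul_df _ (hf.1 i), euler_apply (hf.1 i), euler_apply (ofSmooth_mem (x i))]
    simp [fn_zero]
  rw [akszLagrangian, poissonLagrangian, hα, map_sum]
  congr 1
  · refine Finset.sum_congr rfl fun i _ => ?_
    rw [map_mul, (hκ _).1, (hκ _).2]
    simp
  · rw [hf.hamiltonian_eq hh]
    simp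

end Poisson

end SymplecticQManifold

namespace SymplecticQManifold

open GradedFnAlg

universe v w

/-! ### Degree two: Courant algebroids -/

section Courant

variable {n : ℕ} {M : Type v} [TopologicalSpace M] [ChartedSpace (EuclideanSpace ℝ (Fin n)) M]
  {S : SymplecticQManifold.{v, w} 2 n M}

variable (S) in
open Classical in
/-- The pairing `⟨e, b⟩ = X_e b`. -/
def pairing (e b : S.global.carrier) : S.global.carrier :=
  if he : e ∈ S.global.deg 1 then (ham he).toFun b else 0

variable (S) in
/-- The anchor `ρ(e) b = X_e Q b`. -/
def derivedAnchor (e b : S.global.carrier) : S.global.carrier := S.pairing e (S.Q.toFun b)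

variable (S) in
/-- The Dorfman bracket `[e, b] = (X_e Q + Q X_e) b`. -/
def dorfman (e b : S.global.carrier) : S.global.carrier :=
  S.pairing e (S.Q.toFun b) + S.Q.toFun (S.pairing e b)

theorem pairing_eq {e : S.global.carrier} (he : e ∈ S.global.deg 1) (b : S.global.carrier) :
    S.pairing e b = (ham he).toFun b := by rw [pairing, dif_pos he]

theorem pairing_add {e : S.global.carrier} (he : e ∈ S.global.deg 1) (b c : S.global.carrier) :
    S.pairing e (b + c) = S.pairing e b + S.pairing e c := by simp only [pairing_eq he, map_add]

theorem pairing_smul_real {e : S.global.carrier} (he : e ∈ S.global.deg 1) (r : ℝ)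
    (b : S.global.carrier) : S.pairing e (r • b) = r • S.pairing e b := by
  simp only [pairing_eq he, map_smul]

theorem pairing_sum {e : S.global.carrier} (he : e ∈ S.global.deg 1) {ι : Type*} (s : Finset ι)
    (b : ι → S.global.carrier) : S.pairing e (∑ i ∈ s, b i) = ∑ i ∈ s, S.pairing e (b i) := by
  simp only [pairing_eq he, map_sum]

theorem pairing_deg_zero {e b : S.global.carrier} (he : e ∈ S.global.deg 1)
    (hb : b ∈ S.global.deg 0) : S.pairing e b = 0 := by
  rw [pairing_eq he]; exact VField.map_eq_zero _ (by norm_num) hb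

theorem pairing_mem {e b : S.global.carrier} (he : e ∈ S.global.deg 1) {k : ℕ}
    (hb : b ∈ S.global.deg (k + 1)) : S.pairing e b ∈ S.global.deg k := by
  rw [pairing_eq he]; exact VField.map_mem _ (by push_cast; ring) hb

theorem pairing_mul {e a : S.global.carrier} (he : e ∈ S.global.deg 1) {i : ℕ}
    (ha : a ∈ S.global.deg i) (b : S.global.carrier) :
    S.pairing e (a * b) = S.pairing e a * b + (-1 : ℝ) ^ i • (a * S.pairing e b) := by
  simp only [pairing_eq he]
  exact VField.leibniz_odd ⟨-1, by norm_num⟩ _ b ha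

theorem Q_mul {p : ℕ} {S : SymplecticQManifold.{v, w} p n M} {a : S.global.carrier} {i : ℕ}
    (ha : a ∈ S.global.deg i) (b : S.global.carrier) :
    S.Q.toFun (a * b) = S.Q.toFun a * b + (-1 : ℝ) ^ i • (a * S.Q.toFun b) :=
  VField.leibniz_odd odd_one _ b ha

theorem Q_mem {p : ℕ} {S : SymplecticQManifold.{v, w} p n M} {a : S.global.carrier} {i : ℕ}
    (ha : a ∈ S.global.deg i) : S.Q.toFun a ∈ S.global.deg (i + 1) := S.Q.map_mem (by simp) ha

theorem deg_zero_mul_comm {p : ℕ} {S : SymplecticQManifold.{v, w} p n M} {a b : S.global.carrier}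
    (ha : a ∈ S.global.deg 0) {i : ℕ} (hb : b ∈ S.global.deg i) : b * a = a * b := by
  rw [S.global.comm hb ha]; simp

theorem pairing_symm {e e' : S.global.carrier} (he : e ∈ S.global.deg 1)
    (he' : e' ∈ S.global.deg 1) : S.pairing e e' = S.pairing e' e := by
  have h := (ham_spec he).skew (ham_spec he')
  rw [pairing_eq he, pairing_eq he']
  norm_num at h
  exact h

theorem pairing_eq_neg {e f : S.global.carrier} (he : e ∈ S.global.deg 1)
    (hf : f ∈ S.global.deg 2) : S.pairing e f = -(ham hf).toFun e := by
  have h := (ham_spec he).skew (ham_spec hf)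
  rw [pairing_eq he]
  norm_num at h
  rw [← h, neg_neg]

/-- The Dorfman bracket with `e` is the Hamiltonian vector field of `Q e`. -/
theorem dorfman_eq {e : S.global.carrier} (he : e ∈ S.global.deg 1) (b : S.global.carrier) :
    S.dorfman e b = (ham (Q_mem he)).toFun b := by
  rw [(ham_spec (Q_mem he)).toFun_eq ((ham_spec he).Q_bracket two_pos rfl) b]
  simp only [dorfman, pairing_eq he, VField.commutator, LinearMap.sub_apply, LinearMap.comp_apply,
    LinearMap.smul_apply]
  norm_num [add_comm]

/-- As Q² = 0, both sides reduce to Q X_e Q b. -/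
theorem dorfman_Q {e : S.global.carrier} (b : S.global.carrier) (he : e ∈ S.global.deg 1) :
    S.Q.toFun (S.dorfman e b) = S.dorfman e (S.Q.toFun b) := by
  rw [dorfman, dorfman, map_add, S.Q_sq, S.Q_sq, pairing_eq he 0, map_zero]
  abel

theorem dorfman_mem {e b : S.global.carrier} (he : e ∈ S.global.deg 1) {k : ℕ}
    (hb : b ∈ S.global.deg k) : S.dorfman e b ∈ S.global.deg k := by
  rw [dorfman_eq he]; exact VField.map_mem _ (by push_cast; ring) hb

theorem dorfman_deg_zero {e b : S.global.carrier} (he : e ∈ S.global.deg 1)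
    (hb : b ∈ S.global.deg 0) : S.dorfman e b = S.derivedAnchor e b := by
  rw [dorfman, derivedAnchor, pairing_deg_zero he hb, map_zero, add_zero]

/-- X_{Qe} has degree zero and [X_{Qe}, X_f] = X_{[e,f]}. With f = Q e₂ this is the Jacobi identity
of the Dorfman bracket, and with f = e₁ it is the invariance of the pairing. -/
theorem dorfman_hamiltonian {e : S.global.carrier} (he : e ∈ S.global.deg 1) {k : ℕ}
    {f : S.global.carrier} (hf : f ∈ S.global.deg k) (b : S.global.carrier) :
    S.dorfman e ((ham hf).toFun b) =
      (ham (dorfman_mem he hf)).toFun b + (ham hf).toFun (S.dorfman e b) := by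
  have h := (ham_spec (Q_mem he)).commutator (ham_spec hf) (k := k) (by push_cast; ring)
  rw [← dorfman_eq he] at h
  rw [(ham_spec (dorfman_mem he hf)).toFun_eq h b, dorfman_eq he, dorfman_eq he]
  simp only [VField.commutator, LinearMap.sub_apply, LinearMap.comp_apply, LinearMap.smul_apply]
  norm_num

/-- `ham` depends on a membership proof, so an equality of functions is transported by this lemma
instead of by rewriting. -/
theorem ham_congr {p q : ℕ} {S : SymplecticQManifold.{v, w} p n M} {f g : S.global.carrier}
    (h : f = g) (hf : f ∈ S.global.deg q) (hg : g ∈ S.global.deg q) (b : S.global.carrier) :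
    (ham hf).toFun b = (ham hg).toFun b := by subst h; rfl

/-- By skew-symmetry X_e Q e = −X_{Qe} e = −[e, e], so the definition reads [e, e] = −[e, e] + Q⟨e,
e⟩. -/
theorem dorfman_self {e : S.global.carrier} (he : e ∈ S.global.deg 1) :
    (2 : ℝ) • S.dorfman e e = S.Q.toFun (S.pairing e e) := by
  have h : S.dorfman e e = S.pairing e (S.Q.toFun e) + S.Q.toFun (S.pairing e e) := rfl
  rw [pairing_eq_neg he (Q_mem he), ← dorfman_eq he, eq_neg_add_iff_add_eq, ← two_smul ℝ] at h
  exact h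

/-! #### Frames -/

/-- As in degree one, ι_X ω = ± df is contracted with the Euler field. The factor 2 is the degree of
Pᵢ; the two contractions of the ξ-part agree after using the symmetry of g, which absorbs the factor
½ of the form. -/
theorem _root_.IsCourantFrame.expand {r s : ℕ} {x : Fin r → SmoothFn (𝓡 n) (⊤ : Opens M)}
    {P : Fin r → S.global.carrier} {ξ : Fin s → S.global.carrier} {g : Matrix (Fin s) (Fin s) ℝ}
    (hf : IsCourantFrame S x P ξ g) {q : ℕ} {f : S.global.carrier} {k : ℤ}
    {X : S.global.VField k} (hX : S.IsHamiltonian q f X) :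
    ((-1 : ℝ) ^ (q + 1) * q) • f = (2 * (-1 : ℝ) ^ (k - 1)) • ∑ i, P i * X.toFun (S.global.ofSmooth (x i)) +
      ∑ a, ξ a * X.toFun (∑ b, g a b • ξ b) := by
  have h := congrArg (S.global.contract S.global.euler) hX.2.2
  have e1 : S.global.contract S.global.euler (S.global.contract X S.form) = S.global.fn
      ((2 * (-1 : ℝ) ^ (k - 1)) • ∑ i, P i * X.toFun (S.global.ofSmooth (x i)) +
      ∑ a, ξ a * X.toFun (∑ b, g a b • ξ b)) := by
    have sq : ∀ l : ℤ, ((-1 : ℝ) ^ l) ^ 2 = 1 := fun l => by rw [pow_two, neg_one_zpow_mul_self]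
    rw [hf.2.2.2]
    simp only [map_add, map_sum, map_smul, contract_euler_contract X (hf.1 _) (ofSmooth_mem (x _)),
      contract_euler_contract X (hf.2.1 _) (hf.2.1 _)]
    simp only [← S.global.fn_smul, ← S.global.fn_sum, ← S.global.isFormHom.fn_add]
    congr 1
    congr 1
    · rw [Finset.smul_sum]
      refine Finset.sum_congr rfl fun i _ => ?_
      rw [pow_succ, sq]
      simp [mul_comm]
    -- X ξᵃ has degree 1 + k, so moving ξᵇ past it gives exactly the sign that the contraction
    -- produced.
    · have comm : ∀ a b, (-1 : ℝ) ^ (1 + k) • (X.toFun (ξ a) * ξ b) = ξ b * X.toFun (ξ a) := by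
        intro a b
        rcases S.global.degZ_mem (X.map_deg (hf.2.1 a)) with h | ⟨l, hl, h⟩
        · simp [h]
        · rw [S.global.comm h (hf.2.1 b), smul_smul]
          push_cast at hl
          rw [hl, mul_one, zpow_natCast, ← mul_pow]; simp
      have e2 : ∀ a b, ((-1 : ℝ) ^ (((1 : ℕ) : ℤ) + k) * ((1 : ℕ) : ℝ)) • (X.toFun (ξ a) * ξ b) +
          (((-1 : ℝ) ^ (k - 1)) ^ (1 + 1) * ((1 : ℕ) : ℝ)) • (ξ a * X.toFun (ξ b)) =
          ξ b * X.toFun (ξ a) + ξ a * X.toFun (ξ b) := by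
        intro a b
        rw [← comm a b, sq]; simp only [Nat.cast_one, mul_one, one_smul]
      simp only [e2, smul_add, Finset.sum_add_distrib]
      rw [Finset.sum_comm]
      simp only [fun a b => hf.2.2.1.apply a b, Finset.mul_sum, mul_smul_comm]
      rw [← add_smul]
      norm_num
  rw [e1, map_smul, contract_euler_df hX.1, smul_smul, ← fn_smul] at h
  exact (fn_injective h).symm

/-- The terms with Pᵢ drop out because X_e has degree −1 and kills xⁱ. The ξᵃ need not be a basis;
this expansion replaces dual bases in what follows. -/
theorem _root_.IsCourantFrame.expand_one {r s : ℕ} {x : Fin r → SmoothFn (𝓡 n) (⊤ : Opens M)}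
    {P : Fin r → S.global.carrier} {ξ : Fin s → S.global.carrier} {g : Matrix (Fin s) (Fin s) ℝ}
    (hf : IsCourantFrame S x P ξ g) {e : S.global.carrier} (he : e ∈ S.global.deg 1) :
    e = ∑ a, ξ a * S.pairing e (∑ b, g a b • ξ b) := by
  have h := hf.expand (ham_spec he)
  simp only [← pairing_eq he, pairing_deg_zero he (ofSmooth_mem _), mul_zero, Finset.sum_const_zero,
    smul_zero, zero_add] at h
  rw [← h]; norm_num

/-- For p = 2 the terms da db of ω have degrees (2, 0) or (1, 1). The first kind gives dP dx. A term
du dv of the second kind is ½(du dv + dv du), since differentials of functions of degree one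
commute; this is an off-diagonal block of g. -/
theorem exists_isCourantFrame : ∃ (r s : ℕ) (x : Fin r → SmoothFn (𝓡 n) (⊤ : Opens M))
    (P : Fin r → S.global.carrier) (ξ : Fin s → S.global.carrier) (g : Matrix (Fin s) (Fin s) ℝ),
    IsCourantFrame S x P ξ g := by
  obtain ⟨r, a, b, i, j, ha, hb, hi, hij, -, e⟩ := exists_potential (S := S) two_pos
  -- At an index of type (1, 1) the value of x is an irrelevant default, because P is set to zero
  -- there.
  have hx : ∀ t, ∃ x, i t = 2 → S.global.ofSmooth x = b t := by
    intro t
    by_cases h : i t = 2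
    · have := hb t
      rw [show j t = 0 by have := hij t; omega] at this
      obtain ⟨x, hx⟩ := (S.global.mem_deg_zero _).1 this
      exact ⟨x, fun _ => hx⟩
    · exact ⟨0, fun h' => absurd h' h⟩
  choose x hx using hx
  let e' : Fin r ⊕ Fin r ≃ Fin (r + r) := finSumFinEquiv
  -- Indices of type (2, 0) are padded with zero, so that all families are indexed by the same
  -- finite type.
  let u : Fin r → S.global.carrier := fun t => if i t = 1 then a t else 0
  let v : Fin r → S.global.carrier := fun t => if i t = 1 then b t else 0
  have hu : ∀ t, u t ∈ S.global.deg 1 := by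
    intro t
    by_cases h : i t = 1
    · have := ha t
      rw [h] at this
      simpa [u, h] using this
    · simp [u, h]
  have hv : ∀ t, v t ∈ S.global.deg 1 := by
    intro t
    by_cases h : i t = 1
    · have := hb t
      rw [show j t = 1 by have := hij t; omega] at this
      simpa [v, h] using this
    · simp [v, h]
  let g : Matrix (Fin r ⊕ Fin r) (Fin r ⊕ Fin r) ℝ := Matrix.fromBlocks 0 1 1 0
  have hg : g.IsSymm := by
    simp [g, Matrix.IsSymm, Matrix.fromBlocks_transpose]
  refine ⟨r, r + r, x, fun t => if i t = 2 then a t else 0, Sum.elim u v ∘ e'.symm,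
    g.submatrix e'.symm e'.symm, ?_, ?_, hg.submatrix _, ?_⟩
  · intro t
    by_cases h : i t = 2
    · have := ha t
      rw [h] at this
      simpa [h] using this
    · simp [h]
  · intro t
    simp only [Function.comp_apply]
    rcases e'.symm t with t | t
    · exact hu t
    · exact hv t
  · have e1 : ∀ c, ∑ d, (g.submatrix e'.symm e'.symm) c d • (S.global.df ((Sum.elim u v ∘ e'.symm) c) *
        S.global.df ((Sum.elim u v ∘ e'.symm) d)) = ∑ d, g (e'.symm c) d •
          (S.global.df (Sum.elim u v (e'.symm c)) * S.global.df (Sum.elim u v d)) := fun c =>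
      Equiv.sum_comp e'.symm fun d => g (e'.symm c) d •
          (S.global.df (Sum.elim u v (e'.symm c)) * S.global.df (Sum.elim u v d))
    rw [Finset.sum_congr rfl fun c _ => e1 c, Equiv.sum_comp e'.symm fun c => ∑ d, g c d •
          (S.global.df (Sum.elim u v c) * S.global.df (Sum.elim u v d))]
    have comm : ∀ t, S.global.df (v t) * S.global.df (u t) = S.global.df (u t) * S.global.df (v t) := by
      intro t
      rw [S.global.isFormHom.d_d_comm (hv t) (hu t)]; norm_num
    simp only [Fintype.sum_sum_type, g, Matrix.fromBlocks_apply₁₁, Matrix.fromBlocks_apply₁₂,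
      Matrix.fromBlocks_apply₂₁, Matrix.fromBlocks_apply₂₂, Matrix.one_apply, Matrix.zero_apply,
      Sum.elim_inl, Sum.elim_inr, zero_smul, Finset.sum_const_zero, zero_add, add_zero, ite_smul,
      one_smul, Finset.sum_ite_eq, Finset.mem_univ, if_true, comm]
    rw [← two_smul ℝ, smul_smul, e]
    norm_num
    rw [← Finset.sum_add_distrib]
    refine Finset.sum_congr rfl fun t _ => ?_
    rcases (show i t = 1 ∨ i t = 2 by have := hij t; have := hi t; omega) with h | h
    · simp [u, v, h, S.global.df_zero]
    · simp [u, v, h, S.global.df_zero, hx t h]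

theorem isDerivedCourant : IsDerivedCourant S S.pairing S.derivedAnchor S.dorfman := by
  intro e b r X hX
  have h := hX.toFun_eq (ham_spec hX.1)
  exact ⟨by rw [pairing_eq hX.1, h], by rw [derivedAnchor, pairing_eq hX.1, h],
    by rw [dorfman, pairing_eq hX.1, pairing_eq hX.1, h, h]⟩

/-- Linearity in the right slot is the Leibniz rule of X_e, whose extra term X_e a vanishes by
degree. Linearity in the left slot, where the Hamiltonian field itself changes, is obtained from it
by symmetry. -/
theorem pairing_mul_left {a e e' : S.global.carrier} (ha : a ∈ S.global.deg 0)
    (he : e ∈ S.global.deg 1) (he' : e' ∈ S.global.deg 1) :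
    S.pairing (a * e) e' = a * S.pairing e e' := by
  have hae : a * e ∈ S.global.deg 1 := by simpa using SetLike.mul_mem_graded ha he
  rw [pairing_symm hae he', pairing_mul he' ha, pairing_deg_zero he' ha, pairing_symm he' he]
  simp

theorem pairing_add_left {e e' e'' : S.global.carrier} (he : e ∈ S.global.deg 1)
    (he' : e' ∈ S.global.deg 1) (he'' : e'' ∈ S.global.deg 1) :
    S.pairing (e + e') e'' = S.pairing e e'' + S.pairing e' e'' := by
  rw [pairing_symm (Submodule.add_mem _ he he') he'', pairing_add he'', pairing_symm he'' he,
    pairing_symm he'' he']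

theorem isCourantAlgebroid :
    IsCourantAlgebroid S.global S.pairing S.derivedAnchor S.dorfman where
  pair_mem e he e' he' := pairing_mem he he'
  pair_add e he e' _ e'' _ := pairing_add he _ _
  pair_smul a ha e he e' he' := by
    rw [pairing_mul he ha, pairing_deg_zero he ha]; simp
  pair_symm e he e' he' := pairing_symm he he'
  pair_nondeg l hl hadd hmul := by
    obtain ⟨r, s, x, P, ξ, g, hf⟩ := exists_isCourantFrame (S := S)
    have hε : ∀ a, ∑ b, g a b • ξ b ∈ S.global.deg 1 := fun a =>
      Submodule.sum_mem _ fun b _ => Submodule.smul_mem _ _ (hf.2.1 b)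
    -- The map l is additive only on degree one and is not assumed linear elsewhere, so finite sums
    -- are treated by induction; l 0 = 0 comes from l (0 · 0) = 0 · l 0.
    have hlsum : ∀ {t : ℕ} (e : Fin t → S.global.carrier), (∀ a, e a ∈ S.global.deg 1) →
        l (∑ a, e a) = ∑ a, l (e a) := by
      intro t
      induction t with
      | zero =>
        intro e _
        have := hmul 0 (Submodule.zero_mem _) 0 (Submodule.zero_mem _)
        simpa using this
      | succ t ih =>
        intro e he
        rw [Fin.sum_univ_succ, Fin.sum_univ_succ, hadd _ (he 0) _
          (Submodule.sum_mem _ fun a _ => he a.succ), ih _ fun a => he a.succ]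
    have mem : ∀ a, l (ξ a) * (∑ b, g a b • ξ b) ∈ S.global.deg 1 := fun a => by
      simpa using SetLike.mul_mem_graded (hl _ (hf.2.1 a)) (hε a)
    -- The representing element is read off from e' = Σ ξᵃ ⟨e', eₐ⟩ by applying l, where eₐ = Σ gₐᵦ
    -- ξᵇ.
    refine ⟨∑ a, l (ξ a) * ∑ b, g a b • ξ b, ⟨Submodule.sum_mem _ fun a _ => mem a, ?_⟩, ?_⟩
    · intro e' he'
      have h1 : S.pairing (∑ a, l (ξ a) * ∑ b, g a b • ξ b) e' =
          ∑ a, l (ξ a) * S.pairing e' (∑ b, g a b • ξ b) := by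
        rw [pairing_symm (Submodule.sum_mem _ fun a _ => mem a) he', pairing_sum he']
        refine Finset.sum_congr rfl fun a _ => ?_
        rw [pairing_symm he' (mem a), pairing_mul_left (hl _ (hf.2.1 a)) (hε a) he',
          pairing_symm (hε a) he']
      rw [h1]
      conv_rhs => rw [hf.expand_one he']
      have h2 : ∀ a, ξ a * S.pairing e' (∑ b, g a b • ξ b) ∈ S.global.deg 1 := fun a => by
        simpa using SetLike.mul_mem_graded (hf.2.1 a) (pairing_mem he' (hε a))
      rw [hlsum _ h2]
      refine Finset.sum_congr rfl fun a _ => ?_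
      rw [deg_zero_mul_comm (pairing_mem he' (hε a)) (hf.2.1 a), hmul _ (pairing_mem he' (hε a)) _
        (hf.2.1 a), deg_zero_mul_comm (pairing_mem he' (hε a)) (hl _ (hf.2.1 a))]
    · rintro e ⟨he, h⟩
      rw [hf.expand_one he]
      -- Conversely, if e represents l, its expansion only involves ⟨e, ξᵇ⟩ = l ξᵇ, and the symmetry
      -- of g brings it to the form of the witness.
      have h1 : ∀ a, ξ a * S.pairing e (∑ b, g a b • ξ b) = ∑ b, g a b • (l (ξ b) * ξ a) := by
        intro a
        rw [pairing_sum he, Finset.mul_sum]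
        refine Finset.sum_congr rfl fun b _ => ?_
        rw [pairing_smul_real he, h _ (hf.2.1 b), mul_smul_comm,
          deg_zero_mul_comm (hl _ (hf.2.1 b)) (hf.2.1 a)]
      rw [Finset.sum_congr rfl fun a _ => h1 a, Finset.sum_comm]
      refine Finset.sum_congr rfl fun b _ => ?_
      simp only [Finset.mul_sum, mul_smul_comm, fun a => hf.2.2.1.apply a b]
  anchor_mem e he a ha := pairing_mem he (Q_mem ha)
  anchor_add e he e' he' a ha := pairing_add_left he he' (Q_mem ha)
  anchor_smul a ha e he b hb := pairing_mul_left ha he (Q_mem hb)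
  anchor_linear e he a ha b hb r := by
    simp only [derivedAnchor, map_add, map_smul, pairing_add he, pairing_smul_real he]
  anchor_leibniz e he a ha b hb := by
    simp only [derivedAnchor, Q_mul ha, pairing_add he, pairing_smul_real he, pairing_mul he (Q_mem ha),
      pairing_mul he ha, pairing_deg_zero he ha, pairing_deg_zero he hb]
    simp
  brk_mem e he e' he' := dorfman_mem he he'
  brk_add_left e he e' he' e'' he'' := by
    -- The term X_e Q e'' is additive in e because it equals −X_{Qe''} e.
    rw [dorfman, dorfman, dorfman, pairing_add_left he he' he'', map_add,
      pairing_eq_neg (Submodule.add_mem _ he he') (Q_mem he''), pairing_eq_neg he (Q_mem he''),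
      pairing_eq_neg he' (Q_mem he''), map_add]
    abel
  brk_add_right e he e' he' e'' he'' := by simp only [dorfman_eq he, map_add]
  brk_smul a ha e he e' he' := by
    rw [dorfman_eq he, VField.leibniz_even ⟨0, by norm_num⟩ _ _ ha, ← dorfman_eq he, ← dorfman_eq he,
      dorfman_deg_zero he ha, add_comm]
  brk_jacobi e₁ h₁ e₂ h₂ e₃ h₃ := by
    -- [e₂, ·] is the Hamiltonian field of Q e₂, and [e₁, Q e₂] = Q [e₁, e₂].
    rw [dorfman_eq h₂ e₃, dorfman_hamiltonian h₁ (Q_mem h₂), ← dorfman_eq h₂,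
      dorfman_eq (dorfman_mem h₁ h₂)]
    congr 1
    exact ham_congr (dorfman_Q _ h₁).symm _ _ _
  brk_pair e he e₁ h₁ e₂ h₂ := by
    rw [← dorfman_deg_zero he (pairing_mem h₁ h₂), pairing_eq h₁ e₂, dorfman_hamiltonian he h₁,
      pairing_eq (dorfman_mem he h₁), pairing_eq h₁]
  brk_self e he e' he' := by
    rw [derivedAnchor, ← dorfman_self he, pairing_smul_real he', pairing_symm (dorfman_mem he he) he']

/-- The expansion is applied successively to Q xⁱ, to Q eₐ, to [eₐ, eᵦ] and finally to h. The values
of the Hamiltonian fields that occur are the anchor, the bracket and the pairing, so h is expressed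
by the structure functions of the Courant algebroid. -/
theorem _root_.IsCourantFrame.hamiltonian_eq {r s : ℕ} {x : Fin r → SmoothFn (𝓡 n) (⊤ : Opens M)}
    {P : Fin r → S.global.carrier} {ξ : Fin s → S.global.carrier} {g : Matrix (Fin s) (Fin s) ℝ}
    (hf : IsCourantFrame S x P ξ g) {h : S.global.carrier} (hh : S.IsHamiltonian (2 + 1) h S.Q)
    {ε : Fin s → S.global.carrier} (hε : ∀ a, ε a = ∑ b, g a b • ξ b) :
    h = ∑ i, ∑ a, S.derivedAnchor (ε a) (S.global.ofSmooth (x i)) * P i * ξ a -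
      (1 / 6 : ℝ) • ∑ a, ∑ b, ∑ c, S.pairing (S.dorfman (ε a) (ε b)) (ε c) * ξ a * ξ b * ξ c := by
  have hm : ∀ a, ε a ∈ S.global.deg 1 := fun a => by
    rw [hε]; exact Submodule.sum_mem _ fun b _ => Submodule.smul_mem _ _ (hf.2.1 b)
  have e1 : ∀ i, S.Q.toFun (S.global.ofSmooth (x i)) =
      ∑ a, ξ a * S.derivedAnchor (ε a) (S.global.ofSmooth (x i)) := by
    intro i
    rw [hf.expand_one (Q_mem (ofSmooth_mem (x i)))]
    refine Finset.sum_congr rfl fun a _ => ?_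
    rw [← hε, pairing_symm (Q_mem (ofSmooth_mem (x i))) (hm a), derivedAnchor]
  have e2 : ∀ a, S.Q.toFun (ε a) = ∑ i, P i * S.derivedAnchor (ε a) (S.global.ofSmooth (x i)) -
      (1 / 2 : ℝ) • ∑ b, ξ b * S.dorfman (ε a) (ε b) := by
    intro a
    -- For Q eₐ, of degree 2 with a field of degree 0, this reads −2 Q eₐ = −2 Σ Pᵢ ρ(eₐ)xⁱ + Σ ξᵇ
    -- [eₐ, eᵦ]; dividing by −2 gives the coefficient −½.
    have := hf.expand (ham_spec (Q_mem (hm a)))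
    simp only [← hε, ← dorfman_eq (hm a), dorfman_deg_zero (hm a) (ofSmooth_mem _)] at this
    have h2 := congrArg (fun y => (-1 / 2 : ℝ) • y) this
    simp only [smul_add, smul_smul] at h2
    norm_num at h2
    rw [h2, sub_eq_add_neg]
  have e3 : ∀ a b, S.dorfman (ε a) (ε b) = ∑ c, ξ c * S.pairing (S.dorfman (ε a) (ε b)) (ε c) := by
    intro a b
    have := hf.expand_one (dorfman_mem (hm a) (hm b))
    simpa only [← hε] using this
  -- For h, of degree 3, this reads 3 h = 2 Σ Pᵢ Q xⁱ + Σ ξᵃ Q eₐ. The anchor term occurs 2 + 1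
  -- times and the cubic term with −½, which after division by 3 gives 1 and −1/6.
  have e4 := hf.expand hh
  simp only [← hε, e1] at e4
  have c1 : ∀ i a, P i * (ξ a * S.derivedAnchor (ε a) (S.global.ofSmooth (x i))) =
      S.derivedAnchor (ε a) (S.global.ofSmooth (x i)) * P i * ξ a := by
    intro i a
    rw [← mul_assoc, derivedAnchor, deg_zero_mul_comm (pairing_mem (hm a) (Q_mem (ofSmooth_mem _)))
      (SetLike.mul_mem_graded (hf.1 i) (hf.2.1 a)), mul_assoc]
  have c2 : ∀ i a, ξ a * (P i * S.derivedAnchor (ε a) (S.global.ofSmooth (x i))) =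
      S.derivedAnchor (ε a) (S.global.ofSmooth (x i)) * P i * ξ a := by
    intro i a
    rw [← c1, ← mul_assoc, ← mul_assoc, S.global.comm (hf.2.1 a) (hf.1 i)]
    norm_num
  have c3 : ∀ a b c, ξ a * (ξ b * (ξ c * S.pairing (S.dorfman (ε a) (ε b)) (ε c))) =
      S.pairing (S.dorfman (ε a) (ε b)) (ε c) * ξ a * ξ b * ξ c := by
    intro a b c
    rw [← mul_assoc, ← mul_assoc, deg_zero_mul_comm (pairing_mem (dorfman_mem (hm a) (hm b)) (hm c))
      (SetLike.mul_mem_graded (SetLike.mul_mem_graded (hf.2.1 a) (hf.2.1 b)) (hf.2.1 c))]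
    simp only [mul_assoc]
  have e5 : ∀ a, ξ a * S.Q.toFun (ε a) =
      ∑ i, S.derivedAnchor (ε a) (S.global.ofSmooth (x i)) * P i * ξ a -
      (1 / 2 : ℝ) • ∑ b, ∑ c, S.pairing (S.dorfman (ε a) (ε b)) (ε c) * ξ a * ξ b * ξ c := by
    intro a
    rw [e2, mul_sub, mul_smul_comm, Finset.mul_sum, Finset.mul_sum, Finset.sum_congr rfl fun i _ => c2 i a]
    congr 2
    refine Finset.sum_congr rfl fun b _ => ?_
    rw [e3, Finset.mul_sum, Finset.mul_sum]
    refine Finset.sum_congr rfl fun c _ => ?_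
    rw [← e3, c3]
  simp only [Finset.mul_sum, c1, e5, Finset.sum_sub_distrib, ← Finset.smul_sum] at e4
  rw [Finset.sum_comm (f := fun a i => S.derivedAnchor (ε a) (S.global.ofSmooth (x i)) * P i * ξ a)] at e4
  have h2 := congrArg (fun y => (1 / 3 : ℝ) • y) e4
  simp only [smul_add, smul_sub, smul_smul] at h2
  norm_num at h2
  rw [h2, add_sub, ← add_smul]
  norm_num

/-- Here (−1)^(p+1) = −1, which reverses the signs of both terms of the Hamiltonian. In α the factor
1/p = ½ cancels the degree 2 of Pᵢ, and the two halves of the ξ-part agree by the symmetry of g. -/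
theorem _root_.IsCourantFrame.akszLagrangian_eq {r s : ℕ} {x : Fin r → SmoothFn (𝓡 n) (⊤ : Opens M)}
    {P : Fin r → S.global.carrier} {ξ : Fin s → S.global.carrier} {g : Matrix (Fin s) (Fin s) ℝ}
    (hf : IsCourantFrame S x P ξ g) {h : S.global.carrier} (hh : S.IsHamiltonian (2 + 1) h S.Q)
    {m : ℕ} {H : Type*} [TopologicalSpace H]
    {I : ModelWithCorners ℝ (EuclideanSpace ℝ (Fin m)) H}
    {B : Type*} [TopologicalSpace B] [ChartedSpace H B] [IsManifold I ∞ B]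
    (φ : S.global.carrier →ₐ[ℝ] DForm I B) (κ : S.global.Form →ₐ[ℝ] DForm I B)
    (hκ : IsFieldStrength S.global 0 φ κ) :
    akszLagrangian S φ κ h =
      courantLagrangian S φ S.pairing S.derivedAnchor S.dorfman x P ξ g := by
  have hα : S.α = ∑ i, S.global.fn (P i) * S.global.df (S.global.ofSmooth (x i)) +
      (1 / 2 : ℝ) • ∑ a, ∑ b, g a b • (S.global.fn (ξ a) * S.global.df (ξ b)) := by
    have e1 : ∀ i, S.global.contract S.global.euler
        (S.global.df (P i) * S.global.df (S.global.ofSmooth (x i))) =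
        (2 : ℝ) • (S.global.fn (P i) * S.global.df (S.global.ofSmooth (x i))) := by
      intro i
      rw [contract_df_mul_df _ (hf.1 i), euler_apply (hf.1 i), euler_apply (ofSmooth_mem (x i)),
        S.global.fn_smul, smul_mul_assoc]
      simp [fn_zero]
    have e2 : ∀ a b, S.global.contract S.global.euler (S.global.df (ξ a) * S.global.df (ξ b)) =
        S.global.fn (ξ a) * S.global.df (ξ b) + S.global.fn (ξ b) * S.global.df (ξ a) := by
      intro a b
      rw [contract_df_mul_df _ (hf.2.1 a), euler_apply (hf.2.1 a), euler_apply (hf.2.1 b), Nat.cast_one,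
        one_smul, one_smul, df_mul_fn (hf.2.1 b) (hf.2.1 a)]
      norm_num
    rw [α, hf.2.2.2]
    simp only [map_add, map_sum, map_smul, e1, e2, smul_add, Finset.sum_add_distrib]
    rw [Finset.sum_comm (f := fun a b => g a b • (S.global.fn (ξ b) * S.global.df (ξ a)))]
    simp only [fun a b => hf.2.2.1.apply a b, smul_smul, ← Finset.smul_sum, ← add_smul]
    norm_num
  rw [akszLagrangian, courantLagrangian, hα, map_add, map_smul, hf.hamiltonian_eq hh (fun a => rfl)]
  simp only [map_sum, map_smul, map_mul, map_sub, (hκ _).1, (hκ _).2, LinearMap.zero_apply,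
    map_zero, sub_zero]
  norm_num
  abel

end Courant

end SymplecticQManifold

/-! ### The exterior algebra of the dual of a Euclidean space -/

namespace ExteriorAlgebra

variable {V : Type*} [AddCommGroup V] [Module ℝ V]

/-- A vector moves past an element of the exterior algebra up to the grade involution. -/
theorem ι_mul_eq (v : V) (x : ExteriorAlgebra ℝ V) :
    ι ℝ v * x = map (-LinearMap.id) x * ι ℝ v := by
  induction x using ExteriorAlgebra.induction with
  | algebraMap r => rw [AlgHom.commutes]; exact (Algebra.commutes r _).symm
  | ι w =>
    have := ι_add_mul_swap (R := ℝ) v w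
    rw [map_apply_ι]
    simp only [LinearMap.neg_apply, LinearMap.id_apply, map_neg, neg_mul]
    exact eq_neg_of_add_eq_zero_left this
  | mul x y hx hy => rw [← mul_assoc, hx, mul_assoc, hy, map_mul, mul_assoc]
  | add x y hx hy => rw [mul_add, hx, hy, map_add, add_mul]

theorem ι_mul_eq_of_mem (v : V) {j : ℕ} {y : ExteriorAlgebra ℝ V} (hy : y ∈ ⋀[ℝ]^j V) :
    ι ℝ v * y = (-1 : ℝ) ^ j • (y * ι ℝ v) := by
  rw [ι_mul_eq, ← smul_mul_assoc]
  congr 1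
  induction hy using Submodule.pow_induction_on_left' with
  | algebraMap r => simp
  | add x y i hx hy ihx ihy => rw [map_add, ihx, ihy, smul_add]
  | mem_mul m hm i x hx ih =>
    obtain ⟨v, rfl⟩ := hm
    rw [map_mul, ih, map_apply_ι]
    simp [pow_succ]

theorem graded_comm {i j : ℕ} {x y : ExteriorAlgebra ℝ V} (hx : x ∈ ⋀[ℝ]^i V)
    (hy : y ∈ ⋀[ℝ]^j V) : x * y = (-1 : ℝ) ^ (i * j) • (y * x) := by
  induction hx using Submodule.pow_induction_on_left' with
  | algebraMap r => simp [Algebra.commutes]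
  | add x z i hx hz ihx ihz => rw [add_mul, ihx, ihz, mul_add, smul_add]
  | mem_mul m hm i x hx ih =>
    obtain ⟨v, rfl⟩ := hm
    rw [mul_assoc, ih, mul_smul_comm, ← mul_assoc, ι_mul_eq_of_mem v hy, smul_mul_assoc, smul_smul,
      mul_assoc, ← pow_add, Nat.succ_mul]

theorem map_mem {W : Type*} [AddCommGroup W] [Module ℝ W] (f : V →ₗ[ℝ] W) {j : ℕ}
    {y : ExteriorAlgebra ℝ V} (hy : y ∈ ⋀[ℝ]^j V) : map f y ∈ ⋀[ℝ]^j W := by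
  induction hy using Submodule.pow_induction_on_left' with
  | algebraMap r =>
    rw [AlgHom.commutes]
    change _ ∈ LinearMap.range (ι ℝ (M := W)) ^ 0
    rw [pow_zero]
    exact Submodule.algebraMap_mem r
  | add x y i hx hy ihx ihy => rw [map_add]; exact Submodule.add_mem _ ihx ihy
  | mem_mul m hm i x hx ih =>
    obtain ⟨v, rfl⟩ := hm
    rw [map_mul, map_apply_ι]
    change _ ∈ LinearMap.range (ι ℝ (M := W)) ^ (i + 1)
    rw [pow_succ']
    exact Submodule.mul_mem_mul ⟨_, rfl⟩ ih

theorem ι_mul_mem (v : V) {j : ℕ} {y : ExteriorAlgebra ℝ V} (hy : y ∈ ⋀[ℝ]^j V) :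
    ι ℝ v * y ∈ ⋀[ℝ]^(j + 1) V := by
  change _ ∈ LinearMap.range (ι ℝ (M := V)) ^ (j + 1)
  rw [pow_succ']
  exact Submodule.mul_mem_mul ⟨_, rfl⟩ hy

end ExteriorAlgebra

/-- The exterior algebra of the dual of `ℝᵐ`. -/
abbrev Lam (m : ℕ) := ExteriorAlgebra ℝ (Module.Dual ℝ (EuclideanSpace ℝ (Fin m)))

namespace Lam

variable {m : ℕ}

/-- The norm is transported from the coefficients. The space is finite-dimensional, so the choice is
immaterial; it only serves to make calculus with form-valued functions available. -/
instance : NormedAddCommGroup (Lam m) :=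
  NormedAddCommGroup.induced (Lam m) (Finset (Fin m) → ℝ) (extBasis m).equivFun.toLinearMap
    (extBasis m).equivFun.injective

instance : NormedSpace ℝ (Lam m) :=
  NormedSpace.induced ℝ (Lam m) (Finset (Fin m) → ℝ) (extBasis m).equivFun.toLinearMap

instance : FiniteDimensional ℝ (Lam m) := (extBasis m).finiteDimensional_of_finite

/-- The exterior product as a continuous bilinear map. -/
def mulL : Lam m →L[ℝ] Lam m →L[ℝ] Lam m := (LinearMap.mul ℝ (Lam m)).toContinuousBilinearMap

@[simp] theorem mulL_apply (x y : Lam m) : mulL x y = x * y := rfl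

/-- A coefficient as a continuous linear form. -/
def coef (s : Finset (Fin m)) : Lam m →L[ℝ] ℝ := ((extBasis m).coord s).toContinuousLinearMap

@[simp] theorem coef_apply (s : Finset (Fin m)) (x : Lam m) :
    coef s x = (extBasis m).repr x s := rfl

theorem sum_coef (x : Lam m) : ∑ s, coef s x • extBasis m s = x := (extBasis m).sum_repr x

theorem sum_coBasis (L : Module.Dual ℝ (EuclideanSpace ℝ (Fin m))) :
    ∑ i, L (EuclideanSpace.single i 1) • coBasis m i = L := by
  have := (EuclideanSpace.basisFun (Fin m) ℝ).toBasis.sum_dual_apply_smul_coord L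
  simpa [coBasis] using this

theorem coBasis_apply (i : Fin m) (v : EuclideanSpace ℝ (Fin m)) : coBasis m i v = v i := by
  simp [coBasis]

/-- The pull-back of exterior forms along a linear map. -/
def pb {m' : ℕ} (A : EuclideanSpace ℝ (Fin m') →L[ℝ] EuclideanSpace ℝ (Fin m)) : Lam m →ₐ[ℝ] Lam m' :=
  ExteriorAlgebra.map A.toLinearMap.dualMap

theorem pb_ι {m' : ℕ} (A : EuclideanSpace ℝ (Fin m') →L[ℝ] EuclideanSpace ℝ (Fin m))
    (v : Module.Dual ℝ (EuclideanSpace ℝ (Fin m))) :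
    pb A (ExteriorAlgebra.ι ℝ v) = ExteriorAlgebra.ι ℝ (v ∘ₗ A.toLinearMap) :=
  ExteriorAlgebra.map_apply_ι _ _

theorem pb_comp {m' m'' : ℕ} (A : EuclideanSpace ℝ (Fin m') →L[ℝ] EuclideanSpace ℝ (Fin m))
    (C : EuclideanSpace ℝ (Fin m'') →L[ℝ] EuclideanSpace ℝ (Fin m')) (x : Lam m) :
    pb (A ∘L C) x = pb C (pb A x) := by
  have := DFunLike.congr_fun (ExteriorAlgebra.map_comp_map A.toLinearMap.dualMap C.toLinearMap.dualMap) x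
  exact this.symm

theorem pb_id (x : Lam m) : pb (ContinuousLinearMap.id ℝ _) x = x :=
  DFunLike.congr_fun ExteriorAlgebra.map_id x

/-- The differential of a function as an element of the exterior algebra. -/
def ofDual : (EuclideanSpace ℝ (Fin m) →L[ℝ] ℝ) →L[ℝ] Lam m :=
  LinearMap.toContinuousLinearMap ((ExteriorAlgebra.ι ℝ) ∘ₗ ContinuousLinearMap.coeLM ℝ)

@[simp] theorem ofDual_apply (L : EuclideanSpace ℝ (Fin m) →L[ℝ] ℝ) :
    ofDual L = ExteriorAlgebra.ι ℝ (L : EuclideanSpace ℝ (Fin m) →ₗ[ℝ] ℝ) := rfl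

theorem pb_ofDual {m' : ℕ} (A : EuclideanSpace ℝ (Fin m') →L[ℝ] EuclideanSpace ℝ (Fin m))
    (v : EuclideanSpace ℝ (Fin m) →L[ℝ] ℝ) : pb A (ofDual v) = ofDual (v ∘L A) := pb_ι _ _

end Lam

open Lam

/-! ### The exterior derivative in coordinates -/

section CoordD

variable {m : ℕ} {F : Type*} [NormedAddCommGroup F] [NormedSpace ℝ F]

/-- The exterior derivative `∑ᵢ dxⁱ ∧ ∂ᵢ θ` on a subset of a Euclidean space. -/
def coordD (s : Set (EuclideanSpace ℝ (Fin m))) (θ : EuclideanSpace ℝ (Fin m) → Lam m)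
    (y : EuclideanSpace ℝ (Fin m)) : Lam m :=
  ∑ i, ExteriorAlgebra.ι ℝ (coBasis m i) * fderivWithin ℝ θ s y (EuclideanSpace.single i 1)

variable {s : Set (EuclideanSpace ℝ (Fin m))} {θ θ' : EuclideanSpace ℝ (Fin m) → Lam m}
  {y : EuclideanSpace ℝ (Fin m)}

theorem DifferentiableWithinAt.lam_mul {s : Set F} {y : F} {θ θ' : F → Lam m}
    (h : DifferentiableWithinAt ℝ θ s y) (h' : DifferentiableWithinAt ℝ θ' s y) :
    DifferentiableWithinAt ℝ (fun y => θ y * θ' y) s y :=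
  (mulL.hasFDerivWithinAt_of_bilinear h.hasFDerivWithinAt h'.hasFDerivWithinAt).differentiableWithinAt

theorem ContDiffWithinAt.lam_mul {k : WithTop ℕ∞} {s : Set F} {y : F} {θ θ' : F → Lam m}
    (h : ContDiffWithinAt ℝ k θ s y) (h' : ContDiffWithinAt ℝ k θ' s y) :
    ContDiffWithinAt ℝ k (fun y => θ y * θ' y) s y :=
  (mulL (m := m)).isBoundedBilinearMap.contDiff.contDiffAt.comp_contDiffWithinAt (x := y)
    (f := fun y => (θ y, θ' y)) (h.prodMk h')

theorem fderivWithin_lam_mul (hu : UniqueDiffWithinAt ℝ s y) (h : DifferentiableWithinAt ℝ θ s y)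
    (h' : DifferentiableWithinAt ℝ θ' s y) (v : EuclideanSpace ℝ (Fin m)) :
    fderivWithin ℝ (fun y => θ y * θ' y) s y v =
      fderivWithin ℝ θ s y v * θ' y + θ y * fderivWithin ℝ θ' s y v := by
  have := mulL.fderivWithin_of_bilinear h h' hu
  simp only [mulL_apply] at this
  rw [this]
  simp [add_comm]

/-- The sign is expressed by the grade involution, so forms of mixed degree are allowed. -/
theorem coordD_mul (hu : UniqueDiffWithinAt ℝ s y) (h : DifferentiableWithinAt ℝ θ s y)
    (h' : DifferentiableWithinAt ℝ θ' s y) : coordD s (fun y => θ y * θ' y) y =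
      coordD s θ y * θ' y + ExteriorAlgebra.map (-LinearMap.id) (θ y) * coordD s θ' y := by
  simp only [coordD, fderivWithin_lam_mul hu h h', mul_add, Finset.sum_add_distrib, Finset.sum_mul,
    Finset.mul_sum, ← mul_assoc, ExteriorAlgebra.ι_mul_eq _ (θ y)]

theorem coordD_mul_of_mem (hu : UniqueDiffWithinAt ℝ s y) (h : DifferentiableWithinAt ℝ θ s y)
    (h' : DifferentiableWithinAt ℝ θ' s y) {k : ℕ}
    (hk : θ y ∈ ⋀[ℝ]^k (Module.Dual ℝ (EuclideanSpace ℝ (Fin m)))) :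
    coordD s (fun y => θ y * θ' y) y =
      coordD s θ y * θ' y + (-1 : ℝ) ^ k • (θ y * coordD s θ' y) := by
  simp only [coordD, fderivWithin_lam_mul hu h h', mul_add, Finset.sum_add_distrib, Finset.sum_mul,
    Finset.mul_sum, Finset.smul_sum, ← mul_assoc, ExteriorAlgebra.ι_mul_eq_of_mem _ hk,
    smul_mul_assoc]

theorem coordD_add (hu : UniqueDiffWithinAt ℝ s y) (h : DifferentiableWithinAt ℝ θ s y)
    (h' : DifferentiableWithinAt ℝ θ' s y) :
    coordD s (fun y => θ y + θ' y) y = coordD s θ y + coordD s θ' y := by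
  simp only [coordD, fderivWithin_fun_add hu h h', add_apply, mul_add,
    Finset.sum_add_distrib]

theorem coordD_const_smul (hu : UniqueDiffWithinAt ℝ s y) (h : DifferentiableWithinAt ℝ θ s y)
    (r : ℝ) : coordD s (fun y => r • θ y) y = r • coordD s θ y := by
  simp only [coordD, fderivWithin_fun_const_smul hu h, smul_apply, mul_smul_comm,
    Finset.smul_sum]

theorem coordD_const (x : Lam m) : coordD s (fun _ => x) y = 0 := by
  simp [coordD, fderivWithin_fun_const]

theorem coordD_sum (hu : UniqueDiffWithinAt ℝ s y) {ι : Type*} (t : Finset ι)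
    {θ : ι → EuclideanSpace ℝ (Fin m) → Lam m} (h : ∀ i ∈ t, DifferentiableWithinAt ℝ (θ i) s y) :
    coordD s (fun y => ∑ i ∈ t, θ i y) y = ∑ i ∈ t, coordD s (θ i) y := by
  simp only [coordD, fderivWithin_fun_sum hu h, sum_apply, Finset.mul_sum]
  rw [Finset.sum_comm]

theorem sum_ι_coBasis_smul (L : EuclideanSpace ℝ (Fin m) →L[ℝ] ℝ) :
    ∑ i, L (EuclideanSpace.single i 1) • ExteriorAlgebra.ι ℝ (coBasis m i) = ofDual L := by
  rw [ofDual_apply, ← sum_coBasis (L : EuclideanSpace ℝ (Fin m) →ₗ[ℝ] ℝ), map_sum]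
  simp

theorem coordD_smul (hu : UniqueDiffWithinAt ℝ s y) {c : EuclideanSpace ℝ (Fin m) → ℝ}
    (hc : DifferentiableWithinAt ℝ c s y) (h : DifferentiableWithinAt ℝ θ s y) :
    coordD s (fun y => c y • θ y) y =
      ofDual (fderivWithin ℝ c s y) * θ y + c y • coordD s θ y := by
  rw [← sum_ι_coBasis_smul, Finset.sum_mul]
  simp only [coordD, fderivWithin_fun_smul hu hc h, add_apply,
    smul_apply, ContinuousLinearMap.smulRight_apply, mul_add,
    Finset.sum_add_distrib, mul_smul_comm, smul_mul_assoc, Finset.smul_sum]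
  rw [add_comm]

theorem coordD_algebraMap (hu : UniqueDiffWithinAt ℝ s y) {c : EuclideanSpace ℝ (Fin m) → ℝ}
    (hc : DifferentiableWithinAt ℝ c s y) :
    coordD s (fun y => algebraMap ℝ (Lam m) (c y)) y = ofDual (fderivWithin ℝ c s y) := by
  simp only [Algebra.algebraMap_eq_smul_one]
  rw [coordD_smul hu hc (differentiableWithinAt_const _), coordD_const]
  simp

theorem coordD_congr (h : θ =ᶠ[nhdsWithin y s] θ') (hy : θ y = θ' y) :
    coordD s θ y = coordD s θ' y := by
  simp only [coordD, h.fderivWithin_eq hy]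

theorem coordD_eq_sum (hu : UniqueDiffWithinAt ℝ s y) (h : DifferentiableWithinAt ℝ θ s y) :
    coordD s θ y = ∑ t, ofDual (fderivWithin ℝ (fun y => coef t (θ y)) s y) * extBasis m t := by
  have hc : ∀ t, DifferentiableWithinAt ℝ (fun y => coef t (θ y)) s y := fun t =>
    (coef t).differentiableAt.comp_differentiableWithinAt y h
  conv_lhs => rw [show θ = fun y => ∑ t, coef t (θ y) • extBasis m t from
    funext fun y => (sum_coef (θ y)).symm]
  rw [coordD_sum hu _ fun t _ => (hc t).smul_const _]
  refine Finset.sum_congr rfl fun t _ => ?_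
  rw [coordD_smul hu (hc t) (differentiableWithinAt_const _), coordD_const, smul_zero, add_zero]

/-- The exterior derivative preserves the grading. -/
theorem coordD_mem (hu : UniqueDiffWithinAt ℝ s y) (h : DifferentiableWithinAt ℝ θ s y) {k : ℕ}
    (hk : ∀ y, θ y ∈ ⋀[ℝ]^k (Module.Dual ℝ (EuclideanSpace ℝ (Fin m)))) :
    coordD s θ y ∈ ⋀[ℝ]^(k + 1) (Module.Dual ℝ (EuclideanSpace ℝ (Fin m))) := by
  let A : ℕ → Submodule ℝ (Lam m) := fun i => ⋀[ℝ]^i (Module.Dual ℝ (EuclideanSpace ℝ (Fin m)))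
  -- The projection to degree k is a continuous linear map that fixes θ, hence it also fixes the
  -- derivative of θ.
  let P : Lam m →L[ℝ] Lam m := (GradedAlgebra.proj A k).toContinuousLinearMap
  have hP : ∀ x, P x ∈ ⋀[ℝ]^k (Module.Dual ℝ (EuclideanSpace ℝ (Fin m))) := fun x => by
    change GradedAlgebra.proj A k x ∈ A k
    rw [GradedAlgebra.proj_apply]
    exact SetLike.coe_mem _
  have hP' : ∀ y, P (θ y) = θ y := fun y => by
    change GradedAlgebra.proj A k _ = _
    rw [GradedAlgebra.proj_apply, DirectSum.decompose_of_mem_same A (hk y)]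
  have : fderivWithin ℝ θ s y = P ∘L fderivWithin ℝ θ s y := by
    have h1 : HasFDerivWithinAt (fun y => P (θ y)) (P ∘L fderivWithin ℝ θ s y) s y :=
      P.hasFDerivAt.comp_hasFDerivWithinAt y h.hasFDerivWithinAt
    simp only [hP'] at h1
    exact h1.fderivWithin hu
  refine Submodule.sum_mem _ fun i _ => ExteriorAlgebra.ι_mul_mem _ ?_
  rw [this]
  exact hP _

/-- A symmetric second derivative is summed against the antisymmetric products dxⁱ ∧ dxʲ. -/
theorem coordD_ofDual_eq_zero (hu : UniqueDiffWithinAt ℝ s y)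
    {L : EuclideanSpace ℝ (Fin m) → EuclideanSpace ℝ (Fin m) →L[ℝ] ℝ}
    (hL : DifferentiableWithinAt ℝ L s y)
    (hs : ∀ v w, fderivWithin ℝ L s y v w = fderivWithin ℝ L s y w v) :
    coordD s (fun y => ofDual (L y)) y = 0 := by
  have h1 : HasFDerivWithinAt (fun y => ofDual (L y)) (ofDual ∘L fderivWithin ℝ L s y) s y :=
    ofDual.hasFDerivAt.comp_hasFDerivWithinAt y hL.hasFDerivWithinAt
  rw [coordD, h1.fderivWithin hu]
  simp only [ContinuousLinearMap.comp_apply, ← sum_ι_coBasis_smul, Finset.mul_sum,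
    mul_smul_comm]
  have hsum : ∀ f : Fin m → Fin m → Lam m, (∀ i j, f i j = -f j i) → ∑ i, ∑ j, f i j = 0 := by
    intro f hf
    have : ∑ i, ∑ j, f i j = -∑ i, ∑ j, f i j := by
      conv_rhs => rw [Finset.sum_comm]
      simp only [← Finset.sum_neg_distrib]
      exact Finset.sum_congr rfl fun i _ => Finset.sum_congr rfl fun j _ => hf i j
    have h2 : (2 : ℝ) • ∑ i, ∑ j, f i j = 0 := by rw [two_smul]; nth_rewrite 1 [this]; simp
    exact (smul_eq_zero_iff_right two_ne_zero).1 h2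
  apply hsum
  intro i j
  rw [hs, eq_neg_of_add_eq_zero_left (ExteriorAlgebra.ι_add_mul_swap (R := ℝ) (coBasis m i) (coBasis m j)),
    smul_neg]

/-- Writing dθ as a sum of dcₜ ∧ eₜ with constant eₜ reduces this to d(dcₜ) = 0. The hypothesis on
the closure of the interior makes second derivatives within s symmetric even at boundary points. -/
theorem coordD_coordD (hu : UniqueDiffOn ℝ s) (hy : y ∈ s) (hy' : y ∈ closure (interior s))
    (h : ContDiffWithinAt ℝ ∞ θ s y) : coordD s (coordD s θ) y = 0 := by
  have hev : ∀ᶠ z in nhdsWithin y s, DifferentiableWithinAt ℝ θ s z := by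
    have h1 : ContDiffWithinAt ℝ 1 θ s y := h.of_le (by exact_mod_cast le_top)
    have h2 := h1.eventually (by simp)
    rw [Set.insert_eq_of_mem hy] at h2
    exact h2.mono fun z hz => hz.differentiableWithinAt (by simp)
  have hc : ∀ t, ContDiffWithinAt ℝ ∞ (fun y => coef t (θ y)) s y := fun t =>
    (coef t).contDiff.contDiffAt.comp_contDiffWithinAt y h
  have hd : ∀ t, DifferentiableWithinAt ℝ (fderivWithin ℝ (fun y => coef t (θ y)) s) s y := fun t =>
    ((hc t).fderivWithin_right (m := ∞) hu (by simp) hy).differentiableWithinAt (by simp)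
  have hd' : ∀ t, DifferentiableWithinAt ℝ
      (fun z => ofDual (fderivWithin ℝ (fun y => coef t (θ y)) s z)) s y := fun t =>
    ofDual.differentiableAt.comp_differentiableWithinAt y (hd t)
  have heq : coordD s θ =ᶠ[nhdsWithin y s] fun z =>
      ∑ t, ofDual (fderivWithin ℝ (fun y => coef t (θ y)) s z) * extBasis m t := by
    filter_upwards [hev, self_mem_nhdsWithin] with z hz hzs
    exact coordD_eq_sum (hu z hzs) hz
  rw [coordD_congr heq (heq.self_of_nhdsWithin hy), coordD_sum (hu y hy) _ fun t _ =>
    (hd' t).lam_mul (differentiableWithinAt_const _)]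
  refine Finset.sum_eq_zero fun t _ => ?_
  rw [coordD_mul (hu y hy) (hd' t) (differentiableWithinAt_const _), coordD_const, mul_zero, add_zero,
    coordD_ofDual_eq_zero (hu y hy) (hd t), zero_mul]
  exact fun v w => (hc t).isSymmSndFDerivWithinAt (by simpa using WithTop.coe_le_coe.2 (le_top (a := (2 : ℕ∞)))) hu hy' hy v w

/-! ### Pull-back of forms in coordinates -/

/-- The pull-back of a fixed exterior form depends on A linearly on one-forms and multiplicatively
on products. -/
theorem ContDiffWithinAt.pb_const {k : WithTop ℕ∞} {m' : ℕ} {s : Set F} {u : F}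
    {A : F → EuclideanSpace ℝ (Fin m') →L[ℝ] EuclideanSpace ℝ (Fin m)}
    (hA : ContDiffWithinAt ℝ k A s u) (x : Lam m) : ContDiffWithinAt ℝ k (fun u => pb (A u) x) s u := by
  induction x using ExteriorAlgebra.induction with
  | algebraMap r => simp only [AlgHom.commutes]; exact contDiffWithinAt_const
  | ι v =>
    have hv : ∀ u, pb (A u) (ExteriorAlgebra.ι ℝ v) =
        ofDual (LinearMap.toContinuousLinearMap v ∘L A u) := fun u => pb_ι _ _
    simp only [hv]
    exact (ofDual (m := m')).contDiff.contDiffAt.comp_contDiffWithinAt u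
      (contDiffWithinAt_const.clm_comp hA)
  | mul x y hx hy => simp only [map_mul]; exact hx.lam_mul hy
  | add x y hx hy => simp only [map_add]; exact hx.add hy

theorem pb_eq_sum {m' : ℕ} (A : EuclideanSpace ℝ (Fin m') →L[ℝ] EuclideanSpace ℝ (Fin m)) (x : Lam m) :
    pb A x = ∑ t, coef t x • pb A (extBasis m t) := by
  conv_lhs => rw [← sum_coef x, map_sum]
  simp only [map_smul]

theorem ContDiffWithinAt.pb {k : WithTop ℕ∞} {m' : ℕ} {s : Set F} {u : F}
    {A : F → EuclideanSpace ℝ (Fin m') →L[ℝ] EuclideanSpace ℝ (Fin m)} {θ : F → Lam m}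
    (hA : ContDiffWithinAt ℝ k A s u) (hθ : ContDiffWithinAt ℝ k θ s u) :
    ContDiffWithinAt ℝ k (fun u => pb (A u) (θ u)) s u := by
  simp only [fun u => pb_eq_sum (A u) (θ u)]
  refine ContDiffWithinAt.sum fun t _ => ContDiffWithinAt.fun_smul ?_ (hA.pb_const _)
  exact (coef t).contDiff.contDiffAt.comp_contDiffWithinAt u hθ

/-- The exterior derivative commutes with pull-backs. -/
theorem coordD_pb {m' : ℕ} {s' : Set (EuclideanSpace ℝ (Fin m'))} {u : EuclideanSpace ℝ (Fin m')}
    {Ψ : EuclideanSpace ℝ (Fin m') → EuclideanSpace ℝ (Fin m)} (hu' : UniqueDiffOn ℝ s') (hus : u ∈ s')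
    (hus' : u ∈ closure (interior s')) (hΨ : ContDiffWithinAt ℝ ∞ Ψ s' u) (hm : Set.MapsTo Ψ s' s)
    (hu : UniqueDiffWithinAt ℝ s (Ψ u)) (hθ : DifferentiableWithinAt ℝ θ s (Ψ u)) :
    coordD s' (fun u => pb (fderivWithin ℝ Ψ s' u) (θ (Ψ u))) u =
      pb (fderivWithin ℝ Ψ s' u) (coordD s θ (Ψ u)) := by
  have hA : ContDiffWithinAt ℝ ∞ (fderivWithin ℝ Ψ s') s' u :=
    hΨ.fderivWithin_right hu' (by simp) hus
  have hAd := hA.differentiableWithinAt (by simp)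
  have hF : ∀ x : Lam m, DifferentiableWithinAt ℝ (fun u => pb (fderivWithin ℝ Ψ s' u) x) s' u :=
    fun x => (hA.pb_const x).differentiableWithinAt (by simp)
  have hΨd : DifferentiableWithinAt ℝ Ψ s' u := hΨ.differentiableWithinAt (by simp)
  -- The pull-back of a constant form is closed. For a covector v it is d(v ∘ Ψ), closed by the
  -- symmetry of the second derivative of Ψ; the Leibniz rule extends this to products. Only the
  -- coefficients of θ are then differentiated.
  have hF0 : ∀ x : Lam m, coordD s' (fun u => pb (fderivWithin ℝ Ψ s' u) x) u = 0 := by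
    intro x
    induction x using ExteriorAlgebra.induction with
    | algebraMap r => simp only [AlgHom.commutes]; exact coordD_const _
    | ι v =>
      have hv : ∀ u, pb (fderivWithin ℝ Ψ s' u) (ExteriorAlgebra.ι ℝ v) =
        ofDual (LinearMap.toContinuousLinearMap v ∘L fderivWithin ℝ Ψ s' u) := fun u => pb_ι _ _
      simp only [hv]
      have hd : HasFDerivWithinAt (fun u => LinearMap.toContinuousLinearMap v ∘L fderivWithin ℝ Ψ s' u)
          ((ContinuousLinearMap.compL ℝ _ _ _ (LinearMap.toContinuousLinearMap v)) ∘L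
            fderivWithin ℝ (fderivWithin ℝ Ψ s') s' u) s' u :=
        (ContinuousLinearMap.compL ℝ (EuclideanSpace ℝ (Fin m')) _ _
          (LinearMap.toContinuousLinearMap v)).hasFDerivAt.comp_hasFDerivWithinAt
          u hAd.hasFDerivWithinAt
      refine coordD_ofDual_eq_zero (hu' u hus) hd.differentiableWithinAt fun a b => ?_
      rw [hd.fderivWithin (hu' u hus)]
      simp only [ContinuousLinearMap.comp_apply, ContinuousLinearMap.compL_apply]
      rw [(hΨ.isSymmSndFDerivWithinAt (by simpa using WithTop.coe_le_coe.2 (le_top (a := (2 : ℕ∞)))) hu' hus' hus).eq]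
    | mul x y hx hy =>
      simp only [map_mul]
      rw [coordD_mul (hu' u hus) (hF x) (hF y), hx, hy, zero_mul, mul_zero, add_zero]
    | add x y hx hy =>
      simp only [map_add]
      rw [coordD_add (hu' u hus) (hF x) (hF y), hx, hy, add_zero]
  have hc : ∀ t, DifferentiableWithinAt ℝ (fun y => coef t (θ y)) s (Ψ u) := fun t =>
    (coef t).differentiableAt.comp_differentiableWithinAt _ hθ
  have hc' : ∀ t, DifferentiableWithinAt ℝ (fun u => coef t (θ (Ψ u))) s' u := fun t =>
    (hc t).comp u hΨd hm
  simp only [fun u => pb_eq_sum (fderivWithin ℝ Ψ s' u) (θ (Ψ u))]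
  rw [coordD_sum (hu' u hus) _ fun t _ => (hc' t).fun_smul (hF _), coordD_eq_sum hu hθ, map_sum]
  refine Finset.sum_congr rfl fun t _ => ?_
  rw [coordD_smul (hu' u hus) (hc' t) (hF _), hF0, smul_zero, add_zero, map_mul, pb_ofDual]
  congr 2
  exact fderivWithin_comp (g := fun y => coef t (θ y)) u (hc t) hΨd hm (hu' u hus)

end CoordD

/-! ### Differential forms on manifolds -/

section ManifoldForms

variable {m : ℕ} {H : Type*} [TopologicalSpace H]
  {I : ModelWithCorners ℝ (EuclideanSpace ℝ (Fin m)) H}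
  {N : Type*} [TopologicalSpace N] [ChartedSpace H N] [IsManifold I ∞ N]
  {m' : ℕ} {H' : Type*} [TopologicalSpace H']
  {I' : ModelWithCorners ℝ (EuclideanSpace ℝ (Fin m')) H'}
  {N' : Type*} [TopologicalSpace N'] [ChartedSpace H' N'] [IsManifold I' ∞ N']

/-- The value of a form at a point, with the tangent space identified with `ℝᵐ`. -/
def formAt (η : DForm I N) (z : N) : Lam m := η z

theorem chartRep_of_eq (η : DForm I N) {x z : N} {y : EuclideanSpace ℝ (Fin m)}
    (h : (extChartAt I x).symm y = z) :
    chartRep I η x y = pb (tangentCoordChange I x z z) (formAt η z) := by subst h; rfl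

variable (I) in
theorem tangentCoordChange_comp_eq_id {x z : N} (hz : z ∈ (extChartAt I x).source) :
    tangentCoordChange I x z z ∘L tangentCoordChange I z x z = ContinuousLinearMap.id ℝ _ := by
  ext1 v
  have hz' := mem_extChartAt_source (I := I) z
  rw [ContinuousLinearMap.comp_apply, tangentCoordChange_comp ⟨⟨hz', hz⟩, hz'⟩,
    tangentCoordChange_self hz']
  rfl

variable (I) in
theorem tangentCoordChange_comp_eq_id' {x z : N} (hz : z ∈ (extChartAt I x).source) :
    tangentCoordChange I z x z ∘L tangentCoordChange I x z z = ContinuousLinearMap.id ℝ _ := by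
  ext1 v
  have hz' := mem_extChartAt_source (I := I) z
  rw [ContinuousLinearMap.comp_apply, tangentCoordChange_comp ⟨⟨hz, hz'⟩, hz⟩,
    tangentCoordChange_self hz]
  rfl

theorem chartRep_self (η : DForm I N) (x : N) : chartRep I η x (extChartAt I x x) = formAt η x := by
  rw [chartRep_of_eq η (extChartAt_to_inv (I := I) x),
    show tangentCoordChange I x x x = ContinuousLinearMap.id ℝ _ from
      ContinuousLinearMap.ext fun v => tangentCoordChange_self (mem_extChartAt_source (I := I) x)]
  exact pb_id _

/-- Smooth differential forms, of mixed degree. -/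
def IsSmoothDForm (η : DForm I N) : Prop :=
  ∀ x, ContDiffOn ℝ ∞ (chartRep I η x) (extChartAt I x).target

theorem IsSmoothForm.isSmoothDForm {k : ℕ} {η : DForm I N} (h : IsSmoothForm I k η) :
    IsSmoothDForm η := by
  intro x
  have : chartRep I η x = fun y => ∑ s, chartCoef I η x s y • extBasis m s :=
    funext fun y => ((extBasis m).sum_repr _).symm
  rw [this]
  exact ContDiffOn.sum fun s _ => (h.2 x s).smul contDiffOn_const

theorem IsSmoothDForm.contDiffWithinAt {η : DForm I N} (h : IsSmoothDForm η) {x : N}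
    {y : EuclideanSpace ℝ (Fin m)} (hy : y ∈ (extChartAt I x).target) :
    ContDiffWithinAt ℝ ∞ (chartRep I η x) (Set.range I) y :=
  (h x y hy).mono_of_mem_nhdsWithin (extChartAt_target_mem_nhdsWithin_of_mem hy)

theorem IsSmoothDForm.differentiableWithinAt {η : DForm I N} (h : IsSmoothDForm η) {x : N}
    {y : EuclideanSpace ℝ (Fin m)} (hy : y ∈ (extChartAt I x).target) :
    DifferentiableWithinAt ℝ (chartRep I η x) (Set.range I) y :=
  (h.contDiffWithinAt hy).differentiableWithinAt (by simp)

theorem extD_eq_coordD {η : DForm I N} (h : IsSmoothDForm η) (x : N) :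
    formAt (extD I η) x = coordD (Set.range I) (chartRep I η x) (extChartAt I x x) := by
  have hy := mem_extChartAt_target (I := I) x
  rw [coordD_eq_sum (I.uniqueDiffOn _ (extChartAt_target_subset_range x hy))
    (h.differentiableWithinAt hy)]
  simp only [← sum_ι_coBasis_smul, Finset.sum_mul, smul_mul_assoc]
  rw [Finset.sum_comm]
  rfl

variable (I I') in
/-- The derivative of a map, with the tangent spaces identified with Euclidean spaces. -/
def derivAt (j : N' → N) (w : N') : EuclideanSpace ℝ (Fin m') →L[ℝ] EuclideanSpace ℝ (Fin m) :=
  mfderiv I' I j w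

theorem formAt_pullForm (j : N' → N) (η : DForm I N) (w : N') :
    formAt (pullForm I I' j η) w = pb (derivAt I I' j w) (formAt η (j w)) := rfl

/-- A map read in charts. -/
theorem hasFDerivWithinAt_inCharts {j : N' → N} (hj : ContMDiff I' I ∞ j) {b : N'} {x : N}
    {u : EuclideanSpace ℝ (Fin m')} {w : N'} (hu : u ∈ (extChartAt I' b).target)
    (hw : (extChartAt I' b).symm u = w) (hx : j w ∈ (extChartAt I x).source) :
    HasFDerivWithinAt (extChartAt I x ∘ j ∘ (extChartAt I' b).symm)
      (tangentCoordChange I (j w) x (j w) ∘L derivAt I I' j w ∘L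
        tangentCoordChange I' b w w) (Set.range I') u := by
  have hwb : w ∈ (extChartAt I' b).source := hw ▸ (extChartAt I' b).map_target hu
  have hub : extChartAt I' b w = u := hw ▸ (extChartAt I' b).right_inv hu
  -- The manifold derivative at w refers to the preferred charts at w and j w. The chain rule
  -- inserts the changes from the chart at b and to the chart at x.
  have h1 := hasFDerivWithinAt_tangentCoordChange (I := I') (x := b) (y := w) (z := w)
    ⟨hwb, mem_extChartAt_source (I := I') w⟩
  have h2 := ((hj w).mdifferentiableAt (by simp)).hasMFDerivAt.2
  have h3 := hasFDerivWithinAt_tangentCoordChange (I := I) (x := j w) (y := x) (z := j w)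
    ⟨mem_extChartAt_source (I := I) (j w), hx⟩
  have e2 : (writtenInExtChartAt I' I w j) (extChartAt I' w w) = extChartAt I (j w) (j w) := by
    simp [writtenInExtChartAt]
  have e1 : (extChartAt I' w ∘ (extChartAt I' b).symm) (extChartAt I' b w) = extChartAt I' w w := by
    rw [Function.comp_apply, (extChartAt I' b).left_inv hwb]
  rw [← e2] at h3
  have h32 := h3.comp _ h2 (fun a _ => by
    simp only [writtenInExtChartAt, extChartAt_coe, Function.comp_apply]; exact Set.mem_range_self _)
  rw [← e1] at h32
  have h321 := h32.comp _ h1 (fun a _ => by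
    simp only [extChartAt_coe, Function.comp_apply]; exact Set.mem_range_self _)
  rw [hub] at h321
  refine h321.congr_of_eventuallyEq ?_ ?_
  · have hc := continuousAt_extChartAt_symm'' hu
    rw [ContinuousAt, hw] at hc
    have hjc : ContinuousAt j w := hj.continuous.continuousAt
    filter_upwards [mem_nhdsWithin_of_mem_nhds (hc (extChartAt_source_mem_nhds' (I := I')
      (mem_extChartAt_source (I := I') w))), mem_nhdsWithin_of_mem_nhds
      (hc (hjc (extChartAt_source_mem_nhds (I := I) (j w))))] with v hv1 hv2
    simp only [Function.comp_apply, writtenInExtChartAt]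
    rw [(extChartAt I' w).left_inv hv1, (extChartAt I (j w)).left_inv hv2]
  · simp only [Function.comp_apply, writtenInExtChartAt, hw, extChartAt_to_inv]

theorem contDiffWithinAt_inCharts {j : N' → N} (hj : ContMDiff I' I ∞ j) {b : N'} {x : N}
    {u : EuclideanSpace ℝ (Fin m')} (hu : u ∈ (extChartAt I' b).target)
    (hx : j ((extChartAt I' b).symm u) ∈ (extChartAt I x).source) :
    ContDiffWithinAt ℝ ∞ (extChartAt I x ∘ j ∘ (extChartAt I' b).symm) (Set.range I') u := by
  have hw := (extChartAt I' b).map_target hu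
  rw [extChartAt_source] at hw hx
  have := ((contMDiffAt_iff_of_mem_source hw hx).1 (hj _)).2
  rwa [(extChartAt I' b).right_inv hu] at this

theorem mapsTo_inCharts (j : N' → N) (b : N') (x : N) (s : Set (EuclideanSpace ℝ (Fin m'))) :
    Set.MapsTo (extChartAt I x ∘ j ∘ (extChartAt I' b).symm) s (Set.range I) := fun a _ => by
  simp only [extChartAt_coe, Function.comp_apply]; exact Set.mem_range_self _

/-- Near a point of the chart at `b`, the image under `j` stays in the chart at `x`. -/
theorem eventually_inCharts {j : N' → N} (hj : ContMDiff I' I ∞ j) {b : N'} {x : N}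
    {u : EuclideanSpace ℝ (Fin m')} (hu : u ∈ (extChartAt I' b).target)
    (hx : j ((extChartAt I' b).symm u) ∈ (extChartAt I x).source) :
    ∀ᶠ v in nhdsWithin u (Set.range I'), v ∈ (extChartAt I' b).target ∧
      j ((extChartAt I' b).symm v) ∈ (extChartAt I x).source := by
  refine Filter.Eventually.and (extChartAt_target_mem_nhdsWithin_of_mem hu) ?_
  exact mem_nhdsWithin_of_mem_nhds ((hj.continuous.continuousAt.comp
    (continuousAt_extChartAt_symm'' hu)) (extChartAt_source_mem_nhds' hx))

theorem chartRep_pullForm {j : N' → N} (hj : ContMDiff I' I ∞ j) (η : DForm I N) {b : N'} {x : N}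
    {u : EuclideanSpace ℝ (Fin m')} (hu : u ∈ (extChartAt I' b).target)
    (hx : j ((extChartAt I' b).symm u) ∈ (extChartAt I x).source) :
    chartRep I' (pullForm I I' j η) b u =
      pb (fderivWithin ℝ (extChartAt I x ∘ j ∘ (extChartAt I' b).symm) (Set.range I') u)
        (chartRep I η x ((extChartAt I x ∘ j ∘ (extChartAt I' b).symm) u)) := by
  generalize hw : (extChartAt I' b).symm u = w at hx
  rw [(hasFDerivWithinAt_inCharts hj hu hw hx).fderivWithin
    (I'.uniqueDiffOn _ (extChartAt_target_subset_range b hu)), chartRep_of_eq _ hw,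
    chartRep_of_eq η (z := j w) (by simp only [Function.comp_apply, hw, (extChartAt I x).left_inv hx]),
    ← pb_comp, ← ContinuousLinearMap.comp_assoc, tangentCoordChange_comp_eq_id I hx, ContinuousLinearMap.id_comp,
    pb_comp, formAt_pullForm]

theorem coordD_chartRep_pullForm {j : N' → N} (hj : ContMDiff I' I ∞ j) {η : DForm I N}
    (hη : IsSmoothDForm η) {b : N'} {x : N}
    {u : EuclideanSpace ℝ (Fin m')} (hu : u ∈ (extChartAt I' b).target)
    (hx : j ((extChartAt I' b).symm u) ∈ (extChartAt I x).source) :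
    coordD (Set.range I') (chartRep I' (pullForm I I' j η) b) u =
      pb (fderivWithin ℝ (extChartAt I x ∘ j ∘ (extChartAt I' b).symm) (Set.range I') u)
        (coordD (Set.range I) (chartRep I η x) ((extChartAt I x ∘ j ∘ (extChartAt I' b).symm) u)) := by
  have hur := extChartAt_target_subset_range b hu
  have heq : chartRep I' (pullForm I I' j η) b =ᶠ[nhdsWithin u (Set.range I')] fun u =>
      pb (fderivWithin ℝ (extChartAt I x ∘ j ∘ (extChartAt I' b).symm) (Set.range I') u)
        (chartRep I η x ((extChartAt I x ∘ j ∘ (extChartAt I' b).symm) u)) := by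
    filter_upwards [eventually_inCharts hj hu hx] with v hv
    exact chartRep_pullForm hj η hv.1 hv.2
  rw [coordD_congr heq (heq.self_of_nhdsWithin hur)]
  exact coordD_pb I'.uniqueDiffOn hur (I'.range_subset_closure_interior hur)
    (contDiffWithinAt_inCharts hj hu hx) (mapsTo_inCharts j b x _)
    (I.uniqueDiffOn _ (mapsTo_inCharts j b x _ hur))
    (hη.differentiableWithinAt ((extChartAt I x).map_source hx))

theorem pullForm_id (η : DForm I N) : pullForm I I id η = η := by
  funext x
  change ExteriorAlgebra.map (mfderiv I I id x).toLinearMap.dualMap (η x) = η x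
  rw [mfderiv_id]
  exact pb_id (η x)

/-- `extD` uses a different chart at each point. Naturality for the identity map, which in
coordinates is a change of charts, shows that a single chart computes it on its whole domain. -/
theorem chartRep_extD {η : DForm I N} (hη : IsSmoothDForm η) {x : N}
    {y : EuclideanSpace ℝ (Fin m)} (hy : y ∈ (extChartAt I x).target) :
    chartRep I (extD I η) x y = coordD (Set.range I) (chartRep I η x) y := by
  generalize hz : (extChartAt I x).symm y = z
  have hzx : z ∈ (extChartAt I x).source := hz ▸ (extChartAt I x).map_target hy
  have hxz : extChartAt I x z = y := hz ▸ (extChartAt I x).right_inv hy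
  have := coordD_chartRep_pullForm (I' := I) (j := id) contMDiff_id hη hy (x := z)
    (by rw [id, hz]; exact mem_extChartAt_source z)
  rw [pullForm_id] at this
  rw [this, chartRep_of_eq _ hz, extD_eq_coordD hη, tangentCoordChange_def, hxz]
  simp only [Function.comp_apply, hz, id]
  rfl

theorem extD_pullForm {j : N' → N} (hj : ContMDiff I' I ∞ j) {η : DForm I N}
    (hη : IsSmoothDForm η) (hη' : IsSmoothDForm (pullForm I I' j η)) :
    extD I' (pullForm I I' j η) = pullForm I I' j (extD I η) := by
  funext b
  change formAt (extD I' (pullForm I I' j η)) b = formAt (pullForm I I' j (extD I η)) b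
  rw [extD_eq_coordD hη', formAt_pullForm, coordD_chartRep_pullForm hj hη (x := j b) (mem_extChartAt_target b)
    (by rw [extChartAt_to_inv]; exact mem_extChartAt_source _)]
  have hb := (extChartAt_to_inv (I := I') b)
  have hd := (hasFDerivWithinAt_inCharts hj (x := j b) (mem_extChartAt_target b) hb
    (mem_extChartAt_source _)).fderivWithin (I'.uniqueDiffOn _ (extChartAt_target_subset_range b (mem_extChartAt_target b)))
  rw [hd]
  simp only [Function.comp_apply, hb]
  rw [extD_eq_coordD hη, show tangentCoordChange I (j b) (j b) (j b) = ContinuousLinearMap.id ℝ _ from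
      ContinuousLinearMap.ext fun v => tangentCoordChange_self (mem_extChartAt_source (I := I) _),
     show tangentCoordChange I' b b b = ContinuousLinearMap.id ℝ _ from
      ContinuousLinearMap.ext fun v => tangentCoordChange_self (mem_extChartAt_source (I := I') _)]
  rfl

theorem IsSmoothDForm.pullForm {j : N' → N} (hj : ContMDiff I' I ∞ j) {η : DForm I N}
    (hη : IsSmoothDForm η) : IsSmoothDForm (pullForm I I' j η) := by
  intro b u hu
  set x := j ((extChartAt I' b).symm u)
  have hx : j ((extChartAt I' b).symm u) ∈ (extChartAt I x).source := mem_extChartAt_source _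
  have hur := extChartAt_target_subset_range b hu
  have hΨ := contDiffWithinAt_inCharts hj hu hx
  have h1 : ContDiffWithinAt ℝ ∞ (fun u =>
      pb (fderivWithin ℝ (extChartAt I x ∘ j ∘ (extChartAt I' b).symm) (Set.range I') u)
        (chartRep I η x ((extChartAt I x ∘ j ∘ (extChartAt I' b).symm) u))) (Set.range I') u :=
    (hΨ.fderivWithin_right I'.uniqueDiffOn (by simp) hur).pb
      (ContDiffWithinAt.comp (g := chartRep I η x) u
        (hη.contDiffWithinAt ((extChartAt I x).map_source hx)) hΨ (mapsTo_inCharts j b x _))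
  have heq : chartRep I' (_root_.pullForm I I' j η) b =ᶠ[nhdsWithin u (Set.range I')] fun u =>
      pb (fderivWithin ℝ (extChartAt I x ∘ j ∘ (extChartAt I' b).symm) (Set.range I') u)
        (chartRep I η x ((extChartAt I x ∘ j ∘ (extChartAt I' b).symm) u)) := by
    filter_upwards [eventually_inCharts hj hu hx] with v hv
    exact chartRep_pullForm hj η hv.1 hv.2
  exact (h1.congr_of_eventuallyEq heq (heq.self_of_nhdsWithin hur)).mono
    (extChartAt_target_subset_range b)

theorem IsSmoothDForm.extD {η : DForm I N} (hη : IsSmoothDForm η) : IsSmoothDForm (extD I η) := by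
  intro x y hy
  have hyr := extChartAt_target_subset_range x hy
  have h1 : ContDiffWithinAt ℝ ∞ (coordD (Set.range I) (chartRep I η x)) (Set.range I) y := by
    refine ContDiffWithinAt.sum fun i _ => contDiffWithinAt_const.lam_mul ?_
    exact ((hη.contDiffWithinAt hy).fderivWithin_right I.uniqueDiffOn (by simp) hyr).clm_apply
      contDiffWithinAt_const
  exact (h1.mono (extChartAt_target_subset_range x)).congr
    (fun z hz => chartRep_extD hη hz) (chartRep_extD hη hy)

theorem chartRep_mul (η θ : DForm I N) (x : N) (y : EuclideanSpace ℝ (Fin m)) :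
    chartRep I (η * θ) x y = chartRep I η x y * chartRep I θ x y :=
  map_mul (pb (tangentCoordChange I x _ _)) _ _

theorem chartRep_add (η θ : DForm I N) (x : N) (y : EuclideanSpace ℝ (Fin m)) :
    chartRep I (η + θ) x y = chartRep I η x y + chartRep I θ x y :=
  map_add (pb (tangentCoordChange I x _ _)) _ _

theorem chartRep_smul (r : ℝ) (η : DForm I N) (x : N) (y : EuclideanSpace ℝ (Fin m)) :
    chartRep I (r • η) x y = r • chartRep I η x y :=
  map_smul (pb (tangentCoordChange I x _ _)) r (formAt η _)

theorem chartRep_zero (x : N) (y : EuclideanSpace ℝ (Fin m)) :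
    chartRep I (0 : DForm I N) x y = 0 :=
  map_zero (pb (tangentCoordChange I x _ _))

theorem IsSmoothDForm.mul {η θ : DForm I N} (hη : IsSmoothDForm η) (hθ : IsSmoothDForm θ) :
    IsSmoothDForm (η * θ) := by
  intro x y hy
  rw [show chartRep I (η * θ) x = _ from funext fun y => chartRep_mul η θ x y]
  exact (hη x y hy).lam_mul (hθ x y hy)

theorem IsSmoothDForm.add {η θ : DForm I N} (hη : IsSmoothDForm η) (hθ : IsSmoothDForm θ) :
    IsSmoothDForm (η + θ) := by
  intro x
  rw [show chartRep I (η + θ) x = _ from funext fun y => chartRep_add η θ x y]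
  exact (hη x).add (hθ x)

theorem IsSmoothDForm.smul (r : ℝ) {η : DForm I N} (hη : IsSmoothDForm η) :
    IsSmoothDForm (r • η) := by
  intro x
  rw [show chartRep I (r • η) x = _ from funext fun y => chartRep_smul r η x y]
  exact (hη x).const_smul r

theorem IsSmoothDForm.zero : IsSmoothDForm (0 : DForm I N) := by
  intro x
  rw [show chartRep I (0 : DForm I N) x = fun _ => 0 from funext fun y => chartRep_zero x y]
  exact contDiffOn_const

theorem IsSmoothDForm.sum {ι : Type*} (t : Finset ι) {η : ι → DForm I N}
    (hη : ∀ i ∈ t, IsSmoothDForm (η i)) : IsSmoothDForm (∑ i ∈ t, η i) :=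
  Finset.sum_induction _ IsSmoothDForm (fun _ _ => IsSmoothDForm.add) .zero hη

theorem extD_add {η θ : DForm I N} (hη : IsSmoothDForm η) (hθ : IsSmoothDForm θ) :
    extD I (η + θ) = extD I η + extD I θ := by
  funext x
  change formAt (extD I (η + θ)) x = formAt (extD I η) x + formAt (extD I θ) x
  have hx := mem_extChartAt_target (I := I) x
  rw [extD_eq_coordD (hη.add hθ), extD_eq_coordD hη, extD_eq_coordD hθ,
    show chartRep I (η + θ) x = _ from funext fun y => chartRep_add η θ x y]
  exact coordD_add (I.uniqueDiffOn _ (extChartAt_target_subset_range x hx))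
    (hη.differentiableWithinAt hx) (hθ.differentiableWithinAt hx)

theorem extD_smul (r : ℝ) {η : DForm I N} (hη : IsSmoothDForm η) :
    extD I (r • η) = r • extD I η := by
  funext x
  change formAt (extD I (r • η)) x = r • formAt (extD I η) x
  have hx := mem_extChartAt_target (I := I) x
  rw [extD_eq_coordD (hη.smul r), extD_eq_coordD hη,
    show chartRep I (r • η) x = _ from funext fun y => chartRep_smul r η x y]
  exact coordD_const_smul (I.uniqueDiffOn _ (extChartAt_target_subset_range x hx))
    (hη.differentiableWithinAt hx) r

theorem extD_sum {ι : Type*} (t : Finset ι) {η : ι → DForm I N}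
    (hη : ∀ i ∈ t, IsSmoothDForm (η i)) : extD I (∑ i ∈ t, η i) = ∑ i ∈ t, extD I (η i) := by
  classical
  induction t using Finset.induction_on with
  | empty =>
    simp only [Finset.sum_empty]
    simpa using extD_smul (I := I) 0 (IsSmoothDForm.zero (N := N))
  | insert i t hi ih =>
    rw [Finset.sum_insert hi, Finset.sum_insert hi, extD_add (hη i (by simp))
      (IsSmoothDForm.sum t fun k hk => hη k (by simp [hk])), ih fun k hk => hη k (by simp [hk])]

theorem extD_mul {η θ : DForm I N} (hη : IsSmoothDForm η) (hθ : IsSmoothDForm θ) {k : ℕ}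
    (hk : ∀ x, η x ∈ ⋀[ℝ]^k (Module.Dual ℝ (TangentSpace I x))) :
    extD I (η * θ) = extD I η * θ + (-1 : ℝ) ^ k • (η * extD I θ) := by
  funext x
  change formAt (extD I (η * θ)) x =
    formAt (extD I η) x * formAt θ x + (-1 : ℝ) ^ k • (formAt η x * formAt (extD I θ) x)
  have hx := mem_extChartAt_target (I := I) x
  rw [extD_eq_coordD (hη.mul hθ), show chartRep I (η * θ) x = _ from funext fun y => chartRep_mul η θ x y,
    coordD_mul_of_mem (I.uniqueDiffOn _ (extChartAt_target_subset_range x hx))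
    (hη.differentiableWithinAt hx) (hθ.differentiableWithinAt hx) (k := k)
    (by rw [chartRep_self]; exact hk x), chartRep_self, chartRep_self, extD_eq_coordD hη,
    extD_eq_coordD hθ]

theorem extD_mem {η : DForm I N} (hη : IsSmoothDForm η) {k : ℕ}
    (hk : ∀ x, η x ∈ ⋀[ℝ]^k (Module.Dual ℝ (TangentSpace I x))) (x : N) :
    extD I η x ∈ ⋀[ℝ]^(k + 1) (Module.Dual ℝ (TangentSpace I x)) := by
  have hx := mem_extChartAt_target (I := I) x
  change formAt (extD I η) x ∈ _
  rw [extD_eq_coordD hη]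
  refine coordD_mem (I.uniqueDiffOn _ (extChartAt_target_subset_range x hx))
    (hη.differentiableWithinAt hx) fun y => ?_
  exact ExteriorAlgebra.map_mem _ (hk _)

theorem extD_extD {η : DForm I N} (hη : IsSmoothDForm η) : extD I (extD I η) = 0 := by
  funext x
  change formAt (extD I (extD I η)) x = 0
  have hx := mem_extChartAt_target (I := I) x
  have hxr := extChartAt_target_subset_range x hx
  have heq : chartRep I (extD I η) x =ᶠ[nhdsWithin (extChartAt I x x) (Set.range I)]
      coordD (Set.range I) (chartRep I η x) := by
    filter_upwards [extChartAt_target_mem_nhdsWithin_of_mem hx] with y hy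
    exact chartRep_extD hη hy
  rw [extD_eq_coordD hη.extD, coordD_congr heq (heq.self_of_nhdsWithin hxr)]
  exact coordD_coordD I.uniqueDiffOn hxr (I.range_subset_closure_interior hxr) (hη.contDiffWithinAt hx)

end ManifoldForms

/-! ### The field strength -/

universe v₁ w₁

section FieldStrength

open GradedFnAlg

variable {E₀ H₀ M₀ : Type*} [NormedAddCommGroup E₀] [NormedSpace ℝ E₀] [TopologicalSpace H₀]
  {I₀ : ModelWithCorners ℝ E₀ H₀} [TopologicalSpace M₀] [ChartedSpace H₀ M₀] {G : GradedFnAlg I₀ M₀}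
  {m : ℕ} {H : Type*} [TopologicalSpace H]
  {I : ModelWithCorners ℝ (EuclideanSpace ℝ (Fin m)) H}
  {N : Type*} [TopologicalSpace N] [ChartedSpace H N] [IsManifold I ∞ N]
  {m' : ℕ} {H' : Type*} [TopologicalSpace H']
  {I' : ModelWithCorners ℝ (EuclideanSpace ℝ (Fin m')) H'}
  {N' : Type*} [TopologicalSpace N'] [ChartedSpace H' N'] [IsManifold I' ∞ N']

/-- The vector field zero, of degree one. -/
def GradedFnAlg.VField.zeroOne : G.VField 1 where
  toFun := 0
  map_deg _ := Submodule.zero_mem _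
  leibniz _ _ := by simp
  chain _ _ _ := by simp

/-- Pull-backs of functions along degree preserving maps `T[1]N → S`. -/
structure IsPull (φ : G.carrier →ₐ[ℝ] DForm I N) : Prop where
  smooth : ∀ a, IsSmoothDForm (φ a)
  mem : ∀ {k : ℕ} {a : G.carrier}, a ∈ G.deg k →
    ∀ x, φ a x ∈ ⋀[ℝ]^k (Module.Dual ℝ (TangentSpace I x))
  body : ∃ b : N → M₀, ∀ (h : SmoothFn I₀ M₀) x, φ (G.ofSmooth h) x = algebraMap ℝ _ (h (b x))

theorem GradedMap.isPull {p n : ℕ} {M : Type*} [TopologicalSpace M]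
    [ChartedSpace (EuclideanSpace ℝ (Fin n)) M] {S : GradedManifold p n M} (φ : GradedMap S I N) :
    IsPull φ.pull where
  smooth a := by
    induction a using S.global.homogeneous_induction with
    | h0 => rw [map_zero]; exact .zero
    | hh k a ha => exact (φ.pull_smooth ha).isSmoothDForm
    | ha a b h h' => rw [map_add]; exact h.add h'
  mem ha := (φ.pull_smooth ha).1
  body := ⟨fun x => ⟨φ.body x, trivial⟩, φ.pull_body⟩

theorem IsPull.comp_pullForm {φ : G.carrier →ₐ[ℝ] DForm I N} (hφ : IsPull φ) {j : N' → N}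
    (hj : ContMDiff I' I ∞ j) : IsPull ((pullForm I I' j).comp φ) where
  smooth a := (hφ.smooth a).pullForm hj
  mem ha x := ExteriorAlgebra.map_mem _ (hφ.mem ha (j x))
  body := by
    obtain ⟨b, hb⟩ := hφ.body
    refine ⟨b ∘ j, fun h x => ?_⟩
    change ExteriorAlgebra.map _ (φ (G.ofSmooth h) (j x)) = _
    rw [hb, AlgHom.commutes]
    rfl

theorem chartRep_of_algebraMap {η : DForm I N} {c : N → ℝ} (h : ∀ x, η x = algebraMap ℝ _ (c x)) (x : N) :
    chartRep I η x = fun y => algebraMap ℝ (Lam m) (c ((extChartAt I x).symm y)) :=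
  funext fun y => by
    rw [chartRep_of_eq η rfl, formAt, h]
    exact AlgHom.commutes (pb (tangentCoordChange I x _ _)) _

/-- The smoothness of c is recovered from that of the form by the linear projection to degree zero.
-/
theorem differentiableWithinAt_of_algebraMap {η : DForm I N} (hη : IsSmoothDForm η) {c : N → ℝ}
    (h : ∀ x, η x = algebraMap ℝ _ (c x)) {x : N} {y : EuclideanSpace ℝ (Fin m)}
    (hy : y ∈ (extChartAt I x).target) :
    ContDiffWithinAt ℝ ∞ (fun y => c ((extChartAt I x).symm y)) (Set.range I) y := by
  have h1 := hη.contDiffWithinAt hy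
  rw [chartRep_of_algebraMap h] at h1
  let L : Lam m →L[ℝ] ℝ := LinearMap.toContinuousLinearMap
    (ExteriorAlgebra.algebraMapInv (R := ℝ)).toLinearMap
  have h2 := L.contDiff.contDiffAt.comp_contDiffWithinAt y h1
  convert h2 using 1
  funext z
  exact (ExteriorAlgebra.algebraMap_leftInverse _ _).symm

theorem extD_of_algebraMap {η : DForm I N} (hη : IsSmoothDForm η) {c : N → ℝ}
    (h : ∀ x, η x = algebraMap ℝ _ (c x)) (x : N) : formAt (extD I η) x =
      ofDual (fderivWithin ℝ (fun y => c ((extChartAt I x).symm y)) (Set.range I) (extChartAt I x x)) := by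
  have hy := mem_extChartAt_target (I := I) x
  rw [extD_eq_coordD hη, chartRep_of_algebraMap h]
  exact coordD_algebraMap (I.uniqueDiffOn _ (extChartAt_target_subset_range x hy))
    ((differentiableWithinAt_of_algebraMap hη h hy).differentiableWithinAt (by simp))

theorem IsPull.extD_comp {φ : G.carrier →ₐ[ℝ] DForm I N} (hφ : IsPull φ) {n : ℕ}
    (F : (Fin n → ℝ) → ℝ) (hF : ContDiff ℝ ∞ F) (h : Fin n → SmoothFn I₀ M₀) :
    extD I (φ (G.ofSmooth (SmoothFn.comp F hF h))) =
      ∑ i, φ (G.ofSmooth (SmoothFn.comp _ (partialDeriv_contDiff hF i) h)) *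
        extD I (φ (G.ofSmooth (h i))) := by
  obtain ⟨b, hb⟩ := hφ.body
  funext x
  have hy := mem_extChartAt_target (I := I) x
  rw [Finset.sum_apply]
  change formAt (extD I (φ (G.ofSmooth (SmoothFn.comp F hF h)))) x =
    ∑ i, formAt (φ (G.ofSmooth (SmoothFn.comp _ (partialDeriv_contDiff hF i) h))) x *
        formAt (extD I (φ (G.ofSmooth (h i)))) x
  rw [extD_of_algebraMap (hφ.smooth _) (hb _)]
  have e1 : ∀ i, formAt (φ (G.ofSmooth (SmoothFn.comp _ (partialDeriv_contDiff hF i) h))) x =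
      algebraMap ℝ (Lam m) (partialDeriv F i fun k => h k (b x)) := fun i => hb _ _
  have hd : ∀ i, DifferentiableWithinAt ℝ (fun y => h i (b ((extChartAt I x).symm y))) (Set.range I)
      (extChartAt I x x) := fun i =>
    (differentiableWithinAt_of_algebraMap (hφ.smooth _) (hb _) hy).differentiableWithinAt (by simp)
  simp only [e1, extD_of_algebraMap (hφ.smooth _) (hb _), ← Algebra.smul_def]
  simp only [← map_smul, ← map_sum]
  congr 1
  have hFd : DifferentiableAt ℝ F (fun k => h k (b ((extChartAt I x).symm (extChartAt I x x)))) :=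
    hF.differentiable (by simp) _
  have hc := hFd.hasFDerivAt.comp_hasFDerivWithinAt (f := fun y k => h k (b ((extChartAt I x).symm y)))
    (extChartAt I x x)
    (hasFDerivWithinAt_pi.2 fun i => (hd i).hasFDerivWithinAt)
  have h2 := hc.fderivWithin (I.uniqueDiffOn _ (extChartAt_target_subset_range x hy))
  rw [extChartAt_to_inv] at h2
  refine h2.trans ?_
  ext v
  simp only [ContinuousLinearMap.comp_apply, sum_apply, smul_apply, smul_eq_mul, partialDeriv]
  conv_lhs => rw [show (ContinuousLinearMap.pi fun i => fderivWithin ℝ (fun y => h i (b ((extChartAt I x).symm y)))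
    (Set.range I) (extChartAt I x x)) v = ∑ i, (fderivWithin ℝ (fun y => h i (b ((extChartAt I x).symm y)))
    (Set.range I) (extChartAt I x x) v) • (Pi.single i 1 : Fin n → ℝ) from by
      funext k; simp [Finset.sum_apply, Pi.single_apply]]
  rw [map_sum]
  exact Finset.sum_congr rfl fun i _ => by rw [map_smul, smul_eq_mul, mul_comm]

theorem graded_comm_forms {η θ : DForm I N} {i k : ℕ}
    (hη : ∀ x, η x ∈ ⋀[ℝ]^i (Module.Dual ℝ (TangentSpace I x)))
    (hθ : ∀ x, θ x ∈ ⋀[ℝ]^k (Module.Dual ℝ (TangentSpace I x))) :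
    η * θ = (-1 : ℝ) ^ (i * k) • (θ * η) :=
  funext fun x => ExteriorAlgebra.graded_comm (hη x) (hθ x)

/-- The map a ↦ d φ(a) − φ(Q a) is a derivation of degree one along φ, as the difference of two
such. The commutation relations hold because its value on a function of degree k is a (k + 1)-form.
-/
theorem IsPull.isFormHom {φ : G.carrier →ₐ[ℝ] DForm I N} (hφ : IsPull φ) (Q : G.VField 1) :
    G.IsFormHom (B := DForm I N) φ (fun a => extD I (φ a) - φ (Q.toFun a)) := by
  have hv : ∀ {k : ℕ} {a : G.carrier}, a ∈ G.deg k → ∀ x, (extD I (φ a) - φ (Q.toFun a)) x ∈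
      ⋀[ℝ]^(k + 1) (Module.Dual ℝ (TangentSpace I x)) := fun ha x =>
    Submodule.sub_mem _ (extD_mem (hφ.smooth _) (hφ.mem ha) x)
      (hφ.mem (Q.map_mem (by simp) ha) x)
  exact
  { fn_add := fun a b => map_add φ a b
    fn_mul := fun a b => map_mul φ a b
    fn_const := fun r => φ.commutes r
    d_add := fun a b => by
      simp only [map_add, extD_add (hφ.smooth a) (hφ.smooth b)]
      abel
    d_smul := fun r a => by
      simp only [map_smul, extD_smul r (hφ.smooth a), smul_sub]
    d_mul := fun {i a} b ha => by
      rw [VField.leibniz_odd odd_one Q b ha]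
      simp only [map_mul, map_add, map_smul, extD_mul (hφ.smooth a) (hφ.smooth b) (hφ.mem ha), sub_mul,
        mul_sub, smul_sub]
      abel
    fn_d_comm := fun ha hb => graded_comm_forms (hφ.mem ha) (hv hb)
    d_d_comm := fun ha hb => graded_comm_forms (hv ha) (hv hb)
    chain := fun F hF h => by
      rw [Q.chain F hF h, hφ.extD_comp F hF h, map_sum, ← Finset.sum_sub_distrib]
      exact Finset.sum_congr rfl fun i _ => by rw [map_mul, mul_sub] }

theorem IsFieldStrength.unique {Q : G.carrier →ₗ[ℝ] G.carrier} {φ : G.carrier →ₐ[ℝ] DForm I N}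
    {f f' : G.Form →ₐ[ℝ] DForm I N} (h : IsFieldStrength G Q φ f) (h' : IsFieldStrength G Q φ f') :
    f = f' :=
  form_algHom_ext _ (fun a => (h a).1.trans (h' a).1.symm) (fun a => (h a).2.trans (h' a).2.symm)

theorem IsPull.existsUnique_fieldStrength {φ : G.carrier →ₐ[ℝ] DForm I N} (hφ : IsPull φ)
    (Q : G.VField 1) : ∃! f, IsFieldStrength G Q.toFun φ f :=
  ⟨(hφ.isFormHom Q).lift, fun a => ⟨(hφ.isFormHom Q).lift_fn a, (hφ.isFormHom Q).lift_df a⟩,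
    fun _ h => h.unique fun a => ⟨(hφ.isFormHom Q).lift_fn a, (hφ.isFormHom Q).lift_df a⟩⟩

theorem IsFieldStrength.comp_pullForm {φ : G.carrier →ₐ[ℝ] DForm I N} (hφ : IsPull φ) {j : N' → N}
    (hj : ContMDiff I' I ∞ j) {κ : G.Form →ₐ[ℝ] DForm I N} (hκ : IsFieldStrength G 0 φ κ) :
    IsFieldStrength G 0 ((pullForm I I' j).comp φ) ((pullForm I I' j).comp κ) := fun a => by
  refine ⟨congrArg (pullForm I I' j) (hκ a).1, (congrArg (pullForm I I' j) (hκ a).2).trans ?_⟩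
  have h1 := extD_pullForm hj (hφ.smooth a) ((hφ.smooth a).pullForm hj)
  rw [AlgHom.comp_apply, h1, map_sub]
  simp

variable {p n : ℕ} {M : Type v₁} [TopologicalSpace M] [ChartedSpace (EuclideanSpace ℝ (Fin n)) M]
  {S : SymplecticQManifold.{v₁, w₁} p n M}

theorem IsPull.smooth_akszLagrangian (hp : 0 < p) {φ : S.global.carrier →ₐ[ℝ] DForm I N}
    (hφ : IsPull φ) {κ : S.global.Form →ₐ[ℝ] DForm I N} (hκ : IsFieldStrength S.global 0 φ κ)
    (h : S.global.carrier) : IsSmoothDForm (akszLagrangian S φ κ h) := by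
  obtain ⟨r, a, b, i, k, -, -, -, -, eα, -⟩ := SymplecticQManifold.exists_potential (S := S) hp
  refine IsSmoothDForm.add ?_ ((hφ.smooth h).smul _)
  rw [eα, map_sum]
  refine IsSmoothDForm.sum _ fun t _ => ?_
  rw [map_mul, (hκ _).1, (hκ _).2]
  simpa using (hφ.smooth _).mul (hφ.smooth _).extD

/-- The pull-back of the symplectic form along the field strength is the exterior derivative of
the integrand of the sigma model. -/
theorem IsFieldStrength.form_eq (hp : 0 < p) {φ : S.global.carrier →ₐ[ℝ] DForm I N} (hφ : IsPull φ)
    {f κ : S.global.Form →ₐ[ℝ] DForm I N} (hf : IsFieldStrength S.global S.Q.toFun φ f)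
    (hκ : IsFieldStrength S.global 0 φ κ) {h : S.global.carrier}
    (hh : S.IsHamiltonian (p + 1) h S.Q) : f S.form = extD I (akszLagrangian S φ κ h) := by
  obtain ⟨r, a, b, i, k, ha, hb, -, -, eα, e⟩ := SymplecticQManifold.exists_potential (S := S) hp
  have hκf : ∀ c, κ (S.global.fn c) = φ c := fun c => (hκ c).1
  have hκd : ∀ c, κ (S.global.df c) = extD I (φ c) := fun c => by rw [(hκ c).2]; simp
  have hs := hφ.smooth
  have eQ : S.global.contract S.Q S.form = ∑ t, (S.global.fn (S.Q.toFun (a t)) * S.global.df (b t) +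
      S.global.df (a t) * S.global.fn (S.Q.toFun (b t))) := by
    rw [e, map_sum]
    refine Finset.sum_congr rfl fun t _ => ?_
    rw [contract_df_mul_df _ (ha t)]
    simp
  -- The mixed terms of the expansion are the image of ι_Q ω = (−1)^(p+2) dh.
  have eQ1 : (-1 : ℝ) ^ p • extD I (φ h) = ∑ t, (φ (S.Q.toFun (a t)) * extD I (φ (b t)) +
      extD I (φ (a t)) * φ (S.Q.toFun (b t))) := by
    have := congrArg κ (hh.2.2.symm.trans eQ)
    simp only [map_sum, map_add, map_mul, hκf, hκd, map_smul] at this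
    rw [← this]
    congr 1
    rw [pow_add, pow_add]
    norm_num
  -- The terms quadratic in Q are half of ι_Q ι_Q ω: contraction with a field of degree one has an
  -- even sign, so ι_Q ι_Q (da db) = 2 Qa Qb. On the other hand ι_Q ι_Q ω is Qh up to sign, which is
  -- zero.
  have eQ2 : ∑ t, φ (S.Q.toFun (a t)) * φ (S.Q.toFun (b t)) = 0 := by
    have h1 : S.global.contract S.Q (S.global.contract S.Q S.form) = 0 := by
      rw [hh.2.2, map_smul, contract_df, hh.Q_hamiltonian]
      simp [S.global.fn_zero]
    rw [eQ, map_sum] at h1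
    have h2 : (2 : ℝ) • S.global.fn (∑ t, S.Q.toFun (a t) * S.Q.toFun (b t)) = 0 := by
      rw [S.global.fn_sum, Finset.smul_sum]
      refine Eq.trans (Finset.sum_congr rfl fun t _ => ?_) h1
      rw [map_add, isDer_contract, isDer_contract, contract_fn, contract_fn, contract_df, contract_df,
        S.global.isFormHom.fn_mul]
      rw [S.global.twist_fn _ (S.Q.map_mem (k := i t + 1) (by simp) (ha t))]
      simp [two_smul]
    have h3 := (smul_eq_zero_iff_right two_ne_zero).1 h2
    have h4 := congrArg κ h3
    simpa only [hκf, map_sum, map_mul, map_zero] using h4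
  have eα1 : κ S.α = ∑ t, φ (a t) * extD I (φ (b t)) := by
    rw [eα, map_sum]
    exact Finset.sum_congr rfl fun t _ => by rw [map_mul, hκf, hκd]
  have eα2 : extD I (κ S.α) = ∑ t, extD I (φ (a t)) * extD I (φ (b t)) := by
    rw [eα1, extD_sum _ fun t _ => (hs _).mul (hs _).extD]
    refine Finset.sum_congr rfl fun t _ => ?_
    rw [extD_mul (hs _) (hs _).extD (hφ.mem (ha t)), extD_extD (hs _)]
    simp
  have hsα : IsSmoothDForm (κ S.α) := by
    rw [eα1]; exact IsSmoothDForm.sum _ fun t _ => (hs _).mul (hs _).extD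
  rw [akszLagrangian, extD_add hsα ((hs _).smul _), extD_smul _ (hs _), eα2, pow_succ, mul_smul,
    neg_one_smul, smul_neg, eQ1, e, map_sum]
  have : ∀ t, f (S.global.df (a t) * S.global.df (b t)) = extD I (φ (a t)) * extD I (φ (b t)) -
      (φ (S.Q.toFun (a t)) * extD I (φ (b t)) + extD I (φ (a t)) * φ (S.Q.toFun (b t))) +
      φ (S.Q.toFun (a t)) * φ (S.Q.toFun (b t)) := fun t => by
    rw [map_mul, (hf _).2, (hf _).2]; noncomm_ring
  simp only [this, Finset.sum_add_distrib, Finset.sum_sub_distrib, eQ2]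
  noncomm_ring

end FieldStrength

/-! ### The top coefficient of an exterior form -/

namespace Lam

variable {m k : ℕ}

/-- The top coefficient of an exterior form. -/
def top : Lam m →L[ℝ] ℝ := coef Finset.univ

/-- On the basis of products of increasing coordinate one-forms, both sides are 1 on the full
product and 0 on the others. Statements about the top coefficient thereby become statements about
determinants. -/
theorem top_eq_liftAlternating : (top : Lam m →L[ℝ] ℝ).toLinearMap =
    ExteriorAlgebra.liftAlternating (Pi.single m (coBasis m).det) := by
  refine (extBasis m).ext fun s => ?_
  have h1 : (top : Lam m →L[ℝ] ℝ).toLinearMap (extBasis m s) = if s = Finset.univ then 1 else 0 := by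
    change (extBasis m).repr (extBasis m s) Finset.univ = _
    rw [Module.Basis.repr_self, Finsupp.single_apply]
  rw [h1, extBasis]
  by_cases hs : s = Finset.univ
  · subst hs
    rw [ExteriorAlgebra.basis_apply_ofCard (n := m) _ (by simp), ExteriorAlgebra.ιMulti_family,
      ExteriorAlgebra.liftAlternating_apply_ιMulti, Pi.single_eq_same, if_pos rfl]
    have : (Set.powersetCard.ofFinEmbEquiv.symm
        (Set.powersetCard.ofCard (s := (Finset.univ : Finset (Fin m))) (n := m) (by simp)) : Fin m → Fin m) = id := by
      rw [Set.powersetCard.ofFinEmbEquiv_symm_apply]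
      exact (Finset.orderEmbOfFin_unique _ (fun x => by simp) strictMono_id).symm
    rw [this, Function.comp_id, Module.Basis.det_self]
  · have hc : s.card ≠ m := fun h => hs (Finset.card_eq_iff_eq_univ s |>.1 (by simpa using h))
    rw [ExteriorAlgebra.basis_apply_ofCard (n := s.card) _ rfl, ExteriorAlgebra.ιMulti_family,
      ExteriorAlgebra.liftAlternating_apply_ιMulti, Pi.single_eq_of_ne hc, if_neg hs]
    rfl

theorem top_ιMulti (v : Fin m → Module.Dual ℝ (EuclideanSpace ℝ (Fin m))) :
    top (ExteriorAlgebra.ιMulti ℝ m v) = (coBasis m).det v := by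
  have := LinearMap.congr_fun (top_eq_liftAlternating (m := m)) (ExteriorAlgebra.ιMulti ℝ m v)
  rw [ExteriorAlgebra.liftAlternating_apply_ιMulti, Pi.single_eq_same] at this
  exact this

theorem top_ιMulti_of_ne {l : ℕ} (h : l ≠ m) (v : Fin l → Module.Dual ℝ (EuclideanSpace ℝ (Fin m))) :
    top (ExteriorAlgebra.ιMulti ℝ l v) = 0 := by
  have := LinearMap.congr_fun (top_eq_liftAlternating (m := m)) (ExteriorAlgebra.ιMulti ℝ l v)
  rw [ExteriorAlgebra.liftAlternating_apply_ιMulti, Pi.single_eq_of_ne h] at this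
  exact this

theorem linearMap_congr {F : Type*} [AddCommGroup F] [Module ℝ F] {f g : Lam m →ₗ[ℝ] F}
    (h : ∀ l (v : Fin l → Module.Dual ℝ (EuclideanSpace ℝ (Fin m))),
      f (ExteriorAlgebra.ιMulti ℝ l v) = g (ExteriorAlgebra.ιMulti ℝ l v)) (x : Lam m) : f x = g x :=
  LinearMap.congr_fun (ExteriorAlgebra.lhom_ext fun i => AlternatingMap.ext fun v => h i v) x

theorem pb_ιMulti (A : EuclideanSpace ℝ (Fin k) →L[ℝ] EuclideanSpace ℝ (Fin m)) {l : ℕ}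
    (v : Fin l → Module.Dual ℝ (EuclideanSpace ℝ (Fin m))) :
    pb A (ExteriorAlgebra.ιMulti ℝ l v) = ExteriorAlgebra.ιMulti ℝ l (A.toLinearMap.dualMap ∘ v) :=
  ExteriorAlgebra.map_apply_ιMulti _ _

theorem top_pb (A : EuclideanSpace ℝ (Fin m) →L[ℝ] EuclideanSpace ℝ (Fin m)) (x : Lam m) :
    top (pb A x) = A.det * top x := by
  refine linearMap_congr (f := top.toLinearMap ∘ₗ (pb A).toLinearMap) (g := A.det • top.toLinearMap)
    (fun l v => ?_) x
  change top (pb A _) = A.det * top _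
  rw [pb_ιMulti]
  by_cases h : l = m
  · subst h
    rw [top_ιMulti, top_ιMulti, Module.Basis.det_comp, LinearMap.det_dualMap]
  · rw [top_ιMulti_of_ne h, top_ιMulti_of_ne h, mul_zero]

/-- The inclusion of the hyperplane `y₀ = 0`. -/
def incl (k : ℕ) : EuclideanSpace ℝ (Fin k) →L[ℝ] EuclideanSpace ℝ (Fin (k + 1)) :=
  LinearMap.toContinuousLinearMap
    { toFun := fun u => WithLp.toLp 2 (Fin.cons 0 u.ofLp)
      map_add' := fun u v => by
        ext i; refine Fin.cases ?_ (fun i => ?_) i <;> simp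
      map_smul' := fun r u => by
        ext i; refine Fin.cases ?_ (fun i => ?_) i <;> simp }

@[simp] theorem incl_zero (u : EuclideanSpace ℝ (Fin k)) : incl k u 0 = 0 := rfl
@[simp] theorem incl_succ (u : EuclideanSpace ℝ (Fin k)) (i : Fin k) : incl k u i.succ = u i := rfl

/-- The projection to the hyperplane `y₀ = 0`. -/
def tail (k : ℕ) : EuclideanSpace ℝ (Fin (k + 1)) →L[ℝ] EuclideanSpace ℝ (Fin k) :=
  LinearMap.toContinuousLinearMap
    { toFun := fun y => WithLp.toLp 2 (fun i => y i.succ)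
      map_add' := fun u v => by ext i; simp
      map_smul' := fun r u => by ext i; simp }

@[simp] theorem tail_apply (y : EuclideanSpace ℝ (Fin (k + 1))) (i : Fin k) : tail k y i = y i.succ := rfl

@[simp] theorem tail_incl (u : EuclideanSpace ℝ (Fin k)) : tail k (incl k u) = u := by ext i; simp

theorem incl_tail {y : EuclideanSpace ℝ (Fin (k + 1))} (h : y 0 = 0) : incl k (tail k y) = y := by
  ext i; refine Fin.cases ?_ (fun i => ?_) i <;> simp [h]

theorem incl_single (i : Fin k) : incl k (EuclideanSpace.single i 1) = EuclideanSpace.single i.succ 1 := by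
  ext l; refine Fin.cases ?_ (fun l => ?_) l <;> simp [Fin.succ_ne_zero]

theorem det_coBasis_eq (v : Fin m → Module.Dual ℝ (EuclideanSpace ℝ (Fin m))) :
    (coBasis m).det v = (Matrix.of fun i l => v i (EuclideanSpace.single l 1)).det := by
  rw [Module.Basis.det_apply, ← Matrix.det_transpose]
  congr 1
  ext i l
  simp only [Matrix.transpose_apply, Module.Basis.toMatrix_apply, Matrix.of_apply]
  have h := (coBasis m).sum_repr (v i)
  have h2 := congrArg (fun L => L (EuclideanSpace.single l (1 : ℝ))) h
  simp only [LinearMap.sum_apply, LinearMap.smul_apply, coBasis_apply] at h2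
  simpa [Pi.single_apply] using h2

/-- On products of one-forms this is the expansion of a determinant along a first row (1, 0, …, 0).
It identifies the boundary term of the divergence theorem with the restriction of the form to the
hyperplane. -/
theorem top_ι_mul (x : Lam (k + 1)) :
    top (ExteriorAlgebra.ι ℝ (coBasis (k + 1) 0) * x) = top (pb (incl k) x) := by
  refine linearMap_congr (f := top.toLinearMap ∘ₗ LinearMap.mulLeft ℝ
    (ExteriorAlgebra.ι ℝ (coBasis (k + 1) 0))) (g := top.toLinearMap ∘ₗ (pb (incl k)).toLinearMap)
    (fun l v => ?_) x
  change top (ExteriorAlgebra.ι ℝ (coBasis (k + 1) 0) * ExteriorAlgebra.ιMulti ℝ l v) =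
    top (pb (incl k) (ExteriorAlgebra.ιMulti ℝ l v))
  have h1 := ExteriorAlgebra.ιMulti_succ_apply (R := ℝ) (Matrix.vecCons (coBasis (k + 1) 0) v)
  rw [Matrix.cons_val_zero, Matrix.tail_cons] at h1
  rw [← h1, pb_ιMulti]
  by_cases h : l = k
  · subst h
    rw [top_ιMulti, top_ιMulti, det_coBasis_eq, det_coBasis_eq, Matrix.det_succ_row_zero,
      Fin.sum_univ_succ, Finset.sum_eq_zero]
    · simp only [Nat.succ_eq_add_one, Matrix.of_apply, Matrix.cons_val_zero, coBasis_apply]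
      simp only [Fin.val_zero, pow_zero, PiLp.single_apply, if_true, mul_one, one_mul, add_zero]
      congr 1
      ext i n
      simp [incl_single]
    · intro i _
      simp [coBasis_apply, Fin.succ_ne_zero]
  · rw [top_ιMulti_of_ne (by simpa using h), top_ιMulti_of_ne h]

end Lam

/-! ### Stokes' theorem on the half space -/

open MeasureTheory

theorem integrableOn_of_continuousOn_of_eq_zero {X F : Type*} [TopologicalSpace X] [MeasurableSpace X]
    [OpensMeasurableSpace X] [T2Space X] [NormedAddCommGroup F] {μ : Measure X}
    [IsFiniteMeasureOnCompacts μ] {f : X → F} {D K : Set X} (hD : MeasurableSet D) (hK : IsCompact K)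
    (hKD : K ⊆ D) (hf : ContinuousOn f D) (h0 : ∀ x ∈ D, x ∉ K → f x = 0) : IntegrableOn f D μ :=
  ((hf.mono hKD).integrableOn_compact' hK hK.measurableSet).of_forall_sdiff_eq_zero hD
    fun x hx => h0 x hx.1 hx.2

/-- The divergence theorem on the half space, for vector fields with compact support. -/
theorem integral_divergence_halfSpace {k : ℕ}
    {V : EuclideanSpace ℝ (Fin (k + 1)) → Fin (k + 1) → ℝ}
    (hV : ContDiffOn ℝ 1 V {y | 0 ≤ y 0}) {K : Set (EuclideanSpace ℝ (Fin (k + 1)))}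
    (hK : IsCompact K) (h0 : ∀ y, 0 ≤ y 0 → y ∉ K → V y = 0) :
    ∫ y in {y : EuclideanSpace ℝ (Fin (k + 1)) | 0 ≤ y 0},
      ∑ i, fderivWithin ℝ V {y | 0 ≤ y 0} y (EuclideanSpace.single i 1) i =
    -∫ u, V (incl k u) 0 := by
  set s : Set (EuclideanSpace ℝ (Fin (k + 1))) := {y | 0 ≤ y 0} with hs
  have hsr : Set.range (𝓡∂ (k + 1)) = s := range_modelWithCornersEuclideanHalfSpace (k + 1)
  have hu : UniqueDiffOn ℝ s := hsr ▸ (𝓡∂ (k + 1)).uniqueDiffOn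
  have hsc : IsClosed s := hsr ▸ (𝓡∂ (k + 1)).isClosed_range
  obtain ⟨R, hR0, hR⟩ : ∃ R : ℝ, 0 < R ∧ ∀ y ∈ K, ∀ i, |y i| < R := by
    obtain ⟨R, hR⟩ := hK.isBounded.exists_norm_le
    refine ⟨|R| + 1, by positivity, fun y hy i => ?_⟩
    have := PiLp.norm_apply_le y i
    rw [Real.norm_eq_abs] at this
    have h2 := hR y hy
    have := le_abs_self R
    linarith
  have hVR : ∀ y ∈ s, (∃ i, R ≤ |y i|) → V y = 0 := fun y hy ⟨i, hi⟩ =>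
    h0 y hy fun hyK => absurd (hR y hyK i) (not_lt.2 hi)
  let T : (Fin (k + 1) → ℝ) →L[ℝ] EuclideanSpace ℝ (Fin (k + 1)) :=
    (EuclideanSpace.equiv (Fin (k + 1)) ℝ).symm.toContinuousLinearMap
  have hT : ∀ x, T x = WithLp.toLp 2 x := fun _ => rfl
  -- The box is [0, R] × [−R, R]^k. The field vanishes on all its faces except the one in the
  -- hyperplane y₀ = 0.
  let a : Fin (k + 1) → ℝ := Fin.cons 0 fun _ => -R
  let b : Fin (k + 1) → ℝ := fun _ => R
  have hab : a ≤ b := fun i => by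
    refine Fin.cases ?_ (fun i => ?_) i
    · exact hR0.le
    · simp only [a, b, Fin.cons_succ]; linarith
  have hbox : ∀ x ∈ Set.Icc a b, T x ∈ s := fun x hx => hx.1 0
  -- The inequality is strict, so that V vanishes on a whole neighbourhood within s and not just at
  -- y.
  have hdiv0 : ∀ y ∈ s, (∃ i, R < |y i|) → fderivWithin ℝ V s y = 0 := by
    intro y hy ⟨i, hi⟩
    have hev : V =ᶠ[nhdsWithin y s] fun _ => 0 := by
      have : ∀ᶠ z : EuclideanSpace ℝ (Fin (k + 1)) in nhds y, R < |z i| :=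
        (continuous_abs.comp (EuclideanSpace.proj (𝕜 := ℝ) i).continuous).continuousAt.eventually
          (lt_mem_nhds hi)
      filter_upwards [mem_nhdsWithin_of_mem_nhds this, self_mem_nhdsWithin] with z hz hzs
      exact hVR z hzs ⟨i, le_of_lt hz⟩
    rw [hev.fderivWithin_eq (hev.self_of_nhdsWithin hy)]
    simp
  have hmp := PiLp.volume_preserving_toLp (Fin (k + 1))
  have hme : MeasurableEmbedding (WithLp.toLp 2 : (Fin (k + 1) → ℝ) → _) :=
    (MeasurableEquiv.toLp 2 (Fin (k + 1) → ℝ)).measurableEmbedding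
  rw [← hmp.setIntegral_preimage_emb hme]
  have hsub : Set.Icc a b ⊆ WithLp.toLp 2 ⁻¹' s := fun x hx => hbox x hx
  rw [setIntegral_eq_of_subset_of_forall_sdiff_eq_zero (hsc.measurableSet.preimage hme.measurable) hsub]
  swap
  · rintro x ⟨hxs, hx⟩
    have : ∃ i, R < |(WithLp.toLp 2 x : EuclideanSpace ℝ (Fin (k + 1))) i| := by
      by_contra! hc
      refine hx ⟨fun i => ?_, fun i => (abs_le.1 (hc i)).2⟩
      refine Fin.cases ?_ (fun i => ?_) i
      · exact hxs
      · exact (abs_le.1 (hc i.succ)).1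
    simp [hdiv0 _ hxs this]
  have hVc : ContinuousOn (fun x => V (T x)) (Set.Icc a b) :=
    hV.continuousOn.comp T.continuous.continuousOn hbox
  have hdc : ContinuousOn (fun x => ∑ i, fderivWithin ℝ V s (T x) (EuclideanSpace.single i 1) i)
      (Set.Icc a b) := by
    have h1 := (hV.continuousOn_fderivWithin hu le_rfl).comp T.continuous.continuousOn hbox
    refine continuousOn_finsetSum _ fun i _ => ?_
    exact (continuous_apply i).comp_continuousOn (h1.clm_apply continuousOn_const)
  have key := integral_divergence_of_hasFDerivAt_off_countable a b hab (fun x => V (T x))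
    (fun x => fderivWithin ℝ V s (T x) ∘L T) ∅ Set.countable_empty hVc ?_ ?_
  · have e1 : ∀ x i, (fderivWithin ℝ V s (T x) ∘L T) (Pi.single i 1) i =
        fderivWithin ℝ V s (WithLp.toLp 2 x) (EuclideanSpace.single i 1) i := fun x i => rfl
    simp only [e1] at key
    rw [key, Fin.sum_univ_succ, Finset.sum_eq_zero, add_zero]
    · have h1 : ∀ x : Fin k → ℝ, x ∈ Set.Icc (a ∘ Fin.succAbove 0) (b ∘ Fin.succAbove 0) →
          V (T (Fin.insertNth 0 (b 0) x)) 0 = 0 := fun x hx => by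
        rw [hVR]
        · rfl
        · change 0 ≤ R
          exact hR0.le
        · exact ⟨0, le_abs_self R⟩
      rw [setIntegral_congr_fun measurableSet_Icc h1]
      simp only [integral_zero, zero_sub, neg_inj]
      have hmp' := PiLp.volume_preserving_toLp (Fin k)
      have hme' : MeasurableEmbedding (WithLp.toLp 2 : (Fin k → ℝ) → _) :=
        (MeasurableEquiv.toLp 2 (Fin k → ℝ)).measurableEmbedding
      rw [← hmp'.integral_comp hme', ← setIntegral_univ (f := fun x : Fin k → ℝ => V (incl k (WithLp.toLp 2 x)) 0),
        setIntegral_eq_of_subset_of_forall_sdiff_eq_zero (t := Set.univ) MeasurableSet.univ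
          (Set.subset_univ (Set.Icc (a ∘ Fin.succAbove 0) (b ∘ Fin.succAbove 0)))]
      · refine integral_congr_ae (Filter.Eventually.of_forall fun x => ?_)
        have : T (Fin.insertNth 0 (a 0) x) = incl k (WithLp.toLp 2 x) := by
          rw [hT, Fin.insertNth_zero']
          rfl
        simp only [this]
      · rintro x ⟨-, hx⟩
        rw [hVR]
        · rfl
        · exact le_refl (0 : ℝ)
        · by_contra! hc
          refine hx ⟨fun i => ?_, fun i => ?_⟩
          · exact (abs_le.1 (hc i.succ).le).1
          · exact (abs_le.1 (hc i.succ).le).2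
    · intro i _
      have h1 : ∀ c : ℝ, |c| = R → ∀ x ∈ Set.Icc (a ∘ Fin.succAbove i.succ) (b ∘ Fin.succAbove i.succ),
          V (T (Fin.insertNth i.succ c x)) i.succ = 0 := fun c hc x hx => by
        rw [hVR]
        · rfl
        · change 0 ≤ (Fin.insertNth i.succ c x : Fin (k + 1) → ℝ) 0
          cases k with
          | zero => exact i.elim0
          | succ k =>
            have h00 : i.succ.succAbove 0 = 0 := Fin.succ_succAbove_zero i
            rw [← h00, Fin.insertNth_apply_succAbove]
            have := hx.1 0
            simp only [Function.comp_apply, h00, a, Fin.cons_zero] at this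
            exact this
        · refine ⟨i.succ, ?_⟩
          change R ≤ |(Fin.insertNth i.succ c x : Fin (k + 1) → ℝ) i.succ|
          rw [Fin.insertNth_apply_same, hc]
      rw [setIntegral_congr_fun measurableSet_Icc (h1 (b i.succ) (abs_of_pos hR0)),
        setIntegral_congr_fun measurableSet_Icc (h1 (a i.succ) (by simp [a, abs_of_pos hR0]))]
      simp
  · rintro x ⟨hx, -⟩
    have hxs : T x ∈ interior s := by
      refine mem_interior.2 ⟨{y | 0 < y 0}, fun y (hy : 0 < y 0) => le_of_lt hy, ?_, ?_⟩
      · exact isOpen_lt continuous_const (EuclideanSpace.proj (𝕜 := ℝ) 0).continuous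
      · exact (hx 0 trivial).1
    have hn : s ∈ nhds (T x) := mem_interior_iff_mem_nhds.1 hxs
    have h1 : HasFDerivAt V (fderivWithin ℝ V s (T x)) (T x) :=
      ((hV.differentiableOn (by simp)) (T x) (interior_subset hxs)).hasFDerivWithinAt.hasFDerivAt hn
    exact h1.comp x T.hasFDerivAt
  · exact hdc.integrableOn_compact isCompact_Icc

/-- Stokes' theorem on the half space, for forms with compact support. -/
theorem integral_coordD_halfSpace {k : ℕ} {θ : EuclideanSpace ℝ (Fin (k + 1)) → Lam (k + 1)}
    (hθ : ContDiffOn ℝ 1 θ {y | 0 ≤ y 0}) {K : Set (EuclideanSpace ℝ (Fin (k + 1)))}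
    (hK : IsCompact K) (h0 : ∀ y, 0 ≤ y 0 → y ∉ K → θ y = 0) :
    ∫ y in {y : EuclideanSpace ℝ (Fin (k + 1)) | 0 ≤ y 0}, top (coordD {y | 0 ≤ y 0} θ y) =
    -∫ u, top (pb (incl k) (θ (incl k u))) := by
  -- The vector field has components Vᵢ = top(dxⁱ ∧ θ), so that its divergence is the top
  -- coefficient of dθ.
  let P : Fin (k + 1) → Lam (k + 1) →L[ℝ] ℝ := fun i =>
    top ∘L mulL (ExteriorAlgebra.ι ℝ (coBasis (k + 1) i))
  have hu : UniqueDiffOn ℝ {y : EuclideanSpace ℝ (Fin (k + 1)) | 0 ≤ y 0} :=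
    range_modelWithCornersEuclideanHalfSpace (k + 1) ▸ (𝓡∂ (k + 1)).uniqueDiffOn
  have hsc : IsClosed {y : EuclideanSpace ℝ (Fin (k + 1)) | 0 ≤ y 0} :=
    range_modelWithCornersEuclideanHalfSpace (k + 1) ▸ (𝓡∂ (k + 1)).isClosed_range
  have h1 := integral_divergence_halfSpace (V := fun y i => P i (θ y))
    (contDiffOn_pi.2 fun i => (P i).contDiff.comp_contDiffOn hθ) hK
    (fun y hy hyK => by funext i; simp [h0 y hy hyK])
  have e0 : ∀ u, P 0 (θ (incl k u)) = top (pb (incl k) (θ (incl k u))) := fun u => top_ι_mul _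
  simp only [e0] at h1
  rw [← h1]
  refine setIntegral_congr_fun hsc.measurableSet fun y hy => ?_
  have hd := (hθ.differentiableOn (by simp)) y hy
  have h2 : HasFDerivWithinAt (fun y i => P i (θ y))
      (ContinuousLinearMap.pi fun i => P i ∘L fderivWithin ℝ θ {y | 0 ≤ y 0} y) {y | 0 ≤ y 0} y :=
    hasFDerivWithinAt_pi.2 fun i => (P i).hasFDerivAt.comp_hasFDerivWithinAt y hd.hasFDerivWithinAt
  simp only [h2.fderivWithin (hu y hy), coordD, map_sum]
  rfl

/-! ### Integration in charts -/

section ChartIntegral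

variable {m : ℕ} {H : Type*} [TopologicalSpace H]
  {I : ModelWithCorners ℝ (EuclideanSpace ℝ (Fin m)) H}
  {N : Type*} [TopologicalSpace N] [ChartedSpace H N] [IsManifold I ∞ N]

variable (I) in
theorem measurableSet_extChartAt_target (x : N) : MeasurableSet (extChartAt I x).target := by
  rw [extChartAt_target]
  exact ((chartAt H x).open_target.preimage I.continuous_symm).measurableSet.inter
    I.isClosed_range.measurableSet

variable (I) in
theorem measurableSet_target_preimage (x : N) {U : Set N} (hU : IsOpen U) :
    MeasurableSet {y | y ∈ (extChartAt I x).target ∧ (extChartAt I x).symm y ∈ U} := by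
  obtain ⟨u, hu, hu'⟩ := continuousOn_iff'.1 (continuousOn_extChartAt_symm (I := I) x) U hU
  have : {y | y ∈ (extChartAt I x).target ∧ (extChartAt I x).symm y ∈ U} =
      u ∩ (extChartAt I x).target := by
    rw [← hu']; ext y; exact and_comm
  rw [this]
  exact hu.measurableSet.inter (measurableSet_extChartAt_target I x)

variable (I) in
/-- The integral over the chart at `x` of the density that is `g` with respect to the identification
of the tangent spaces with `ℝᵐ`. -/
def chartIntegral (x : N) (g : N → ℝ) : ℝ :=
  ∫ y in (extChartAt I x).target, |(tangentCoordChange I x ((extChartAt I x).symm y)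
    ((extChartAt I x).symm y)).det| * g ((extChartAt I x).symm y)

variable (I) in
theorem tangentCoordChange_comp_eq {w x y z : N} (hw : z ∈ (extChartAt I w).source)
    (hx : z ∈ (extChartAt I x).source) (hy : z ∈ (extChartAt I y).source) :
    tangentCoordChange I x y z ∘L tangentCoordChange I w x z = tangentCoordChange I w y z :=
  ContinuousLinearMap.ext fun _ => tangentCoordChange_comp ⟨⟨hw, hx⟩, hy⟩

theorem ContinuousLinearMap.det_comp_eq {E : Type*} [NormedAddCommGroup E] [NormedSpace ℝ E]
    (A C : E →L[ℝ] E) : (A ∘L C).det = A.det * C.det := LinearMap.det_comp _ _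

variable (I) in
theorem det_tangentCoordChange_ne_zero {x y z : N} (hx : z ∈ (extChartAt I x).source)
    (hy : z ∈ (extChartAt I y).source) : (tangentCoordChange I x y z).det ≠ 0 := by
  have h := congrArg ContinuousLinearMap.det (tangentCoordChange_comp_eq I hx hy hx)
  rw [ContinuousLinearMap.det_comp_eq, show tangentCoordChange I x x z = ContinuousLinearMap.id ℝ _ from
    ContinuousLinearMap.ext fun v => tangentCoordChange_self hx] at h
  intro h0
  rw [h0, mul_zero] at h
  simp [ContinuousLinearMap.det] at h

/-- Both integrals live on the overlap of the charts, and the transition map carries one to the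
other. The Jacobians agree by the cocycle rule for coordinate changes. -/
theorem chartIntegral_congr_chart {x y : N} {g : N → ℝ}
    (hx : ∀ z, z ∉ (extChartAt I x).source → g z = 0) (hy : ∀ z, z ∉ (extChartAt I y).source → g z = 0) :
    chartIntegral I x g = chartIntegral I y g := by
  have hred : ∀ x y : N, (∀ z, z ∉ (extChartAt I y).source → g z = 0) → chartIntegral I x g =
      ∫ u in {u | u ∈ (extChartAt I x).target ∧ (extChartAt I x).symm u ∈ (extChartAt I y).source},
        |(tangentCoordChange I x ((extChartAt I x).symm u) ((extChartAt I x).symm u)).det| *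
          g ((extChartAt I x).symm u) := by
    intro x y hy
    refine setIntegral_eq_of_subset_of_forall_sdiff_eq_zero (measurableSet_extChartAt_target I x)
      (fun u hu => hu.1) fun u hu => ?_
    rw [hy _ fun h => hu.2 ⟨hu.1, h⟩, mul_zero]
  rw [hred x y hy, hred y x hx]
  set A := {u | u ∈ (extChartAt I x).target ∧ (extChartAt I x).symm u ∈ (extChartAt I y).source}
  have himg : {u | u ∈ (extChartAt I y).target ∧ (extChartAt I y).symm u ∈ (extChartAt I x).source} =
      (extChartAt I y ∘ (extChartAt I x).symm) '' A := by
    ext v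
    constructor
    · rintro ⟨hv, hv'⟩
      refine ⟨extChartAt I x ((extChartAt I y).symm v), ⟨(extChartAt I x).map_source hv', ?_⟩, ?_⟩
      · rw [(extChartAt I x).left_inv hv']; exact (extChartAt I y).map_target hv
      · rw [Function.comp_apply, (extChartAt I x).left_inv hv', (extChartAt I y).right_inv hv]
    · rintro ⟨u, ⟨hu, hu'⟩, rfl⟩
      refine ⟨(extChartAt I y).map_source hu', ?_⟩
      rw [Function.comp_apply, (extChartAt I y).left_inv hu']
      exact (extChartAt I x).map_target hu
  rw [himg, integral_image_eq_integral_abs_det_fderiv_smul volume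
    (f' := fun u => tangentCoordChange I x y ((extChartAt I x).symm u))
    (measurableSet_target_preimage I x (isOpen_extChartAt_source y))]
  · refine setIntegral_congr_fun (measurableSet_target_preimage I x (isOpen_extChartAt_source y))
      fun u hu => ?_
    have hz := (extChartAt I x).map_target hu.1
    simp only [Function.comp_apply, (extChartAt I y).left_inv hu.2, smul_eq_mul]
    rw [← tangentCoordChange_comp_eq I hz hu.2 (mem_extChartAt_source _),
      ContinuousLinearMap.det_comp_eq, abs_mul]
    ring
  · intro u hu
    have hz := (extChartAt I x).map_target hu.1
    have := hasFDerivWithinAt_tangentCoordChange (I := I) ⟨hz, hu.2⟩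
    rw [(extChartAt I x).right_inv hu.1] at this
    exact this.mono fun v hv => extChartAt_target_subset_range x hv.1
  · intro u hu v hv huv
    have h1 := (extChartAt I y).injOn hu.2 hv.2 huv
    exact (extChartAt I x).symm.injOn hu.1 hv.1 h1

/-- The orientation in the chart at `x`, compared with the standard one. -/
def MOrientation.chartSign (o : MOrientation I (N := N)) (x z : N) : ℝ :=
  o.sgn z * Real.sign (tangentCoordChange I x z z).det

/-- The factors on the left refer to the preferred chart at a moving point and may jump. Since |det|
= sign(det) · det and pull-back scales the top coefficient by det, their product is a sign times a
smooth coefficient in the fixed chart at x. -/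
theorem MOrientation.chartSign_mul_top (o : MOrientation I (N := N)) (x : N) (η : DForm I N)
    (y : EuclideanSpace ℝ (Fin m)) :
    |(tangentCoordChange I x ((extChartAt I x).symm y) ((extChartAt I x).symm y)).det| *
      (o.sgn ((extChartAt I x).symm y) * top (formAt η ((extChartAt I x).symm y))) =
    o.chartSign x ((extChartAt I x).symm y) * top (chartRep I η x y) := by
  rw [chartRep_of_eq η rfl, top_pb, chartSign]
  have : ∀ d : ℝ, |d| = Real.sign d * d := fun d => by
    rcases lt_trichotomy d 0 with h | h | h
    · rw [Real.sign_of_neg h, abs_of_neg h]; ring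
    · simp [h]
    · rw [Real.sign_of_pos h, abs_of_pos h]; ring
  rw [this]
  ring

theorem Real.sign_mul_eq (a b : ℝ) : Real.sign (a * b) = Real.sign a * Real.sign b := by
  rcases lt_trichotomy a 0 with h | h | h <;> rcases lt_trichotomy b 0 with h' | h' | h' <;>
    simp [*, Real.sign_of_neg, Real.sign_of_pos, mul_pos_of_neg_of_neg, mul_neg_of_neg_of_pos,
      mul_neg_of_pos_of_neg]

theorem continuousWithinAt_tangentCoordChange_det {x y z : N} (hx : z ∈ (extChartAt I x).source)
    (hy : z ∈ (extChartAt I y).source) :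
    ContinuousAt (fun w => (tangentCoordChange I x y w).det) z := by
  have h := (continuousOn_tangentCoordChange (I := I) x y z ⟨hx, hy⟩).continuousAt
    (Filter.inter_mem (extChartAt_source_mem_nhds' hx) (extChartAt_source_mem_nhds' hy))
  exact ContinuousLinearMap.continuous_det.continuousAt.comp h

/-- A jump of the preferred chart at z that reverses orientation also reverses `sgn z`, by the local
compatibility of the orientation; the product of the two signs is thus locally constant. -/
theorem MOrientation.eventually_chartSign (o : MOrientation I (N := N)) {x z₀ : N}
    (hz : z₀ ∈ (extChartAt I x).source) :
    ∀ᶠ z in nhds z₀, o.chartSign x z = o.chartSign x z₀ := by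
  have hz' := mem_extChartAt_source (I := I) z₀
  have h0 := det_tangentCoordChange_ne_zero I hz hz'
  have hc := continuousWithinAt_tangentCoordChange_det hz hz'
  have hev : ∀ᶠ z in nhds z₀, Real.sign (tangentCoordChange I x z₀ z).det =
      Real.sign (tangentCoordChange I x z₀ z₀).det := by
    rcases lt_or_gt_of_ne h0 with h | h
    · filter_upwards [hc.eventually (gt_mem_nhds h)] with z hz
      rw [Real.sign_of_neg hz, Real.sign_of_neg h]
    · filter_upwards [hc.eventually (lt_mem_nhds h)] with z hz
      rw [Real.sign_of_pos hz, Real.sign_of_pos h]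
  filter_upwards [hev, o.locally_const z₀, extChartAt_source_mem_nhds' (I := I) hz,
    extChartAt_source_mem_nhds' (I := I) hz'] with z h1 h2 h3 h4
  have h5 := congrArg ContinuousLinearMap.det
    (tangentCoordChange_comp_eq I h3 (mem_extChartAt_source z) h4)
  rw [ContinuousLinearMap.det_comp_eq] at h5
  rw [chartSign, chartSign, ← h1, ← h5, Real.sign_mul_eq]
  rcases o.sgn_eq z₀ with e0 | e0 <;> rcases o.sgn_eq z with e | e <;> rw [e0, e] at h2 <;>
    rw [e0, e] <;>
    first
    | (rw [Real.sign_of_pos (r := (tangentCoordChange I z z₀ z).det) (by linarith)]; ring)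
    | (rw [Real.sign_of_neg (r := (tangentCoordChange I z z₀ z).det) (by linarith)]; ring)

theorem MOrientation.continuousOn_chartSign (o : MOrientation I (N := N)) (x : N) :
    ContinuousOn (o.chartSign x) (extChartAt I x).source := fun _ hz =>
  ((continuousAt_const (y := _)).congr ((o.eventually_chartSign hz).mono fun _ h => h.symm)).continuousWithinAt

theorem extD_eq_zero_of_eventually {η : DForm I N} (hη : IsSmoothDForm η) {z : N}
    (h : ∀ᶠ w in nhds z, η w = 0) : extD I η z = 0 := by
  have hy := mem_extChartAt_target (I := I) z
  have hc := continuousAt_extChartAt_symm'' hy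
  rw [ContinuousAt, extChartAt_to_inv] at hc
  have hev : chartRep I η z =ᶠ[nhdsWithin (extChartAt I z z) (Set.range I)] fun _ => 0 := by
    filter_upwards [mem_nhdsWithin_of_mem_nhds (hc h)] with y hy
    rw [chartRep_of_eq η rfl, formAt, hy]
    exact map_zero _
  change formAt (extD I η) z = 0
  rw [extD_eq_coordD hη, coordD_congr hev (hev.self_of_nhdsWithin (extChartAt_target_subset_range z hy)),
    coordD_const]

/-- The product of a function and a form. -/
def smulForm (c : N → ℝ) (η : DForm I N) : DForm I N := fun z => c z • η z

theorem chartRep_smulForm (c : N → ℝ) (η : DForm I N) (x : N) (y : EuclideanSpace ℝ (Fin m)) :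
    chartRep I (smulForm c η) x y = c ((extChartAt I x).symm y) • chartRep I η x y :=
  map_smul (pb (tangentCoordChange I x _ _)) (c _) (formAt η _)

theorem IsSmoothDForm.smulForm {c : N → ℝ} (hc : ContMDiff I 𝓘(ℝ, ℝ) ∞ c) {η : DForm I N}
    (hη : IsSmoothDForm η) : IsSmoothDForm (smulForm c η) := by
  intro x
  rw [show chartRep I (_root_.smulForm c η) x = _ from funext fun y => chartRep_smulForm c η x y]
  have h := contMDiffOn_iff_contDiffOn.1
    (hc.comp_contMDiffOn (contMDiffOn_extChartAt_symm (I := I) (n := ∞) x))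
  exact fun y hy => ContDiffWithinAt.fun_smul (h y hy) (hη x y hy)

theorem isCompact_image_extChartAt {x : N} {K : Set N} (hK : IsCompact K)
    (hKx : K ⊆ (extChartAt I x).source) : IsCompact (extChartAt I x '' K) :=
  hK.image_of_continuousOn ((continuousOn_extChartAt x).mono hKx)

theorem image_extChartAt_subset {x : N} {K : Set N} (hKx : K ⊆ (extChartAt I x).source) :
    extChartAt I x '' K ⊆ (extChartAt I x).target := by
  rintro _ ⟨z, hz, rfl⟩
  exact (extChartAt I x).map_source (hKx hz)

theorem symm_notMem_of_notMem_image {x : N} {K : Set N} {y : EuclideanSpace ℝ (Fin m)}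
    (hy : y ∈ (extChartAt I x).target) (h : y ∉ extChartAt I x '' K) :
    (extChartAt I x).symm y ∉ K := fun hK => h ⟨_, hK, (extChartAt I x).right_inv hy⟩

/-- Integrability of a smooth form with compact support in a chart. -/
theorem MOrientation.integrableOn_chart (o : MOrientation I (N := N)) {x : N} {K : Set N}
    (hK : IsCompact K) (hKx : K ⊆ (extChartAt I x).source) {c : N → ℝ} (hc : Continuous c)
    {η : DForm I N} (hη : IsSmoothDForm η) (h0 : ∀ z, z ∉ K → c z • η z = 0) :
    IntegrableOn (fun y => |(tangentCoordChange I x ((extChartAt I x).symm y) ((extChartAt I x).symm y)).det| *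
      (c ((extChartAt I x).symm y) *
        (o.sgn ((extChartAt I x).symm y) * top (formAt η ((extChartAt I x).symm y)))))
      (extChartAt I x).target := by
  refine integrableOn_of_continuousOn_of_eq_zero (measurableSet_extChartAt_target I x)
    (isCompact_image_extChartAt hK hKx) (image_extChartAt_subset hKx) ?_ fun y hy hyK => ?_
  · have e : ∀ y, |(tangentCoordChange I x ((extChartAt I x).symm y) ((extChartAt I x).symm y)).det| *
      (c ((extChartAt I x).symm y) *
        (o.sgn ((extChartAt I x).symm y) * top (formAt η ((extChartAt I x).symm y)))) =
        c ((extChartAt I x).symm y) *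
          (o.chartSign x ((extChartAt I x).symm y) * top (chartRep I η x y)) := fun y => by
      rw [← o.chartSign_mul_top]; ring
    simp only [e]
    have hs := continuousOn_extChartAt_symm (I := I) x
    exact (hc.comp_continuousOn hs).mul (((o.continuousOn_chartSign x).comp hs
      fun y hy => (extChartAt I x).map_target hy).mul
      (top.continuous.comp_continuousOn (hη x).continuousOn))
  · have h1 := h0 _ (symm_notMem_of_notMem_image hy hyK)
    have h2 : c ((extChartAt I x).symm y) * top (formAt η ((extChartAt I x).symm y)) = 0 := by
      have h3 : c ((extChartAt I x).symm y) • formAt η ((extChartAt I x).symm y) = 0 := h1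
      rw [← smul_eq_mul, ← map_smul, h3, map_zero]
    rw [mul_left_comm (c _), h2]
    simp

end ChartIntegral

/-- The integral in terms of a finite partition of unity. -/
theorem exists_integrate_eq {m : ℕ} {H : Type*} [TopologicalSpace H]
    (I : ModelWithCorners ℝ (EuclideanSpace ℝ (Fin m)) H)
    (N : Type*) [TopologicalSpace N] [ChartedSpace H N] [IsManifold I ∞ N] [T2Space N] [CompactSpace N] :
    ∃ (ρ : N → N → ℝ) (t : Finset N), (∀ x, ContMDiff I 𝓘(ℝ, ℝ) ∞ (ρ x)) ∧
      (∀ x, tsupport (ρ x) ⊆ (extChartAt I x).source) ∧ (∀ z, ∑ x ∈ t, ρ x z = 1) ∧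
      ∀ (sgn : N → ℝ) (η : DForm I N), integrate I sgn η =
        ∑ x ∈ t, chartIntegral I x fun z => ρ x z * (sgn z * top (formAt η z)) := by
  classical
  have hch := Classical.choose_spec (SmoothPartitionOfUnity.exists_isSubordinate_chartAt_source I N)
  set ρ := Classical.choose (SmoothPartitionOfUnity.exists_isSubordinate_chartAt_source I N) with hρ
  have hfin : {x : N | (Function.support (ρ x)).Nonempty}.Finite :=
    ρ.locallyFinite.finite_nonempty_of_compact
  have hzero : ∀ x, x ∉ hfin.toFinset → ∀ z, ρ x z = 0 := fun x hx z => by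
    by_contra h
    exact hx (hfin.mem_toFinset.2 ⟨z, h⟩)
  refine ⟨fun x => ρ x, hfin.toFinset, fun x => (ρ x).contMDiff, fun x => ?_, fun z => ?_, fun sgn η => ?_⟩
  · rw [extChartAt_source]; exact hch x
  · rw [← ρ.sum_eq_one (Set.mem_univ z), finsum_eq_sum_of_support_subset]
    intro x hx
    by_contra h
    exact hx (hzero x h z)
  · have e : ∀ x : N, (∫ y in (extChartAt I x).target,
        ρ x ((extChartAt I x).symm y) * (sgn ((extChartAt I x).symm y) *
          |(tangentCoordChange I x ((extChartAt I x).symm y) ((extChartAt I x).symm y)).det| *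
          (extBasis m).repr (formAt η ((extChartAt I x).symm y)) Finset.univ)) =
        chartIntegral I x fun z => ρ x z * (sgn z * top (formAt η z)) := fun x => by
      refine integral_congr_ae (Filter.Eventually.of_forall fun y => ?_)
      simp only [top, coef_apply]
      ring
    change ∑ᶠ x : N, (∫ y in (extChartAt I x).target,
        ρ x ((extChartAt I x).symm y) * (sgn ((extChartAt I x).symm y) *
          |(tangentCoordChange I x ((extChartAt I x).symm y) ((extChartAt I x).symm y)).det| *
          (extBasis m).repr (formAt η ((extChartAt I x).symm y)) Finset.univ)) = _
    simp only [e]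
    refine finsum_eq_sum_of_support_subset _ fun x hx => ?_
    by_contra h
    refine hx ?_
    simp [chartIntegral, hzero x h]

/-! ### Stokes' theorem -/

section ColumnMatrix

variable {k : ℕ}

/-- The matrix with first column `v` and the columns of `D`. -/
def colMatrix (v : EuclideanSpace ℝ (Fin (k + 1)))
    (D : EuclideanSpace ℝ (Fin k) →L[ℝ] EuclideanSpace ℝ (Fin (k + 1))) :
    Matrix (Fin (k + 1)) (Fin (k + 1)) ℝ :=
  Matrix.of fun r c => (Fin.cons v (fun i => D (EuclideanSpace.single i (1 : ℝ))) :
    Fin (k + 1) → EuclideanSpace ℝ (Fin (k + 1))) c r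

/-- The linear map with matrix `colMatrix v D`. -/
def colMap (v : EuclideanSpace ℝ (Fin (k + 1)))
    (D : EuclideanSpace ℝ (Fin k) →L[ℝ] EuclideanSpace ℝ (Fin (k + 1))) :
    EuclideanSpace ℝ (Fin (k + 1)) →L[ℝ] EuclideanSpace ℝ (Fin (k + 1)) :=
  (EuclideanSpace.proj (𝕜 := ℝ) (0 : Fin (k + 1))).smulRight v + D ∘L tail k

theorem colMap_apply (v : EuclideanSpace ℝ (Fin (k + 1)))
    (D : EuclideanSpace ℝ (Fin k) →L[ℝ] EuclideanSpace ℝ (Fin (k + 1)))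
    (y : EuclideanSpace ℝ (Fin (k + 1))) : colMap v D y = y 0 • v + D (tail k y) := rfl

theorem colMap_single_zero (v : EuclideanSpace ℝ (Fin (k + 1)))
    (D : EuclideanSpace ℝ (Fin k) →L[ℝ] EuclideanSpace ℝ (Fin (k + 1))) :
    colMap v D (EuclideanSpace.single 0 1) = v := by
  have : tail k (EuclideanSpace.single 0 1) = 0 := by ext i; simp [Fin.succ_ne_zero]
  rw [colMap_apply, this]
  simp

theorem colMap_comp_incl (v : EuclideanSpace ℝ (Fin (k + 1)))
    (D : EuclideanSpace ℝ (Fin k) →L[ℝ] EuclideanSpace ℝ (Fin (k + 1))) :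
    colMap v D ∘L incl k = D := by
  ext1 u
  simp [colMap_apply]

theorem det_eq_det_colMatrix (A : EuclideanSpace ℝ (Fin (k + 1)) →L[ℝ] EuclideanSpace ℝ (Fin (k + 1))) :
    A.det = (colMatrix (A (EuclideanSpace.single 0 1)) (A ∘L incl k)).det := by
  rw [ContinuousLinearMap.det, ← LinearMap.det_toMatrix (EuclideanSpace.basisFun (Fin (k + 1)) ℝ).toBasis]
  congr 1
  ext r c
  rw [LinearMap.toMatrix_apply]
  simp only [colMatrix, Matrix.of_apply]
  refine Fin.cases ?_ (fun c => ?_) c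
  · simp
  · simp [incl_single]

theorem det_colMap (v : EuclideanSpace ℝ (Fin (k + 1)))
    (D : EuclideanSpace ℝ (Fin k) →L[ℝ] EuclideanSpace ℝ (Fin (k + 1))) :
    (colMap v D).det = (colMatrix v D).det := by
  rw [det_eq_det_colMatrix, colMap_single_zero, colMap_comp_incl]

theorem comp_colMap (A : EuclideanSpace ℝ (Fin (k + 1)) →L[ℝ] EuclideanSpace ℝ (Fin (k + 1)))
    (v : EuclideanSpace ℝ (Fin (k + 1)))
    (D : EuclideanSpace ℝ (Fin k) →L[ℝ] EuclideanSpace ℝ (Fin (k + 1))) :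
    A ∘L colMap v D = colMap (A v) (A ∘L D) := by
  ext1 y
  simp [colMap_apply]

theorem det_colMap_incl (v : EuclideanSpace ℝ (Fin (k + 1)))
    (F : EuclideanSpace ℝ (Fin k) →L[ℝ] EuclideanSpace ℝ (Fin k)) :
    (colMap v (incl k ∘L F)).det = v 0 * F.det := by
  rw [det_colMap, Matrix.det_succ_row_zero, Fin.sum_univ_succ, Finset.sum_eq_zero, add_zero,
    ContinuousLinearMap.det, ← LinearMap.det_toMatrix (EuclideanSpace.basisFun (Fin k) ℝ).toBasis]
  · simp only [Nat.succ_eq_add_one, colMatrix, Matrix.of_apply, Fin.cons_zero, Fin.val_zero, pow_zero, one_mul]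
    congr 2
  · intro i _
    simp [colMatrix]

/-- The comparison of orientations behind the sign in Stokes' theorem. -/
theorem boundary_sign_identity
    {C C' : EuclideanSpace ℝ (Fin (k + 1)) →L[ℝ] EuclideanSpace ℝ (Fin (k + 1))}
    {D : EuclideanSpace ℝ (Fin k) →L[ℝ] EuclideanSpace ℝ (Fin (k + 1))}
    {T F : EuclideanSpace ℝ (Fin k) →L[ℝ] EuclideanSpace ℝ (Fin k)}
    (hC : C ∘L C' = ContinuousLinearMap.id ℝ _) (hF : incl k ∘L F = C' ∘L D ∘L T)
    (h0 : 0 < C' (EuclideanSpace.single 0 1) 0) (c : ℝ) (X : Lam (k + 1)) :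
    |T.det| * (c * Real.sign (colMatrix (-EuclideanSpace.single 0 1) D).det * top (pb D X)) =
      |F.det| * -(c * Real.sign C.det * top (pb (incl k) (pb C X))) := by
  have hCd : C.det * C'.det = 1 := by
    rw [← ContinuousLinearMap.det_comp_eq, hC]
    simp [ContinuousLinearMap.det]
  have hDT : D ∘L T = C ∘L incl k ∘L F := by
    rw [hF, ← ContinuousLinearMap.comp_assoc C, hC, ContinuousLinearMap.id_comp]
  -- Here T and C are changes of charts on the boundary and on the manifold, D is the derivative of
  -- the inclusion and F its expression in charts. Both sides are the top coefficient of the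
  -- pull-back of X along D ∘ T = C ∘ incl ∘ F.
  have h1 : T.det * top (pb D X) = F.det * top (pb (incl k) (pb C X)) := by
    rw [← top_pb, ← pb_comp, hDT, ← top_pb, ← pb_comp, ← pb_comp]
  -- Apply C' to the map with first column −e₀ and remaining columns D ∘ T. The remaining columns
  -- become those of incl ∘ F, so the determinant is −(C' e₀)₀ det F.
  have h2 : (colMatrix (-EuclideanSpace.single 0 1) D).det * T.det =
      -(C' (EuclideanSpace.single 0 1) 0 * F.det * C.det) := by
    have e1 : colMap (-EuclideanSpace.single 0 1) D ∘L
        colMap (EuclideanSpace.single 0 1) (incl k ∘L T) =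
          colMap (-EuclideanSpace.single 0 1) (D ∘L T) := by
      rw [comp_colMap, colMap_single_zero, ← ContinuousLinearMap.comp_assoc, colMap_comp_incl]
    have e2 := congrArg ContinuousLinearMap.det e1
    rw [ContinuousLinearMap.det_comp_eq, det_colMap_incl, det_colMap] at e2
    have e3 := congrArg ContinuousLinearMap.det
      (comp_colMap C' (-EuclideanSpace.single 0 1) (D ∘L T))
    rw [ContinuousLinearMap.det_comp_eq, ← hF, det_colMap_incl, ← e2] at e3
    simp only [map_neg, PiLp.neg_apply, EuclideanSpace.single, PiLp.single_apply, if_true] at e3 ⊢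
    linear_combination C.det * e3 - hCd * (colMatrix (-EuclideanSpace.single 0 1) D).det * T.det
  have h3 : Real.sign (colMatrix (-EuclideanSpace.single 0 1) D).det * Real.sign T.det =
      -(Real.sign F.det * Real.sign C.det) := by
    rw [← Real.sign_mul_eq, h2, Real.sign_neg, Real.sign_mul_eq, Real.sign_mul_eq, Real.sign_of_pos h0,
      one_mul]
  have habs : ∀ d : ℝ, |d| = Real.sign d * d := fun d => by
    rcases lt_trichotomy d 0 with h | h | h
    · rw [Real.sign_of_neg h, abs_of_neg h]; ring
    · simp [h]
    · rw [Real.sign_of_pos h, abs_of_pos h]; ring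
  rw [habs T.det, habs F.det]
  linear_combination (c * Real.sign (colMatrix (-EuclideanSpace.single 0 1) D).det * Real.sign T.det) * h1 +
    (c * F.det * top (pb (incl k) (pb C X))) * h3

end ColumnMatrix

/-! ### Boundary points in charts, and Stokes' theorem in one chart -/

section Stokes

variable {k : ℕ} {N : Type*} [TopologicalSpace N] [ChartedSpace (EuclideanHalfSpace (k + 1)) N]
  [IsManifold (𝓡∂ (k + 1)) ∞ N]

theorem extChartAt_zero_nonneg (x z : N) : 0 ≤ (extChartAt (𝓡∂ (k + 1)) x z) 0 := by
  have : extChartAt (𝓡∂ (k + 1)) x z ∈ Set.range (𝓡∂ (k + 1)) := by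
    rw [extChartAt_coe]; exact Set.mem_range_self _
  rwa [range_modelWithCornersEuclideanHalfSpace] at this

/-- Being an interior point can be tested in any chart of the atlas, and the interior of the half
space is y₀ > 0. -/
theorem mem_boundary_iff {x z : N} (hz : z ∈ (extChartAt (𝓡∂ (k + 1)) x).source) :
    z ∈ (𝓡∂ (k + 1)).boundary N ↔ (extChartAt (𝓡∂ (k + 1)) x z) 0 = 0 := by
  have hz' := hz
  rw [extChartAt_source] at hz'
  have h1 := (𝓡∂ (k + 1)).isInteriorPoint_iff_of_mem_atlas (M := N) (n := ∞) (by simp)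
    (chart_mem_atlas _ x) hz'
  have h2 : extChartAt (𝓡∂ (k + 1)) x z ∈ interior (extChartAt (𝓡∂ (k + 1)) x).target ↔
      0 < (extChartAt (𝓡∂ (k + 1)) x z) 0 := by
    have h3 : extChartAt (𝓡∂ (k + 1)) x z ∈ interior (Set.range (𝓡∂ (k + 1))) ↔
      0 < (extChartAt (𝓡∂ (k + 1)) x z) 0 := by
      rw [interior_range_modelWithCornersEuclideanHalfSpace]; rfl
    rw [← h3]
    refine ⟨fun h => interior_mono (extChartAt_target_subset_range x) h, fun h => ?_⟩
    rw [mem_interior_iff_mem_nhds] at h ⊢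
    have h4 := extChartAt_target_mem_nhdsWithin_of_mem ((extChartAt (𝓡∂ (k + 1)) x).map_source hz)
    rwa [nhdsWithin_eq_nhds.2 h] at h4
  change (𝓡∂ (k + 1)).IsBoundaryPoint z ↔ _
  rw [ModelWithCorners.isBoundaryPoint_iff_not_isInteriorPoint, h1]
  change ¬ (extChartAt (𝓡∂ (k + 1)) x z ∈ interior (extChartAt (𝓡∂ (k + 1)) x).target) ↔ _
  rw [h2, not_lt]
  exact ⟨fun h => le_antisymm h (extChartAt_zero_nonneg x z), fun h => h.le⟩

/-- At the boundary, changes of charts preserve the inward direction. -/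
theorem tangentCoordChange_single_zero_pos {x z : N} (hz : z ∈ (extChartAt (𝓡∂ (k + 1)) x).source)
    (hb : z ∈ (𝓡∂ (k + 1)).boundary N) :
    0 < tangentCoordChange (𝓡∂ (k + 1)) z x z (EuclideanSpace.single 0 1) 0 := by
  set C' := tangentCoordChange (𝓡∂ (k + 1)) z x z with hC'
  set y₀ := extChartAt (𝓡∂ (k + 1)) z z with hy₀
  have hz0 : y₀ 0 = 0 := (mem_boundary_iff (mem_extChartAt_source z)).1 hb
  have hx0 := (mem_boundary_iff hz).1 hb
  have hd := hasFDerivWithinAt_tangentCoordChange (I := 𝓡∂ (k + 1)) ⟨mem_extChartAt_source z, hz⟩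
  have hd0 : HasFDerivWithinAt (fun y => (extChartAt (𝓡∂ (k + 1)) x ((extChartAt (𝓡∂ (k + 1)) z).symm y)) 0)
      (EuclideanSpace.proj (𝕜 := ℝ) (0 : Fin (k + 1)) ∘L C') (Set.range (𝓡∂ (k + 1))) y₀ :=
    (EuclideanSpace.proj (𝕜 := ℝ) (0 : Fin (k + 1))).hasFDerivAt.comp_hasFDerivWithinAt y₀ hd
  -- The zeroth coordinate in the chart at x is nonnegative and vanishes at the boundary point z, so
  -- z is a minimum along the half space and the derivative is nonnegative in inward directions.
  have hmin : IsLocalMinOn (fun y => (extChartAt (𝓡∂ (k + 1)) x ((extChartAt (𝓡∂ (k + 1)) z).symm y)) 0)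
      (Set.range (𝓡∂ (k + 1))) y₀ := by
    refine Filter.Eventually.of_forall fun y => ?_
    change (extChartAt (𝓡∂ (k + 1)) x ((extChartAt (𝓡∂ (k + 1)) z).symm y₀)) 0 ≤ _
    rw [hy₀, extChartAt_to_inv, hx0]
    exact extChartAt_zero_nonneg x _
  have hdir : ∀ v : EuclideanSpace ℝ (Fin (k + 1)), 0 ≤ v 0 → 0 ≤ C' v 0 := by
    intro v hv
    refine hmin.hasFDerivWithinAt_nonneg hd0 (mem_posTangentConeAt_of_segment_subset ?_)
    rw [range_modelWithCornersEuclideanHalfSpace]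
    rintro _ ⟨a, b, ha, hb, hab, rfl⟩
    change 0 ≤ (a • y₀ + b • (y₀ + v)) 0
    simp only [PiLp.add_apply, PiLp.smul_apply, smul_eq_mul, hz0]
    have := mul_nonneg hb hv
    linarith
  refine lt_of_le_of_ne (hdir _ (by simp)) fun h => ?_
  -- If the derivative also vanished on e₀, it would vanish everywhere, since directions in the
  -- hyperplane are inward together with their negatives. This contradicts the invertibility of the
  -- coordinate change.
  have hall : ∀ v, C' v 0 = 0 := by
    intro v
    have hker : ∀ u : EuclideanSpace ℝ (Fin (k + 1)), u 0 = 0 → C' u 0 = 0 := fun u hu => by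
      have h1 := hdir u hu.ge
      have h2 := hdir (-u) (by simp [hu])
      rw [map_neg, PiLp.neg_apply] at h2
      linarith
    have hv : v = v 0 • EuclideanSpace.single 0 1 + (v - v 0 • EuclideanSpace.single 0 1) := by abel
    rw [hv, map_add, map_smul, PiLp.add_apply, PiLp.smul_apply, ← h,
      hker (v - v 0 • EuclideanSpace.single 0 1) (by simp)]
    simp
  have hid := tangentCoordChange_comp_eq_id' (𝓡∂ (k + 1)) hz
  have := congrArg (fun L => (L (EuclideanSpace.single 0 1)) 0) hid
  simp only [ContinuousLinearMap.comp_apply] at this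
  rw [← hC', hall] at this
  simp at this

open Classical in
/-- A form with support in the chart at `x`, read in this chart with the orientation sign. -/
def chartForm (o : MOrientation (𝓡∂ (k + 1)) (N := N)) (θ : DForm (𝓡∂ (k + 1)) N) (x : N)
    (y : EuclideanSpace ℝ (Fin (k + 1))) : Lam (k + 1) :=
  if y ∈ (extChartAt (𝓡∂ (k + 1)) x).target then
    o.chartSign x ((extChartAt (𝓡∂ (k + 1)) x).symm y) • chartRep (𝓡∂ (k + 1)) θ x y else 0

variable {o : MOrientation (𝓡∂ (k + 1)) (N := N)} {θ : DForm (𝓡∂ (k + 1)) N} {x : N} {K : Set N}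

theorem chartForm_of_mem {y : EuclideanSpace ℝ (Fin (k + 1))}
    (hy : y ∈ (extChartAt (𝓡∂ (k + 1)) x).target) : chartForm o θ x y =
      o.chartSign x ((extChartAt (𝓡∂ (k + 1)) x).symm y) • chartRep (𝓡∂ (k + 1)) θ x y := if_pos hy

theorem chartForm_of_notMem {y : EuclideanSpace ℝ (Fin (k + 1))}
    (hy : y ∉ (extChartAt (𝓡∂ (k + 1)) x).target) : chartForm o θ x y = 0 := if_neg hy

theorem chartForm_eq_zero (h0 : ∀ z, z ∉ K → θ z = 0) {y : EuclideanSpace ℝ (Fin (k + 1))}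
    (hy : y ∉ extChartAt (𝓡∂ (k + 1)) x '' K) : chartForm o θ x y = 0 := by
  by_cases hyt : y ∈ (extChartAt (𝓡∂ (k + 1)) x).target
  · rw [chartForm_of_mem hyt, chartRep_of_eq θ rfl, formAt, h0 _ (symm_notMem_of_notMem_image hyt hy)]
    exact (congrArg _ (map_zero _)).trans (smul_zero _)
  · exact chartForm_of_notMem hyt

theorem chartForm_eventuallyEq {y : EuclideanSpace ℝ (Fin (k + 1))}
    (hy : y ∈ (extChartAt (𝓡∂ (k + 1)) x).target) :
    chartForm o θ x =ᶠ[nhdsWithin y (Set.range (𝓡∂ (k + 1)))] fun v =>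
      o.chartSign x ((extChartAt (𝓡∂ (k + 1)) x).symm y) • chartRep (𝓡∂ (k + 1)) θ x v := by
  have hc := continuousAt_extChartAt_symm'' hy
  filter_upwards [extChartAt_target_mem_nhdsWithin_of_mem hy, mem_nhdsWithin_of_mem_nhds
    (hc (o.eventually_chartSign ((extChartAt (𝓡∂ (k + 1)) x).map_target hy)))] with v hv hv'
  rw [chartForm_of_mem hv]
  congr 1

theorem chartForm_eventuallyEq_zero (hK : IsCompact K)
    (hKx : K ⊆ (extChartAt (𝓡∂ (k + 1)) x).source) (h0 : ∀ z, z ∉ K → θ z = 0)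
    {y : EuclideanSpace ℝ (Fin (k + 1))} (hy : y ∉ (extChartAt (𝓡∂ (k + 1)) x).target) :
    chartForm o θ x =ᶠ[nhdsWithin y (Set.range (𝓡∂ (k + 1)))] fun _ => 0 := by
  have hyK : y ∉ extChartAt (𝓡∂ (k + 1)) x '' K := fun h => hy (image_extChartAt_subset hKx h)
  filter_upwards [mem_nhdsWithin_of_mem_nhds
    ((isCompact_image_extChartAt hK hKx).isClosed.isOpen_compl.mem_nhds hyK)] with v hv
  exact chartForm_eq_zero h0 hv

theorem contDiffOn_chartForm (hθ : IsSmoothDForm θ) (hK : IsCompact K)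
    (hKx : K ⊆ (extChartAt (𝓡∂ (k + 1)) x).source) (h0 : ∀ z, z ∉ K → θ z = 0) :
    ContDiffOn ℝ 1 (chartForm o θ x) (Set.range (𝓡∂ (k + 1))) := by
  intro y hy
  by_cases hyt : y ∈ (extChartAt (𝓡∂ (k + 1)) x).target
  · have h := chartForm_eventuallyEq (o := o) (θ := θ) hyt
    refine ContDiffWithinAt.congr_of_eventuallyEq ?_ h (h.self_of_nhdsWithin hy)
    exact contDiffWithinAt_const.fun_smul ((hθ.contDiffWithinAt hyt).of_le (by exact_mod_cast le_top))
  · have h := chartForm_eventuallyEq_zero (o := o) hK hKx h0 hyt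
    exact contDiffWithinAt_const.congr_of_eventuallyEq h (h.self_of_nhdsWithin hy)

/-- Stokes' theorem for a form with support in a chart. -/
theorem chartIntegral_extD (hθ : IsSmoothDForm θ) (hK : IsCompact K)
    (hKx : K ⊆ (extChartAt (𝓡∂ (k + 1)) x).source) (h0 : ∀ z, z ∉ K → θ z = 0) :
    chartIntegral (𝓡∂ (k + 1)) x (fun z => o.sgn z * top (formAt (extD (𝓡∂ (k + 1)) θ) z)) =
      -∫ u, top (pb (incl k) (chartForm o θ x (incl k u))) := by
  have hr := range_modelWithCornersEuclideanHalfSpace (k + 1)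
  have h1 := integral_coordD_halfSpace (θ := chartForm o θ x) (hr ▸ contDiffOn_chartForm hθ hK hKx h0)
    (isCompact_image_extChartAt hK hKx) (fun y _ hy => chartForm_eq_zero h0 hy)
  rw [← h1, ← hr, chartIntegral]
  have hu := (𝓡∂ (k + 1)).uniqueDiffOn
  rw [setIntegral_eq_of_subset_of_forall_sdiff_eq_zero (𝓡∂ (k + 1)).isClosed_range.measurableSet
    (extChartAt_target_subset_range x)]
  · refine setIntegral_congr_fun (measurableSet_extChartAt_target (𝓡∂ (k + 1)) x) fun y hy => ?_
    have hyr := extChartAt_target_subset_range x hy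
    have h := chartForm_eventuallyEq (o := o) (θ := θ) hy
    rw [o.chartSign_mul_top, chartRep_extD hθ hy, coordD_congr h (h.self_of_nhdsWithin hyr),
      coordD_const_smul (hu y hyr) (hθ.differentiableWithinAt hy), map_smul, smul_eq_mul]
  · rintro y ⟨hyr, hy⟩
    have h := chartForm_eventuallyEq_zero (o := o) hK hKx h0 hy
    rw [coordD_congr h (h.self_of_nhdsWithin hyr), coordD_const, map_zero]

end Stokes

/-! ### Integrals over the boundary and the global Stokes theorem -/

section BoundaryIntegral

variable {k : ℕ} {N : Type*} [TopologicalSpace N] [ChartedSpace (EuclideanHalfSpace (k + 1)) N]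
  [IsManifold (𝓡∂ (k + 1)) ∞ N] {o : MOrientation (𝓡∂ (k + 1)) (N := N)}
  {θ : DForm (𝓡∂ (k + 1)) N} {x : N} {K : Set N}
  {B : Type*} [TopologicalSpace B] [ChartedSpace (EuclideanSpace ℝ (Fin k)) B] [IsManifold (𝓡 k) ∞ B]
  {j : B → N}

/-- The integrand on the hyperplane that bounds the chart at `x`. -/
def boundaryIntegrand (o : MOrientation (𝓡∂ (k + 1)) (N := N)) (θ : DForm (𝓡∂ (k + 1)) N) (x : N)
    (c : N → ℝ) (u : EuclideanSpace ℝ (Fin k)) : ℝ :=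
  -(c ((extChartAt (𝓡∂ (k + 1)) x).symm (incl k u)) * top (pb (incl k) (chartForm o θ x (incl k u))))

theorem integrable_boundaryIntegrand (hθ : IsSmoothDForm θ) (hK : IsCompact K)
    (hKx : K ⊆ (extChartAt (𝓡∂ (k + 1)) x).source) (h0 : ∀ z, z ∉ K → θ z = 0) {c : N → ℝ}
    (hc : Continuous c) : Integrable (boundaryIntegrand o θ x c) := by
  set T := (extChartAt (𝓡∂ (k + 1)) x).target
  set D : Set (EuclideanSpace ℝ (Fin k)) := incl k ⁻¹' T
  have hD : MeasurableSet D := (measurableSet_extChartAt_target _ x).preimage (incl k).continuous.measurable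
  have hsupp : Function.support (boundaryIntegrand o θ x c) ⊆ D := fun u hu => by
    by_contra h
    refine hu ?_
    rw [boundaryIntegrand, chartForm_of_notMem h]
    simp
  rw [← integrableOn_iff_integrable_of_support_subset hsupp]
  have hK' := isCompact_image_extChartAt hK hKx
  have hcl : IsClosed {y : EuclideanSpace ℝ (Fin (k + 1)) | y 0 = 0} :=
    isClosed_eq (EuclideanSpace.proj (𝕜 := ℝ) (0 : Fin (k + 1))).continuous continuous_const
  -- The support is the slice of a compact set by the hyperplane, projected to ℝᵏ.
  refine integrableOn_of_continuousOn_of_eq_zero (K := tail k '' (extChartAt (𝓡∂ (k + 1)) x '' K ∩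
    {y | y 0 = 0})) hD ((hK'.inter_right hcl).image (tail k).continuous) ?_ ?_ fun u _ hu => ?_
  · rintro _ ⟨y, ⟨hy, hy0⟩, rfl⟩
    change incl k (tail k y) ∈ T
    rw [incl_tail hy0]
    exact image_extChartAt_subset hKx hy
  · have h1 : ContinuousOn (fun u => chartForm o θ x (incl k u)) D := by
      have h2 := (contDiffOn_chartForm (o := o) hθ hK hKx h0).continuousOn
      exact h2.comp (incl k).continuous.continuousOn fun u hu => extChartAt_target_subset_range x hu
    have h3 : ContinuousOn (fun u => (extChartAt (𝓡∂ (k + 1)) x).symm (incl k u)) D :=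
      (continuousOn_extChartAt_symm x).comp (incl k).continuous.continuousOn fun u hu => hu
    have h4 : Continuous fun y : Lam (k + 1) => pb (incl k) y :=
      (LinearMap.toContinuousLinearMap (pb (incl k)).toLinearMap).continuous
    exact ((hc.comp_continuousOn h3).mul (top.continuous.comp_continuousOn (h4.comp_continuousOn h1))).neg
  · rw [boundaryIntegrand, chartForm_eq_zero h0]
    · simp
    · intro h
      exact hu ⟨incl k u, ⟨h, incl_zero u⟩, tail_incl u⟩

/-- The change of variables from a chart of the boundary to the hyperplane that bounds a chart. -/
theorem chartIntegral_boundary (hj : ContMDiff (𝓡 k) (𝓡∂ (k + 1)) ∞ j) (hinj : Function.Injective j)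
    (hrange : Set.range j = (𝓡∂ (k + 1)).boundary N)
    (hKx : K ⊆ (extChartAt (𝓡∂ (k + 1)) x).source) (h0 : ∀ z, z ∉ K → θ z = 0)
    {c : N → ℝ} {b : B} (hcb : ∀ w, w ∉ (extChartAt (𝓡 k) b).source → c (j w) = 0)
    (h_integrable : Integrable (boundaryIntegrand o θ x c)) :
    IntegrableOn (fun u => |(tangentCoordChange (𝓡 k) b ((extChartAt (𝓡 k) b).symm u)
      ((extChartAt (𝓡 k) b).symm u)).det| * (c (j ((extChartAt (𝓡 k) b).symm u)) *
        (boundarySgn o j ((extChartAt (𝓡 k) b).symm u) *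
          top (formAt (pullForm (𝓡∂ (k + 1)) (𝓡 k) j θ) ((extChartAt (𝓡 k) b).symm u)))))
      (extChartAt (𝓡 k) b).target ∧
    chartIntegral (𝓡 k) b (fun w => c (j w) * (boundarySgn o j w *
      top (formAt (pullForm (𝓡∂ (k + 1)) (𝓡 k) j θ) w))) = ∫ u, boundaryIntegrand o θ x c u := by
  set F : EuclideanSpace ℝ (Fin k) → ℝ := fun u =>
    |(tangentCoordChange (𝓡 k) b ((extChartAt (𝓡 k) b).symm u)
      ((extChartAt (𝓡 k) b).symm u)).det| * (c (j ((extChartAt (𝓡 k) b).symm u)) *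
        (boundarySgn o j ((extChartAt (𝓡 k) b).symm u) *
          top (formAt (pullForm (𝓡∂ (k + 1)) (𝓡 k) j θ) ((extChartAt (𝓡 k) b).symm u)))) with hF
  set G := boundaryIntegrand o θ x c with hG
  set A : Set (EuclideanSpace ℝ (Fin k)) := {u | u ∈ (extChartAt (𝓡 k) b).target ∧
    (extChartAt (𝓡 k) b).symm u ∈ j ⁻¹' (extChartAt (𝓡∂ (k + 1)) x).source} with hAdef
  have hopen : IsOpen (j ⁻¹' (extChartAt (𝓡∂ (k + 1)) x).source) :=
    (isOpen_extChartAt_source x).preimage hj.continuous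
  have hA : MeasurableSet A := measurableSet_target_preimage (𝓡 k) b hopen
  have hAT : A ⊆ (extChartAt (𝓡 k) b).target := fun u hu => hu.1
  have hbd : ∀ w, j w ∈ (𝓡∂ (k + 1)).boundary N := fun w => hrange ▸ Set.mem_range_self w
  have hF0 : ∀ u ∈ (extChartAt (𝓡 k) b).target \ A, F u = 0 := fun u hu => by
    have h1 : formAt θ (j ((extChartAt (𝓡 k) b).symm u)) = 0 :=
      h0 _ fun h => hu.2 ⟨hu.1, hKx h⟩
    simp only [hF, formAt_pullForm, h1, map_zero, mul_zero]
  set Ψ := extChartAt (𝓡∂ (k + 1)) x ∘ j ∘ (extChartAt (𝓡 k) b).symm with hΨ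
  let C' : EuclideanSpace ℝ (Fin k) → EuclideanSpace ℝ (Fin k) →L[ℝ] EuclideanSpace ℝ (Fin (k + 1)) := fun u =>
    tangentCoordChange (𝓡∂ (k + 1)) (j ((extChartAt (𝓡 k) b).symm u)) x (j ((extChartAt (𝓡 k) b).symm u)) ∘L
      derivAt (𝓡∂ (k + 1)) (𝓡 k) j ((extChartAt (𝓡 k) b).symm u) ∘L
        tangentCoordChange (𝓡 k) b ((extChartAt (𝓡 k) b).symm u) ((extChartAt (𝓡 k) b).symm u)
  have hr : Set.range (𝓡 k) = Set.univ := (𝓡 k).range_eq_univ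
  have hΨd : ∀ u ∈ A, HasFDerivAt Ψ (C' u) u := fun u hu => by
    have := hasFDerivWithinAt_inCharts hj hu.1 rfl hu.2
    rwa [hr, hasFDerivWithinAt_univ] at this
  have hΨ0 : ∀ u ∈ A, Ψ u 0 = 0 := fun u hu => (mem_boundary_iff hu.2).1 (hbd _)
  have hΦd : ∀ u ∈ A, HasFDerivAt (fun u => tail k (Ψ u)) (tail k ∘L C' u) u := fun u hu =>
    (tail k).hasFDerivAt.comp u (hΨd u hu)
  -- Near u the map Ψ takes values in the hyperplane, so incl ∘ tail ∘ Ψ = Ψ there and the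
  -- derivatives agree.
  have hinclΦ : ∀ u ∈ A, incl k ∘L (tail k ∘L C' u) = C' u := fun u hu => by
    have h1 : HasFDerivAt (fun u => incl k (tail k (Ψ u))) (incl k ∘L (tail k ∘L C' u)) u :=
      (incl k).hasFDerivAt.comp u (hΦd u hu)
    have h2 : (fun u => incl k (tail k (Ψ u))) =ᶠ[nhds u] Ψ := by
      have h3 := eventually_inCharts hj hu.1 hu.2
      rw [hr, nhdsWithin_univ] at h3
      filter_upwards [h3] with v hv
      exact incl_tail (hΨ0 v hv)
    exact (h1.congr_of_eventuallyEq h2.symm).unique (hΨd u hu)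
  have hpt : ∀ u ∈ A, F u = |(tail k ∘L C' u).det| • G (tail k (Ψ u)) := fun u hu => by
    generalize hw : (extChartAt (𝓡 k) b).symm u = w at *
    have hwx : j w ∈ (extChartAt (𝓡∂ (k + 1)) x).source := hw ▸ hu.2
    have hΨu : incl k (tail k (Ψ u)) = extChartAt (𝓡∂ (k + 1)) x (j w) := by
      rw [incl_tail (hΨ0 u hu), hΨ]; simp only [Function.comp_apply, hw]
    have hs : (extChartAt (𝓡∂ (k + 1)) x).symm (extChartAt (𝓡∂ (k + 1)) x (j w)) = j w :=
      (extChartAt (𝓡∂ (k + 1)) x).left_inv hwx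
    have hid := boundary_sign_identity (C := tangentCoordChange (𝓡∂ (k + 1)) x (j w) (j w))
      (C' := tangentCoordChange (𝓡∂ (k + 1)) (j w) x (j w))
      (D := derivAt (𝓡∂ (k + 1)) (𝓡 k) j w) (T := tangentCoordChange (𝓡 k) b w w)
      (F := tail k ∘L C' u) (tangentCoordChange_comp_eq_id _ hwx)
      (by rw [hinclΦ u hu]; simp only [C', hw]) (tangentCoordChange_single_zero_pos hwx (hbd w))
      (o.sgn (j w)) (formAt θ (j w))
    have hsgn : boundarySgn o j w = o.sgn (j w) * Real.sign (colMatrix (-EuclideanSpace.single 0 1)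
      (derivAt (𝓡∂ (k + 1)) (𝓡 k) j w)).det := rfl
    simp only [hF, hG, boundaryIntegrand, hw, smul_eq_mul]
    rw [hΨu, hs, chartForm_of_mem ((extChartAt (𝓡∂ (k + 1)) x).map_source hwx), hs,
      chartRep_of_eq θ hs, formAt_pullForm, hsgn, MOrientation.chartSign, map_smul, map_smul, smul_eq_mul]
    linear_combination c (j w) * hid
  have hinjΦ : Set.InjOn (fun u => tail k (Ψ u)) A := by
    intro u hu v hv huv
    have h1 : Ψ u = Ψ v := by
      rw [← incl_tail (hΨ0 u hu), ← incl_tail (hΨ0 v hv)]; exact congrArg _ huv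
    have h2 := hinj ((extChartAt (𝓡∂ (k + 1)) x).injOn hu.2 hv.2 h1)
    exact (extChartAt (𝓡 k) b).symm.injOn hu.1 hv.1 h2
  -- A point where the integrand is nonzero corresponds to a boundary point of N, hence to j w. The
  -- weight c vanishes off the chart at b, so w lies in that chart and the point is in the image.
  have hG0 : ∀ u, u ∉ (fun u => tail k (Ψ u)) '' A → G u = 0 := by
    intro u hu
    by_contra hne
    refine hu ?_
    have hut : incl k u ∈ (extChartAt (𝓡∂ (k + 1)) x).target := by
      by_contra h
      exact hne (by simp [hG, boundaryIntegrand, chartForm_of_notMem h])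
    have hzs := (extChartAt (𝓡∂ (k + 1)) x).map_target hut
    have hzb : (extChartAt (𝓡∂ (k + 1)) x).symm (incl k u) ∈ (𝓡∂ (k + 1)).boundary N := by
      rw [mem_boundary_iff hzs, (extChartAt (𝓡∂ (k + 1)) x).right_inv hut]
      exact incl_zero u
    rw [← hrange] at hzb
    obtain ⟨w, hw⟩ := hzb
    have hwb : w ∈ (extChartAt (𝓡 k) b).source := by
      by_contra h
      exact hne (by rw [hG, boundaryIntegrand, ← hw, hcb w h]; simp)
    refine ⟨extChartAt (𝓡 k) b w, ⟨(extChartAt (𝓡 k) b).map_source hwb, ?_⟩, ?_⟩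
    · rw [Set.mem_preimage, (extChartAt (𝓡 k) b).left_inv hwb, hw]
      exact hzs
    · simp only [hΨ, Function.comp_apply, (extChartAt (𝓡 k) b).left_inv hwb, hw]
      rw [(extChartAt (𝓡∂ (k + 1)) x).right_inv hut, tail_incl]
  have hΦd' : ∀ u ∈ A, HasFDerivWithinAt (fun u => tail k (Ψ u)) (tail k ∘L C' u) A u := fun u hu =>
    (hΦd u hu).hasFDerivWithinAt
  constructor
  · have h1 := (integrableOn_image_iff_integrableOn_abs_det_fderiv_smul volume hA hΦd' hinjΦ G).1
      h_integrable.integrableOn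
    exact (h1.congr_fun (fun u hu => (hpt u hu).symm) hA).of_forall_sdiff_eq_zero
      (measurableSet_extChartAt_target (𝓡 k) b) hF0
  · rw [chartIntegral]
    rw [← setIntegral_eq_integral_of_forall_compl_eq_zero hG0,
      integral_image_eq_integral_abs_det_fderiv_smul volume hA hΦd' hinjΦ G,
      ← setIntegral_congr_fun hA hpt]
    exact setIntegral_eq_of_subset_of_forall_sdiff_eq_zero
      (measurableSet_extChartAt_target (𝓡 k) b) hAT hF0

/-- Stokes' theorem. -/
theorem integrate_extD [T2Space N] [CompactSpace N] [T2Space B] [CompactSpace B]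
    (o : MOrientation (𝓡∂ (k + 1)) (N := N)) (hj : Manifold.IsSmoothEmbedding (𝓡 k) (𝓡∂ (k + 1)) ∞ j)
    (hrange : Set.range j = (𝓡∂ (k + 1)).boundary N) {η : DForm (𝓡∂ (k + 1)) N} (hη : IsSmoothDForm η) :
    integrate (𝓡∂ (k + 1)) o.sgn (extD (𝓡∂ (k + 1)) η) =
      integrate (𝓡 k) (boundarySgn o j) (pullForm (𝓡∂ (k + 1)) (𝓡 k) j η) := by
  obtain ⟨ρ, t, hρ, hρs, hρ1, hN⟩ := exists_integrate_eq (𝓡∂ (k + 1)) N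
  obtain ⟨σ, t', hσ, hσs, hσ1, hB⟩ := exists_integrate_eq (𝓡 k) B
  have hjs := hj.contMDiff
  set θ : N → DForm (𝓡∂ (k + 1)) N := fun x => smulForm (ρ x) η with hθdef
  have hθ : ∀ x, IsSmoothDForm (θ x) := fun x => hη.smulForm (hρ x)
  have hsum : η = ∑ x ∈ t, θ x := by
    funext z
    rw [Finset.sum_apply]
    change η z = ∑ x ∈ t, ρ x z • η z
    rw [← Finset.sum_smul, hρ1, one_smul]
  have hK : ∀ x, IsCompact (tsupport (ρ x)) := fun x => (isClosed_tsupport _).isCompact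
  have hρ0 : ∀ x z, z ∉ tsupport (ρ x) → ρ x z = 0 := fun x z hz => image_eq_zero_of_notMem_tsupport hz
  have hθ0 : ∀ x z, z ∉ tsupport (ρ x) → θ x z = 0 := fun x z hz => by
    change ρ x z • η z = 0
    rw [hρ0 x z hz, zero_smul]
  have hdθ0 : ∀ x z, z ∉ tsupport (ρ x) → extD (𝓡∂ (k + 1)) (θ x) z = 0 := fun x z hz => by
    refine extD_eq_zero_of_eventually (hθ x) ?_
    filter_upwards [(isClosed_tsupport (ρ x)).isOpen_compl.mem_nhds hz] with w hw
    exact hθ0 x w hw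
  -- the left-hand side
  have hL : integrate (𝓡∂ (k + 1)) o.sgn (extD (𝓡∂ (k + 1)) η) =
      ∑ x ∈ t, -∫ u, top (pb (incl k) (chartForm o (θ x) x (incl k u))) := by
    have e1 : ∀ y z, ρ y z * (o.sgn z * top (formAt (extD (𝓡∂ (k + 1)) η) z)) =
        ∑ x ∈ t, ρ y z * (o.sgn z * top (formAt (extD (𝓡∂ (k + 1)) (θ x)) z)) := fun y z => by
      have : formAt (extD (𝓡∂ (k + 1)) η) z = ∑ x ∈ t, formAt (extD (𝓡∂ (k + 1)) (θ x)) z := by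
        conv_lhs => rw [hsum, extD_sum t fun x _ => hθ x]
        exact Finset.sum_apply z t _
      rw [this, map_sum, Finset.mul_sum, Finset.mul_sum]
    rw [hN]
    -- The form ρ_y dθ_x is supported in both charts, so its integral may be moved from the chart at
    -- y to the chart at x. There the sum over y is carried out with Σ ρ_y = 1.
    have e2 : ∀ y ∈ t, chartIntegral (𝓡∂ (k + 1)) y (fun z => ρ y z * (o.sgn z *
        top (formAt (extD (𝓡∂ (k + 1)) η) z))) = ∑ x ∈ t, chartIntegral (𝓡∂ (k + 1)) x (fun z =>
        ρ y z * (o.sgn z * top (formAt (extD (𝓡∂ (k + 1)) (θ x)) z))) := fun y _ => by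
      simp only [e1, chartIntegral, Finset.mul_sum]
      rw [integral_finsetSum]
      · refine Finset.sum_congr rfl fun x _ => ?_
        refine chartIntegral_congr_chart (g := fun z => ρ y z * (o.sgn z *
          top (formAt (extD (𝓡∂ (k + 1)) (θ x)) z))) (fun z hz => ?_) fun z hz => ?_
        · rw [hρ0 y z fun h => hz (hρs y h), zero_mul]
        · have : formAt (extD (𝓡∂ (k + 1)) (θ x)) z = 0 := hdθ0 x z fun h => hz (hρs x h)
          rw [this, map_zero, mul_zero, mul_zero]
      · intro x _
        exact o.integrableOn_chart (hK y) (hρs y) (hρ y).continuous (hθ x).extD fun z hz => by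
          rw [hρ0 y z hz, zero_smul]
    rw [Finset.sum_congr rfl e2, Finset.sum_comm]
    refine Finset.sum_congr rfl fun x _ => ?_
    rw [← chartIntegral_extD (hθ x) (hK x) (hρs x) (hθ0 x)]
    simp only [chartIntegral]
    rw [← integral_finsetSum]
    · refine integral_congr_ae (Filter.Eventually.of_forall fun y => ?_)
      simp only
      rw [← Finset.mul_sum, ← Finset.sum_mul, hρ1, one_mul]
    · intro y _
      exact o.integrableOn_chart (hK x) (hρs x) (hρ y).continuous (hθ x).extD fun z hz => by
        rw [hdθ0 x z hz, smul_zero]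
  -- the right-hand side
  have hcl : Topology.IsClosedEmbedding j := 
    ⟨hj.isEmbedding, (isCompact_range hj.isEmbedding.continuous).isClosed⟩
  -- The partition functions of B are extended to N by Tietze's theorem, as the weight in
  -- `chartIntegral_boundary` is a function on N. Continuity suffices, since only θ is
  -- differentiated.
  have hext : ∀ b, ∃ c : N → ℝ, Continuous c ∧ ∀ w, c (j w) = σ b w := fun b => by
    obtain ⟨g, hg⟩ := ContinuousMap.exists_extension hcl ⟨σ b, (hσ b).continuous⟩
    exact ⟨g, g.continuous, fun w => DFunLike.congr_fun hg w⟩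
  choose c hc hcj using hext
  have hbc := fun b x => chartIntegral_boundary (o := o) (b := b) (c := c b) hjs hcl.injective hrange
    (hρs x) (hθ0 x) (fun w hw => by
      rw [hcj]; exact image_eq_zero_of_notMem_tsupport fun h => hw (hσs b h))
    (integrable_boundaryIntegrand (hθ x) (hK x) (hρs x) (hθ0 x) (hc b))
  simp only [hcj] at hbc
  have hR : integrate (𝓡 k) (boundarySgn o j) (pullForm (𝓡∂ (k + 1)) (𝓡 k) j η) =
      ∑ b ∈ t', ∑ x ∈ t, ∫ u, boundaryIntegrand o (θ x) x (c b) u := by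
    rw [hB]
    refine Finset.sum_congr rfl fun b _ => ?_
    have e1 : ∀ w, σ b w * (boundarySgn o j w * top (formAt (pullForm (𝓡∂ (k + 1)) (𝓡 k) j η) w)) =
        ∑ x ∈ t, σ b w * (boundarySgn o j w *
          top (formAt (pullForm (𝓡∂ (k + 1)) (𝓡 k) j (θ x)) w)) := fun w => by
      have : formAt (pullForm (𝓡∂ (k + 1)) (𝓡 k) j η) w =
          ∑ x ∈ t, formAt (pullForm (𝓡∂ (k + 1)) (𝓡 k) j (θ x)) w := by
        conv_lhs => rw [hsum, map_sum]
        exact Finset.sum_apply w t _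
      rw [this, map_sum, Finset.mul_sum, Finset.mul_sum]
    simp only [e1, chartIntegral, Finset.mul_sum]
    rw [integral_finsetSum _ fun x _ => (hbc b x).1]
    exact Finset.sum_congr rfl fun x _ => (hbc b x).2
  rw [hL, hR, Finset.sum_comm]
  refine Finset.sum_congr rfl fun x _ => ?_
  rw [← integral_finsetSum _ fun b _ =>
    integrable_boundaryIntegrand (hθ x) (hK x) (hρs x) (hθ0 x) (hc b), ← integral_neg]
  refine integral_congr_ae (Filter.Eventually.of_forall fun u => ?_)
  simp only [boundaryIntegrand]
  rw [Finset.sum_neg_distrib, ← Finset.sum_mul, neg_inj]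
  -- A point of the hyperplane inside the chart comes from some w in B, where the extended weights
  -- add up to 1; outside the chart both sides vanish.
  by_cases hu : incl k u ∈ (extChartAt (𝓡∂ (k + 1)) x).target
  · have hzs := (extChartAt (𝓡∂ (k + 1)) x).map_target hu
    have hzb : (extChartAt (𝓡∂ (k + 1)) x).symm (incl k u) ∈ (𝓡∂ (k + 1)).boundary N := by
      rw [mem_boundary_iff hzs, (extChartAt (𝓡∂ (k + 1)) x).right_inv hu]
      exact incl_zero u
    rw [← hrange] at hzb
    obtain ⟨w, hw⟩ := hzb
    simp only [← hw, hcj]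
    rw [hσ1, one_mul]
  · simp [chartForm_of_notMem hu]

end BoundaryIntegral

end

theorem mainTheorem3 {p n : ℕ} (hp : 0 < p)
    -- the target: a symplectic Q-manifold of degree `p` with body `M`
    {M : Type*} [TopologicalSpace M] [T2Space M] [SecondCountableTopology M]
    [ChartedSpace (EuclideanSpace ℝ (Fin n)) M] [IsManifold (𝓡 n) ∞ M]
    (S : SymplecticQManifold p n M)
    -- the source: a compact oriented manifold `N` of dimension `p + 2` with boundary `B`
    {N : Type*} [TopologicalSpace N] [T2Space N] [CompactSpace N]
    [ChartedSpace (EuclideanHalfSpace (p + 2)) N] [IsManifold (𝓡∂ (p + 2)) ∞ N]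
    (o : MOrientation (𝓡∂ (p + 2)) (N := N))
    {B : Type*} [TopologicalSpace B] [T2Space B] [CompactSpace B]
    [ChartedSpace (EuclideanSpace ℝ (Fin (p + 1))) B] [IsManifold (𝓡 (p + 1)) ∞ B]
    (j : B → N) (hj : Manifold.IsSmoothEmbedding (𝓡 (p + 1)) (𝓡∂ (p + 2)) ∞ j)
    (hrange : Set.range j = (𝓡∂ (p + 2)).boundary N)
    (φ : GradedMap S.toGradedManifold (𝓡∂ (p + 2)) N) :
    (∃! f, IsFieldStrength S.global S.Q.toFun φ.pull f) ∧
    (∃! κ, IsFieldStrength S.global 0 (φ.restrict (𝓡 (p + 1)) j) κ) ∧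
    (∃! h, S.IsHamiltonian (p + 1) h S.Q) ∧
    ∀ f κ h, IsFieldStrength S.global S.Q.toFun φ.pull f →
      IsFieldStrength S.global 0 (φ.restrict (𝓡 (p + 1)) j) κ →
      S.IsHamiltonian (p + 1) h S.Q →
      integrate (𝓡∂ (p + 2)) o.sgn (f S.form) =
        integrate (𝓡 (p + 1)) (boundarySgn o j) (akszLagrangian S (φ.restrict (𝓡 (p + 1)) j) κ h) ∧
      (p = 1 → ∃ br, IsPoissonBracket br ∧ IsDerivedPoisson S (fun a b => br a b) ∧
        (∃ (r : ℕ) (x : Fin r → SmoothFn (𝓡 n) (⊤ : Opens M)) (P : Fin r → S.global.carrier),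
          IsPoissonFrame S x P) ∧
        ∀ (r : ℕ) (x : Fin r → SmoothFn (𝓡 n) (⊤ : Opens M)) (P : Fin r → S.global.carrier),
          IsPoissonFrame S x P →
          akszLagrangian S (φ.restrict (𝓡 (p + 1)) j) κ h =
            poissonLagrangian S (φ.restrict (𝓡 (p + 1)) j) (fun a b => br a b) x P) ∧
      (p = 2 → ∃ pair anchor brk, IsCourantAlgebroid S.global pair anchor brk ∧
        IsDerivedCourant S pair anchor brk ∧
        (∃ (r s : ℕ) (x : Fin r → SmoothFn (𝓡 n) (⊤ : Opens M)) (P : Fin r → S.global.carrier)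
          (ξ : Fin s → S.global.carrier) (g : Matrix (Fin s) (Fin s) ℝ),
          IsCourantFrame S x P ξ g) ∧
        ∀ (r s : ℕ) (x : Fin r → SmoothFn (𝓡 n) (⊤ : Opens M)) (P : Fin r → S.global.carrier)
          (ξ : Fin s → S.global.carrier) (g : Matrix (Fin s) (Fin s) ℝ),
          IsCourantFrame S x P ξ g →
          akszLagrangian S (φ.restrict (𝓡 (p + 1)) j) κ h =
            courantLagrangian S (φ.restrict (𝓡 (p + 1)) j) pair anchor brk
              x P ξ g) := by
  have hφ := φ.isPull
  have hjs := hj.contMDiff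
  have hφB : IsPull (φ.restrict (𝓡 (p + 1)) j) := hφ.comp_pullForm hjs
  refine ⟨hφ.existsUnique_fieldStrength S.Q, hφB.existsUnique_fieldStrength .zeroOne,
    S.existsUnique_hamiltonian_Q hp, fun f κ h hf hκ hh => ⟨?_, ?_, ?_⟩⟩
  · obtain ⟨κN, hκN, -⟩ := hφ.existsUnique_fieldStrength GradedFnAlg.VField.zeroOne
    -- The homomorphism for the zero vector field also exists on N and restricts to the boundary, so
    -- by uniqueness κ is this restriction. Hence the integrand on the boundary is the pull-back of
    -- the one on N.
    have hκ' : κ = (pullForm (𝓡∂ (p + 2)) (𝓡 (p + 1)) j).comp κN :=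
      hκ.unique (hκN.comp_pullForm hφ hjs)
    have hL : akszLagrangian S (φ.restrict (𝓡 (p + 1)) j) κ h =
        pullForm (𝓡∂ (p + 2)) (𝓡 (p + 1)) j (akszLagrangian S φ.pull κN h) := by
      rw [akszLagrangian, akszLagrangian, map_add, map_smul, hκ']
      rfl
    rw [hL, hf.form_eq hp hφ hκN hh]
    exact integrate_extD o hj hrange (hφ.smooth_akszLagrangian hp hκN h)
  · rintro rfl
    exact ⟨S.derivedBracket, S.isPoissonBracket_derivedBracket, S.isDerivedPoisson_derivedBracket,
      S.exists_isPoissonFrame, fun r x P hf => hf.akszLagrangian_eq hh _ κ hκ⟩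
  · rintro rfl
    exact ⟨S.pairing, S.derivedAnchor, S.dorfman, S.isCourantAlgebroid, S.isDerivedCourant,
      S.exists_isCourantFrame, fun r s x P ξ g hf => hf.akszLagrangian_eq hh _ κ hκ⟩
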